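/- Let $M^5\subset\mathbb{C}^3$ be a local real-analytic real hypersurface passing through the origin, i.e. $M=\{p\in U: r(p)=0\}\ni 0$ with $U\subset\mathbb{C}^3$ open and $r:U\to\mathbb{R}$ real-analytic with $dr\neq 0$ at every point of $M$. Let $T^{1,0}M$ be the bundle of vectors $\sum_j a_j\,\partial/\partial z_j$ in $\mathbb{C}\otimes_{\mathbb{R}}TM$ and $T^{0,1}M=\overline{T^{1,0}M}$. The Levi form of $M$ at $p$ is $$(\mathcal{L},\mathcal{L}')\longmapsto \sqrt{-1}\,[\mathcal{L},\overline{\mathcal{L}'}](p)\ \bmod\ T^{1,0}_pM\oplus T^{0,1}_pM ,$$ where $\mathcal{L},\mathcal{L}'$ are local sections of $T^{1,0}M$; let $K^{1,0}_pM\subset T^{1,0}_pM$ be its kernel. The Freeman form at $p$ is the pairing of $K^{1,0}_pM$ with $T^{1,0}_pM/K^{1,0}_pM$ $$(\mathcal{K},\mathcal{L})\longmapsto [\mathcal{K},\overline{\mathcal{L}}](p)\ \bmod\ K^{1,0}_pM\oplus T^{0,1}_pM ,$$ where $\mathcal{K}$ is a local section of $K^{1,0}M$ and $\mathcal{L}$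 a local section of $T^{1,0}M$. Assume that at every point of $M$ the Levi form has rank $1$ and the Freeman form is nondegenerate. Then there are local holomorphic coordinates $(z_1,z_2,w)$, $w=u+\sqrt{-1}\,v$, centred at the origin, in which $M$ is, near the origin, the graph $$v = z_1\bar z_1+\tfrac12 z_1^2\bar z_2+\tfrac12 z_2\bar z_1^2 + R(z_1,z_2,\bar z_1,\bar z_2)+u\,S(z_1,z_2,\bar z_1,\bar z_2,u),$$ where $R$ and $S$ are real-valued convergent power series in $(z,\bar z)$ and in $(z,\bar z,u)$, of order at least $4$ and at least $2$ respectively, and both remainders $R$ and $uS$ vanish identically, as power series in independent variables $z$, $\bar z$, $u$, when $z=(z_1,z_2)=0$ and also when $\bar z=(\bar z_1,\bar z_2)=0$. -/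

import Mathlib

open Filter Topology Asymptotics ComplexConjugate

noncomputable section

namespace CRGeometry

/-- A local real-analytic real hypersurface of `ℂ^N`: the zero set, in an open set `U`, of a
real-analytic function `r : U → ℝ` whose differential vanishes at no point of this zero set. -/
structure LocalHypersurface (N : ℕ) where
  U : Set (Fin N → ℂ)
  r : (Fin N → ℂ) → ℝ
  isOpen_U : IsOpen U
  analytic_r : AnalyticOnNhd ℝ r U
  regular_r : ∀ p ∈ U, r p = 0 → fderiv ℝ r p ≠ 0

/-- The underlying set of points of the hypersurface. -/
def LocalHypersurface.carrier {N : ℕ} (M : LocalHypersurface N) : Set (Fin N → ℂ) :=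
  {p | p ∈ M.U ∧ M.r p = 0}

/-- Complexified tangent vectors of `ℂ^N`: the pair `(a, b)` stands for
`∑ a_j ∂/∂z_j + ∑ b_j ∂/∂z̄_j`. -/
abbrev CVec (N : ℕ) : Type := (Fin N → ℂ) × (Fin N → ℂ)

/-- `∂f/∂z_j = (∂f/∂x_j - i ∂f/∂y_j) / 2`. -/
def dz {N : ℕ} (f : (Fin N → ℂ) → ℂ) (j : Fin N) (p : Fin N → ℂ) : ℂ :=
  (fderiv ℝ f p (Pi.single j 1) - Complex.I * fderiv ℝ f p (Pi.single j Complex.I)) / 2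

/-- `∂f/∂z̄_j = (∂f/∂x_j + i ∂f/∂y_j) / 2`. -/
def dzbar {N : ℕ} (f : (Fin N → ℂ) → ℂ) (j : Fin N) (p : Fin N → ℂ) : ℂ :=
  (fderiv ℝ f p (Pi.single j 1) + Complex.I * fderiv ℝ f p (Pi.single j Complex.I)) / 2

/-- The derivative at `p` of the function `f` along a complexified tangent vector. -/
def deriveAlong {N : ℕ} (f : (Fin N → ℂ) → ℂ) (p : Fin N → ℂ) : CVec N →ₗ[ℂ] ℂ where
  toFun Z := ∑ j, (Z.1 j * dz f j p + Z.2 j * dzbar f j p)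
  map_add' Z W := by
    rw [← Finset.sum_add_distrib]
    refine Finset.sum_congr rfl fun j _ => ?_
    simp only [Prod.fst_add, Prod.snd_add, Pi.add_apply]
    ring
  map_smul' c Z := by
    simp only [Prod.smul_fst, Prod.smul_snd, Pi.smul_apply, smul_eq_mul, RingHom.id_apply,
      Finset.mul_sum]
    refine Finset.sum_congr rfl fun j _ => ?_
    ring

/-- The Lie bracket of two complex vector fields, computed on coefficients. -/
def bracket {N : ℕ} (Z W : (Fin N → ℂ) → CVec N) (p : Fin N → ℂ) : CVec N :=
  (fun j => deriveAlong (fun q => (W q).1 j) p (Z p) - deriveAlong (fun q => (Z q).1 j) p (W p),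
   fun j => deriveAlong (fun q => (W q).2 j) p (Z p) - deriveAlong (fun q => (Z q).2 j) p (W p))

/-- The complex conjugate of a complex vector field. -/
def conjField {N : ℕ} (Z : (Fin N → ℂ) → CVec N) (p : Fin N → ℂ) : CVec N :=
  (fun j => conj ((Z p).2 j), fun j => conj ((Z p).1 j))

theorem dz_add {N : ℕ} {f g : (Fin N → ℂ) → ℂ} {p : Fin N → ℂ} (j : Fin N)
    (hf : DifferentiableAt ℝ f p) (hg : DifferentiableAt ℝ g p) :
    dz (fun q => f q + g q) j p = dz f j p + dz g j p := by
  simp only [dz, fderiv_fun_add hf hg, add_apply]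
  ring

theorem dzbar_add {N : ℕ} {f g : (Fin N → ℂ) → ℂ} {p : Fin N → ℂ} (j : Fin N)
    (hf : DifferentiableAt ℝ f p) (hg : DifferentiableAt ℝ g p) :
    dzbar (fun q => f q + g q) j p = dzbar f j p + dzbar g j p := by
  simp only [dzbar, fderiv_fun_add hf hg, add_apply]
  ring

theorem deriveAlong_add {N : ℕ} {f g : (Fin N → ℂ) → ℂ} {p : Fin N → ℂ}
    (hf : DifferentiableAt ℝ f p) (hg : DifferentiableAt ℝ g p) (Z : CVec N) :
    deriveAlong (fun q => f q + g q) p Z = deriveAlong f p Z + deriveAlong g p Z := by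
  simp only [deriveAlong, LinearMap.coe_mk, AddHom.coe_mk, dz_add _ hf hg, dzbar_add _ hf hg]
  rw [← Finset.sum_add_distrib]
  refine Finset.sum_congr rfl fun j _ => ?_
  ring

theorem deriveAlong_const_mul {N : ℕ} (c : ℂ) {f : (Fin N → ℂ) → ℂ} {p : Fin N → ℂ}
    (hf : DifferentiableAt ℝ f p) (Z : CVec N) :
    deriveAlong (fun q => c * f q) p Z = c * deriveAlong f p Z := by
  simp only [deriveAlong, LinearMap.coe_mk, AddHom.coe_mk, dz, dzbar, fderiv_const_mul hf c,
    smul_apply, smul_eq_mul, Finset.mul_sum]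
  refine Finset.sum_congr rfl fun j _ => ?_
  ring

theorem differentiableAt_coeff {N : ℕ} {Z : (Fin N → ℂ) → CVec N} {p : Fin N → ℂ}
    (hZ : DifferentiableAt ℝ Z p) (j : Fin N) :
    DifferentiableAt ℝ (fun q => (Z q).1 j) p ∧ DifferentiableAt ℝ (fun q => (Z q).2 j) p :=
  ⟨differentiableAt_pi.1 hZ.fst j, differentiableAt_pi.1 hZ.snd j⟩

theorem bracket_add_left {N : ℕ} {Z Z' : (Fin N → ℂ) → CVec N} {p : Fin N → ℂ}
    (hZ : DifferentiableAt ℝ Z p) (hZ' : DifferentiableAt ℝ Z' p)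
    (W : (Fin N → ℂ) → CVec N) :
    bracket (fun q => Z q + Z' q) W p = bracket Z W p + bracket Z' W p := by
  ext j
  · simp only [bracket, Prod.fst_add, Pi.add_apply, map_add,
      deriveAlong_add (differentiableAt_coeff hZ j).1 (differentiableAt_coeff hZ' j).1]
    ring
  · simp only [bracket, Prod.snd_add, Pi.add_apply, map_add,
      deriveAlong_add (differentiableAt_coeff hZ j).2 (differentiableAt_coeff hZ' j).2]
    ring

theorem bracket_smul_left {N : ℕ} (c : ℂ) {Z : (Fin N → ℂ) → CVec N} {p : Fin N → ℂ}
    (hZ : DifferentiableAt ℝ Z p) (W : (Fin N → ℂ) → CVec N) :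
    bracket (fun q => c • Z q) W p = c • bracket Z W p := by
  ext j
  · simp only [bracket, Prod.smul_fst, Pi.smul_apply, map_smul, smul_eq_mul,
      deriveAlong_const_mul c (differentiableAt_coeff hZ j).1]
    ring
  · simp only [bracket, Prod.smul_snd, Prod.smul_fst, Pi.smul_apply, map_smul, smul_eq_mul,
      deriveAlong_const_mul c (differentiableAt_coeff hZ j).2]
    ring

theorem bracket_zero_left {N : ℕ} (W : (Fin N → ℂ) → CVec N) (p : Fin N → ℂ) :
    bracket (fun _ => 0) W p = 0 := by
  ext j <;> simp [bracket, deriveAlong, dz, dzbar]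

namespace LocalHypersurface

variable {N : ℕ} (M : LocalHypersurface N)

/-- The complexified tangent space `ℂ ⊗ T_p M` (for `p ∈ M`). -/
def CT (p : Fin N → ℂ) : Submodule ℂ (CVec N) :=
  LinearMap.ker (deriveAlong (fun q => (M.r q : ℂ)) p)

/-- The space `T^{1,0}_p M` of the tangent vectors `∑ a_j ∂/∂z_j`. -/
def T10 (p : Fin N → ℂ) : Submodule ℂ (CVec N) :=
  M.CT p ⊓ LinearMap.ker (LinearMap.snd ℂ (Fin N → ℂ) (Fin N → ℂ))

/-- The space `T^{0,1}_p M` of the tangent vectors `∑ b_j ∂/∂z̄_j`. -/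
def T01 (p : Fin N → ℂ) : Submodule ℂ (CVec N) :=
  M.CT p ⊓ LinearMap.ker (LinearMap.fst ℂ (Fin N → ℂ) (Fin N → ℂ))

/-- `L` is (an extension to a neighbourhood of `p` in `ℂ^N` of) a real-analytic section of
`T^{1,0} M` near `p`. -/
def IsT10Section (p : Fin N → ℂ) (L : (Fin N → ℂ) → CVec N) : Prop :=
  AnalyticAt ℝ L p ∧ ∀ᶠ q in 𝓝[M.carrier] p, L q ∈ M.T10 q

/-- The Levi form at `p` on the sections `L`, `L'` of `T^{1,0} M`:
`i [L, L̄'](p)` modulo `T^{1,0}_p M ⊕ T^{0,1}_p M`. -/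
def leviForm (L L' : (Fin N → ℂ) → CVec N) (p : Fin N → ℂ) :
    CVec N ⧸ (M.T10 p ⊔ M.T01 p) :=
  Submodule.Quotient.mk (Complex.I • bracket L (conjField L') p)

/-- The kernel `K^{1,0}_p M ⊆ T^{1,0}_p M` of the Levi form at `p`. As the value of the Levi form
depends only on the values of the sections at `p`, it does not matter by which section `L` a
vector of `T^{1,0}_p M` is extended. -/
def K10 (p : Fin N → ℂ) : Submodule ℂ (CVec N) where
  carrier := {X | ∃ L, M.IsT10Section p L ∧ L p = X ∧
    ∀ L', M.IsT10Section p L' → M.leviForm L L' p = 0}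
  add_mem' := by
    rintro X Y ⟨L₁, hL₁, rfl, h₁⟩ ⟨L₂, hL₂, rfl, h₂⟩
    refine ⟨fun q => L₁ q + L₂ q, ⟨hL₁.1.add hL₂.1, ?_⟩, rfl, fun L' hL' => ?_⟩
    · filter_upwards [hL₁.2, hL₂.2] with q h h' using add_mem h h'
    · have e₁ := h₁ L' hL'
      have e₂ := h₂ L' hL'
      simp only [leviForm] at e₁ e₂ ⊢
      rw [bracket_add_left hL₁.1.differentiableAt hL₂.1.differentiableAt, smul_add,
        Submodule.Quotient.mk_add, e₁, e₂, add_zero]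
  zero_mem' := by
    refine ⟨fun _ => 0, ⟨analyticAt_const, ?_⟩, rfl, fun L' _ => ?_⟩
    · exact Eventually.of_forall fun q => zero_mem _
    · simp only [leviForm]
      rw [bracket_zero_left, smul_zero, Submodule.Quotient.mk_zero]
  smul_mem' := by
    rintro c X ⟨L, hL, rfl, h⟩
    refine ⟨fun q => c • L q, ⟨?_, ?_⟩, rfl, fun L' hL' => ?_⟩
    · exact (analyticAt_const (v := c)).smul hL.1
    · filter_upwards [hL.2] with q hq using Submodule.smul_mem _ c hq
    · have e := h L' hL'
      simp only [leviForm] at e ⊢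
      rw [bracket_smul_left c hL.1.differentiableAt, smul_comm, Submodule.Quotient.mk_smul, e,
        smul_zero]

/-- The rank of the Levi form at `p ∈ M`: the codimension of its kernel in `T^{1,0}_p M`. -/
def leviRank (p : Fin N → ℂ) : ℕ :=
  Module.finrank ℂ (M.T10 p ⧸ (M.K10 p).submoduleOf (M.T10 p))

/-- `K` is (an extension of) a real-analytic section near `p` of the bundle `K^{1,0} M` of the
kernels of the Levi form. -/
def IsK10Section (p : Fin N → ℂ) (K : (Fin N → ℂ) → CVec N) : Prop :=
  M.IsT10Section p K ∧ ∀ᶠ q in 𝓝[M.carrier] p, K q ∈ M.K10 q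

/-- The Freeman form at `p` on a section `K` of `K^{1,0} M` and a section `L` of `T^{1,0} M`:
`[K, L̄](p)` modulo `K^{1,0}_p M ⊕ T^{0,1}_p M`. It depends only on `K(p)` and on `L(p)` modulo
`K^{1,0}_p M`. -/
def freemanForm (K L : (Fin N → ℂ) → CVec N) (p : Fin N → ℂ) :
    CVec N ⧸ (M.K10 p ⊔ M.T01 p) :=
  Submodule.Quotient.mk (bracket K (conjField L) p)

/-- The Freeman form at `p`, as a pairing of `K^{1,0}_p M` with `T^{1,0}_p M / K^{1,0}_p M`, is
nondegenerate on both sides. -/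
def FreemanNondegenerate (p : Fin N → ℂ) : Prop :=
  (∀ K, M.IsK10Section p K → K p ≠ 0 → ∃ L, M.IsT10Section p L ∧ M.freemanForm K L p ≠ 0) ∧
  (∀ L, M.IsT10Section p L → L p ∉ M.K10 p → ∃ K, M.IsK10Section p K ∧ M.freemanForm K L p ≠ 0)

end LocalHypersurface

end CRGeometry

end

/-! ### Power series tools: conjugation, complexification, division by a linear form. -/

noncomputable section

namespace CRGeometry

section AnalyticTools

/-! Replace `z̄` by an independent variable `ζ`. The defining function then becomes a holomorphic
`ρ` with a reality symmetry, and `M` is read on the totally real set `ζ = z̄`.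
`exists_normal_coordinates` straightens a transverse real-analytic curve of `M` together with the
complexified Segre varieties along it. In the new coordinates `M` is `v = F(z, z̄, u)` with `F(z, 0,
u) = F(0, ζ, u) = 0`, so `F` has no pure terms. This is `IsNormalForm`; it survives any change `z ↦
f(z)` of the `z` variables.

Everything of low order is carried by the holomorphic map `g = gmap F`, the coefficient of `F(z, ζ,
0)` that is linear in `ζ`. Three facts about it drive the proof. Levi rank: the Levi determinant
vanishes on `M`, hence identically in `(z, ζ, u)`, because `M` is totally real and maximal in its
complexification. At `ζ = 0`, `u = 0` this says that the Jacobian determinant of `g` vanishes near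
`0` (`eventually_det_gmap`), while `dg(0)` is Hermitian and nonzero. Change of coordinates: under `z
= f(z')` the map `g` is composed with `f` and multiplied only by the constant matrix of the
conjugate of `df(0)` (`gmap_change`). Using `g₁`, suitably scaled, as the first coordinate gives `g₁
= z₁`. The vanishing Jacobian then makes `∂g₂/∂z₂ = 0`. Freeman form: differentiating the Levi
kernel equation along `M` shows that, if every derivative of `∂g₂/∂z₁` vanished at `0`, the Freeman
form would be zero (`exists_fderiv_fderiv_gmap_ne`). So `∂²g₂/∂z₁²(0)` is nonzero, and scaling `z₂`
makes it `1`, that is `g₂ = z₁²/2 + O(3)`.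

Finally, a monomial of degree at most three without pure part is linear in `z` or linear in `ζ`. The
terms linear in `ζ` are given by `g`, those linear in `z` by conjugation, so `F(z, ζ, 0)` agrees
with the model up to order four (`isBigO_pow_four`). The rest of `F` is divisible by `u`; the
quotient `S` vanishes for `z = 0` and for `ζ = 0`, hence has order at least two. -/

theorem radius_pos_of_norm_le {𝕜 E F : Type*} [NontriviallyNormedField 𝕜] [NormedAddCommGroup E]
    [NormedSpace 𝕜 E] [NormedAddCommGroup F] [NormedSpace 𝕜 F]
    (q : FormalMultilinearSeries 𝕜 E F) {C a : ℝ} (ha : 0 < a) (h : ∀ n, ‖q n‖ ≤ C * a ^ n) :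
    0 < q.radius := by
  have h1 : ((Real.toNNReal a⁻¹ : NNReal) : ENNReal) ≤ q.radius := by
    refine q.le_radius_of_bound C fun n => ?_
    rw [Real.coe_toNNReal _ (inv_pos.2 ha).le]
    calc ‖q n‖ * (a⁻¹) ^ n ≤ (C * a ^ n) * (a⁻¹) ^ n := by gcongr; exact h n
      _ = C := by rw [mul_assoc, ← mul_pow, mul_inv_cancel₀ ha.ne', one_pow, mul_one]
  refine lt_of_lt_of_le ?_ h1
  rw [ENNReal.coe_pos, Real.toNNReal_pos]
  exact inv_pos.2 ha

variable {E F : Type*} [NormedAddCommGroup E] [NormedSpace ℂ E]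
  [NormedAddCommGroup F] [NormedSpace ℂ F]

/-- The conjugate of a power series. -/
def starSeries [StarAddMonoid E] [NormedStarGroup E] [StarModule ℂ E]
    [StarAddMonoid F] [NormedStarGroup F] [StarModule ℂ F]
    (p : FormalMultilinearSeries ℂ E F) : FormalMultilinearSeries ℂ E F := fun n =>
  MultilinearMap.mkContinuous
    { toFun := fun m => star (p n fun i => star (m i))
      map_update_add' := by
        intro _ m i x y
        have key : ∀ v : E, (fun j => star (Function.update m i v j))
            = Function.update (fun j => star (m j)) i (star v) := fun v => by
          ext j; by_cases hj : j = i
          · subst hj; simp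
          · simp [hj]
        have := fun v => congrArg (fun f => star (p n f)) (key v)
        convert congrArg star ((p n).map_update_add (fun j => star (m j)) i (star x) (star y))
          using 1
        · rw [← star_add, ← key]
        · rw [star_add, ← key, ← key]
      map_update_smul' := by
        intro _ m i c x
        have key : ∀ v : E, (fun j => star (Function.update m i v j))
            = Function.update (fun j => star (m j)) i (star v) := fun v => by
          ext j; by_cases hj : j = i
          · subst hj; simp
          · simp [hj]
        convert congrArg star ((p n).map_update_smul (fun j => star (m j)) i (star c) (star x))
          using 1
        · rw [← star_smul, ← key]
        · rw [star_smul, star_star, ← key] }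
    ‖p n‖ (fun m => by
      simp only [MultilinearMap.coe_mk, norm_star]
      simpa using (p n).le_opNorm fun i => star (m i))

/-- Conjugating in the source and in the target undoes the antilinearity. The conjugated
coefficients have no larger norms, so the radius does not shrink. This provides the `ζ`-half of
every complexified coordinate change. -/
theorem analyticAt_star_star [StarAddMonoid E] [NormedStarGroup E] [StarModule ℂ E]
    [StarAddMonoid F] [NormedStarGroup F] [StarModule ℂ F] [CompleteSpace F]
    {f : E → F} {x : E} (hf : AnalyticAt ℂ f (star x)) :
    AnalyticAt ℂ (fun y => star (f (star y))) x := by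
  obtain ⟨p, r, hp⟩ := hf
  have hle : p.radius ≤ (starSeries p).radius := by
    refine ENNReal.le_of_forall_nnreal_lt fun s hs => ?_
    obtain ⟨C, -, hC⟩ := p.norm_mul_pow_le_of_lt_radius hs
    refine (starSeries p).le_radius_of_bound C fun n => (le_trans ?_ (hC n))
    gcongr
    exact MultilinearMap.mkContinuous_norm_le _ (norm_nonneg _) _
  refine ⟨starSeries p, r, hp.r_le.trans hle, hp.r_pos, fun {y} hy => ?_⟩
  have hy' : star y ∈ Metric.eball (0 : E) r := by
    simp only [Metric.mem_eball, edist_zero_right, enorm_eq_nnnorm] at hy ⊢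
    simpa using hy
  have := (hp.hasSum hy')
  have h2 := this.map (starAddEquiv : F ≃+ F).toAddMonoidHom (continuous_star)
  simpa [Function.comp_def, star_add, starSeries] using h2

/-- Real-analytic functions extend to holomorphic functions. -/
theorem exists_complexification {ι E W : Type*} [Fintype ι] [NormedAddCommGroup E] [NormedSpace ℝ E]
    [NormedAddCommGroup W] [NormedSpace ℂ W] {f : E → ℂ} (hf : AnalyticAt ℝ f 0)
    (e : ι → E) (c : ι → W →L[ℂ] ℂ) (t : ι → E → ℝ) (j : E → W) (hj : ContinuousAt j 0)
    (hj0 : j 0 = 0) (hc : ∀ i x, c i (j x) = t i x) (hx : ∀ x, x = ∑ i, t i x • e i) :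
    ∃ g : W → ℂ, AnalyticAt ℂ g 0 ∧ ∀ᶠ x in 𝓝 0, g (j x) = f x := by
  classical
  obtain ⟨p, r, hp⟩ := hf
  -- Expand `p n` in the spanning vectors `e i` and replace the real coordinates `t i` by the
  -- complex functionals `c i`.
  let q : FormalMultilinearSeries ℂ W ℂ := fun n =>
    ∑ v : Fin n → ι, (p n fun k => e (v k)) •
      (ContinuousMultilinearMap.mkPiAlgebra ℂ (Fin n) ℂ).compContinuousLinearMap fun k => c (v k)
  obtain ⟨C, a, hC, ha, hpn⟩ := p.le_mul_pow_of_radius_pos (hp.r_pos.trans_le hp.r_le)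
  set B : ℝ := ∑ i, ‖e i‖ + 1
  set D : ℝ := ∑ i, ‖c i‖ + 1
  have hB : 0 < B := by positivity
  have hD : 0 < D := by positivity
  have heB : ∀ i, ‖e i‖ ≤ B := fun i =>
    (Finset.single_le_sum (f := fun i => ‖e i‖) (fun _ _ => norm_nonneg _)
      (Finset.mem_univ i)).trans (by simp [B])
  have hcD : ∀ i, ‖c i‖ ≤ D := fun i =>
    (Finset.single_le_sum (f := fun i => ‖c i‖) (fun _ _ => norm_nonneg _)
      (Finset.mem_univ i)).trans (by simp [D])
  have hq : 0 < q.radius := by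
    -- The power of the cardinality counts the monomials of degree `n`; the `+ 1` keeps the ratio
    -- positive when `ι` is empty.
    refine radius_pos_of_norm_le q (C := C) (a := (Fintype.card ι + 1) * (a * B * D))
      (by positivity) fun n => ?_
    calc ‖q n‖ ≤ ∑ v : Fin n → ι, C * (a * B * D) ^ n := by
          refine norm_sum_le_of_le _ fun v _ => ?_
          rw [norm_smul]
          have h1 : ‖p n fun k => e (v k)‖ ≤ C * a ^ n * B ^ n := by
            refine ((p n).le_opNorm _).trans ?_
            refine mul_le_mul (hpn n) ?_ (by positivity) (by positivity)
            calc ∏ k, ‖e (v k)‖ ≤ ∏ _k : Fin n, B :=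
                  Finset.prod_le_prod (fun _ _ => norm_nonneg _) fun k _ => heB _
              _ = B ^ n := by simp
          have h2 : ‖(ContinuousMultilinearMap.mkPiAlgebra ℂ (Fin n) ℂ).compContinuousLinearMap
              fun k => c (v k)‖ ≤ D ^ n := by
            refine (ContinuousMultilinearMap.norm_compContinuousLinearMap_le _ _).trans ?_
            rw [ContinuousMultilinearMap.norm_mkPiAlgebra, one_mul]
            calc ∏ k, ‖c (v k)‖ ≤ ∏ _k : Fin n, D :=
                  Finset.prod_le_prod (fun _ _ => norm_nonneg _) fun k _ => hcD _
              _ = D ^ n := by simp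
          calc _ ≤ (C * a ^ n * B ^ n) * D ^ n := by gcongr
            _ = _ := by ring_nf
      _ = C * ((Fintype.card ι : ℝ) * (a * B * D)) ^ n := by
          simp [mul_pow]; ring_nf
      _ ≤ _ := by gcongr; simp
  refine ⟨q.sum, (q.hasFPowerSeriesOnBall hq).analyticAt, ?_⟩
  have h1 : ∀ᶠ x in 𝓝 (0 : E), j x ∈ Metric.eball (0 : W) q.radius := by
    refine hj.eventually_mem ?_
    rw [hj0]; exact Metric.eball_mem_nhds _ hq
  have h2 : ∀ᶠ x in 𝓝 (0 : E), x ∈ Metric.eball (0 : E) r := Metric.eball_mem_nhds _ hp.r_pos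
  filter_upwards [h1, h2] with x hx1 hx2
  have e1 := hp.hasSum hx2
  rw [zero_add] at e1
  have e2 := (q.hasFPowerSeriesOnBall hq).hasSum hx1
  rw [zero_add] at e2
  refine e2.unique (e1.congr_fun ?_)
  intro n
  have key : p n (fun _ => x) = ∑ v : Fin n → ι, p n (fun k => t (v k) x • e (v k)) := by
    conv_lhs => rw [hx x]
    exact (p n).map_sum (fun (_ : Fin n) i => t i x • e i)
  rw [key]
  simp only [q, sum_apply, smul_apply,
    ContinuousMultilinearMap.compContinuousLinearMap_apply, hc,
    ContinuousMultilinearMap.mkPiAlgebra_apply, smul_eq_mul]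
  refine Finset.sum_congr rfl fun v _ => ?_
  rw [(p n).map_smul_univ, Complex.real_smul]
  push_cast
  ring

/-- A holomorphic function vanishing on a totally real subspace vanishes. -/
theorem eventually_eq_zero_of_totallyReal {G : E → ℂ} (hG : AnalyticAt ℂ G 0) {V : Set E}
    {a b : E → E} (ha : ContinuousAt a 0) (hb : ContinuousAt b 0) (ha0 : a 0 = 0) (hb0 : b 0 = 0)
    (hab : ∀ x, a x + Complex.I • b x = x) (hV : ∀ (x : E) (t : ℝ), a x + (t : ℂ) • b x ∈ V)
    (h : ∀ᶠ x in 𝓝 0, x ∈ V → G x = 0) : ∀ᶠ x in 𝓝 0, G x = 0 := by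
  obtain ⟨ε, hε, hball⟩ := Metric.eventually_nhds_iff_ball.1 (hG.eventually_analyticAt.and h)
  have h1 : ∀ᶠ x in 𝓝 (0 : E), ‖a x‖ < ε / 3 := by
    have := ha.norm
    refine this.eventually_lt_const ?_
    simpa [ha0] using by positivity
  have h2 : ∀ᶠ x in 𝓝 (0 : E), ‖b x‖ < ε / 3 := by
    have := hb.norm
    refine this.eventually_lt_const ?_
    simpa [hb0] using by positivity
  filter_upwards [h1, h2] with x hx1 hx2
  have hmem : ∀ s ∈ Metric.ball (0 : ℂ) 2, a x + s • b x ∈ Metric.ball (0 : E) ε := fun s hs => by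
    rw [mem_ball_zero_iff] at hs ⊢
    calc ‖a x + s • b x‖ ≤ ‖a x‖ + ‖s‖ * ‖b x‖ := by
          refine (norm_add_le _ _).trans ?_
          rw [norm_smul]
      _ ≤ ‖a x‖ + 2 * ‖b x‖ := by gcongr
      _ < ε := by linarith
  have hA : AnalyticOnNhd ℂ (fun s : ℂ => G (a x + s • b x)) (Metric.ball 0 2) := fun s hs => by
    refine AnalyticAt.fun_comp (g := G) (f := fun s : ℂ => a x + s • b x)
      (hball _ (hmem s hs)).1 ?_
    exact analyticAt_const.add (analyticAt_id.smul analyticAt_const)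
  -- On the complex line `s ↦ a x + s • b x` the function vanishes at small real `s`, hence
  -- everywhere by the identity theorem. The radius `2` makes room for `s = i`, which returns `x`.
  have hz : Set.EqOn (fun s : ℂ => G (a x + s • b x)) 0 (Metric.ball 0 2) := by
    refine hA.eqOn_zero_of_preconnected_of_frequently_eq_zero
      (convex_ball _ _).isPreconnected (z₀ := 0) (by simp) ?_
    have hT : Tendsto (fun t : ℝ => (t : ℂ)) (𝓝[≠] 0) (𝓝[≠] 0) := by
      refine tendsto_nhdsWithin_iff.2 ⟨?_, ?_⟩
      · exact (Complex.continuous_ofReal.tendsto' 0 0 (by simp)).mono_left nhdsWithin_le_nhds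
      · filter_upwards [self_mem_nhdsWithin] with t ht
        simpa using ht
    refine hT.frequently (Eventually.frequently ?_)
    have : ∀ᶠ t : ℝ in 𝓝[≠] 0, (t : ℂ) ∈ Metric.ball (0 : ℂ) 2 :=
      hT.eventually (nhdsWithin_le_nhds (Metric.ball_mem_nhds _ (by norm_num)))
    filter_upwards [this] with t ht
    exact (hball _ (hmem _ ht)).2 (hV x t)
  have := hz (show Complex.I ∈ Metric.ball (0 : ℂ) 2 by simp)
  simpa [hab] using this

/-- Replace the arguments `x` by `x - ℓ x • e` one slot at a time: each step changes a single slot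
by `ℓ x • e`, so a factor `ℓ x` comes out. -/
theorem telescope_multilinear {n : ℕ} (p : E [×(n + 1)]→L[ℂ] F) (ℓ : E →L[ℂ] ℂ) (e x : E) :
    p (fun _ => x) - p (fun _ => x - ℓ x • e)
      = ℓ x • ∑ k : Fin (n + 1), p (k.insertNth e fun i =>
        if k.succAbove i ≤ k then x else x - ℓ x • e) := by
  let T : ℕ → F := fun k => p fun i : Fin (n + 1) => if i.val < k then x else x - ℓ x • e
  have h0 : T 0 = p (fun _ => x - ℓ x • e) := by simp [T]
  have h1 : T (n + 1) = p (fun _ => x) := by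
    simp only [T]; congr 1; ext i; rw [if_pos i.isLt]
  rw [← h0, ← h1, ← Finset.sum_range_sub, Finset.smul_sum, Finset.sum_range]
  refine Finset.sum_congr rfl fun k _ => ?_
  let m : Fin (n + 1) → E := fun i => if i.val < k then x else x - ℓ x • e
  have e1 : T (k + 1) = p (Function.update m k x) := by
    simp only [T]; congr 1; ext i
    by_cases hi : i = k
    · subst hi; simp
    · have hi' : i.val ≠ k := fun h => hi (Fin.ext h)
      simp only [Function.update_of_ne hi, m]
      by_cases h : i.val < k
      · simp [h, Nat.lt_succ_of_lt h]
      · rw [if_neg h, if_neg (by omega)]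
  have e2 : T k = p (Function.update m k (x - ℓ x • e)) := by
    simp only [T]; congr 1; ext i
    by_cases hi : i = k
    · subst hi; simp
    · simp [hi, m]
  -- Since `k.succAbove i'` never equals `k`, the test `≤ k` here agrees with the strict test that
  -- defines `T`.
  have e3 : k.insertNth e (fun i => if k.succAbove i ≤ k then x else x - ℓ x • e)
      = Function.update m k e := by
    ext i
    by_cases hi : i = k
    · subst hi; simp
    · obtain ⟨i', rfl⟩ := Fin.exists_succAbove_eq hi
      have hne : (k.succAbove i').val ≠ k := fun h => hi (Fin.ext h)
      simp only [Fin.insertNth_apply_succAbove, Function.update_of_ne hi, m, Fin.le_def]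
      by_cases h : (k.succAbove i').val < k
      · rw [if_pos h, if_pos h.le]
      · rw [if_neg h, if_neg (by omega)]
  rw [e1, e2, e3, ← p.map_update_sub, sub_sub_cancel, p.map_update_smul]

/-- Division of an analytic function by a linear form. -/
theorem exists_division [CompleteSpace F] {H : E → F} (hH : AnalyticAt ℂ H 0) (ℓ : E →L[ℂ] ℂ)
    (e : E) :
    ∃ S : E → F, AnalyticAt ℂ S 0 ∧ ∀ᶠ x in 𝓝 0, H x - H (x - ℓ x • e) = ℓ x • S x := by
  obtain ⟨p, r, hp⟩ := hH
  obtain ⟨C, a, hC, ha, hpn⟩ := p.le_mul_pow_of_radius_pos (hp.r_pos.trans_le hp.r_le)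
  let π : E →L[ℂ] E := ContinuousLinearMap.id ℂ E - ℓ.smulRight e
  -- The quotient is formed degree by degree: the telescoped form of `p (n + 1)`, with `ℓ x`
  -- removed, has degree `n`.
  let q : FormalMultilinearSeries ℂ E F := fun n => ∑ k : Fin (n + 1),
    ((p (n + 1)).compContinuousLinearMap
      (fun i => if i ≤ k then ContinuousLinearMap.id ℂ E else π)).curryMid k e
  have hqa : ∀ n x, q n (fun _ => x) = ∑ k : Fin (n + 1), p (n + 1) (k.insertNth e fun i =>
        if k.succAbove i ≤ k then x else x - ℓ x • e) := by
    intro n x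
    simp only [q, sum_apply, ContinuousMultilinearMap.curryMid_apply,
      ContinuousMultilinearMap.compContinuousLinearMap_apply]
    refine Finset.sum_congr rfl fun k _ => ?_
    congr 1
    ext i
    by_cases hi : i = k
    · subst hi; simp
    · obtain ⟨i', rfl⟩ := Fin.exists_succAbove_eq hi
      simp only [Fin.insertNth_apply_succAbove]
      split_ifs <;> simp [π]
  set B : ℝ := ‖π‖ + 1
  have hB : 1 ≤ B := by simp [B]
  have hq : 0 < q.radius := by
    refine radius_pos_of_norm_le q (C := C * a * B * ‖e‖) (a := 2 * a * B) (by positivity)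
      fun n => ?_
    calc ‖q n‖ ≤ ∑ _k : Fin (n + 1), C * a ^ (n + 1) * B ^ (n + 1) * ‖e‖ := by
          refine norm_sum_le_of_le _ fun k _ => ?_
          refine (ContinuousLinearMap.le_opNorm _ _).trans ?_
          rw [ContinuousMultilinearMap.norm_curryMid]
          gcongr
          refine (ContinuousMultilinearMap.norm_compContinuousLinearMap_le _ _).trans ?_
          refine mul_le_mul (hpn _) ?_ (by positivity) (by positivity)
          calc _ ≤ ∏ _k : Fin (n + 1), B := by
                refine Finset.prod_le_prod (fun _ _ => norm_nonneg _) fun i _ => ?_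
                split_ifs
                · exact ContinuousLinearMap.norm_id_le.trans hB
                · simp [B]
            _ = B ^ (n + 1) := by simp
      _ = (n + 1) * (C * a ^ (n + 1) * B ^ (n + 1) * ‖e‖) := by simp
      -- The `n + 1` summands are absorbed into a geometric bound.
      _ ≤ 2 ^ n * (C * a ^ (n + 1) * B ^ (n + 1) * ‖e‖) := by
          gcongr
          have : n + 1 ≤ 2 ^ n := Nat.lt_two_pow_self
          exact_mod_cast this
      _ = _ := by ring_nf
  refine ⟨q.sum, (q.hasFPowerSeriesOnBall hq).analyticAt, ?_⟩
  have hπ : Tendsto (fun x : E => x - ℓ x • e) (𝓝 0) (𝓝 0) := by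
    have : Continuous fun x : E => x - ℓ x • e := by fun_prop
    exact this.tendsto' 0 0 (by simp)
  have hb : ∀ᶠ x in 𝓝 (0 : E), x ∈ Metric.eball (0 : E) r := Metric.eball_mem_nhds _ hp.r_pos
  have h1 : ∀ᶠ x in 𝓝 (0 : E), x ∈ Metric.eball (0 : E) q.radius := Metric.eball_mem_nhds _ hq
  filter_upwards [hb, hπ.eventually hb, h1] with x hx1 hx2 hx3
  have s1 := hp.hasSum hx1
  have s2 := hp.hasSum hx2
  have s3 := (q.hasFPowerSeriesOnBall hq).hasSum hx3
  simp only [zero_add] at s1 s2 s3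
  have s4 := s1.sub s2
  -- The constant terms of the two expansions cancel; dropping them aligns degree `n + 1` of `p`
  -- with degree `n` of `q`.
  rw [← hasSum_nat_add_iff' 1] at s4
  have s5 := s3.const_smul (ℓ x)
  have h := s4.unique (s5.congr_fun fun n => by rw [hqa, telescope_multilinear])
  have h00 : (fun _ : Fin 0 => x) = fun _ => x - ℓ x • e := Subsingleton.elim _ _
  simpa [h00] using h

theorem exists_implicit [CompleteSpace E] {G : E × ℂ → ℂ} (hG : AnalyticAt ℂ G 0) (h0 : G 0 = 0)
    (hd : fderiv ℂ G 0 (0, 1) ≠ 0) :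
    ∃ f : E → ℂ, AnalyticAt ℂ f 0 ∧ f 0 = 0 ∧ ∀ᶠ p in 𝓝 (0 : E × ℂ), G p = 0 ↔ p.2 = f p.1 := by
  have hc : ContDiffAt ℂ ⊤ G 0 := hG.contDiffAt
  have hinv : (fderiv ℂ G 0 ∘L .inr ℂ E ℂ).IsInvertible := by
    refine ⟨ContinuousLinearEquiv.unitsEquivAut ℂ (Units.mk0 _ hd), ?_⟩
    ext
    simp
  refine ⟨hc.implicitFunction (by simp) hinv, ?_, hc.implicitFunction_apply_self _ _, ?_⟩
  · exact (hc.contDiffAt_implicitFunction _ _).analyticAt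
  · filter_upwards [hc.eventually_apply_eq_iff_implicitFunction (by simp) hinv] with p hp
    rw [h0] at hp
    rw [hp, eq_comm]

/-- A point of the hyperplane `ℓ = 0` is the limit of points off it, along a direction `e` with `ℓ e
≠ 0`; continuity does the rest. It serves to cancel a factor `u`. -/
theorem eventually_eq_zero_of_dense {E G F : Type*} [NormedAddCommGroup E] [NormedSpace ℝ E]
    [NormedAddCommGroup G] [NormedSpace ℝ G] [TopologicalSpace F] [T2Space F] [Zero F]
    {f : E → F} {x₀ : E} (hf : ∀ᶠ x in 𝓝 x₀, ContinuousAt f x) (ℓ : E →L[ℝ] G) (hℓ : ℓ ≠ 0)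
    (h : ∀ᶠ x in 𝓝 x₀, ℓ x ≠ 0 → f x = 0) : ∀ᶠ x in 𝓝 x₀, f x = 0 := by
  obtain ⟨e, he⟩ := DFunLike.ne_iff.1 hℓ
  filter_upwards [hf, h.eventually_nhds] with x hx hx2
  by_cases hx0 : ℓ x = 0
  · have hT : Tendsto (fun t : ℝ => x + t • e) (𝓝[≠] 0) (𝓝 x) := by
      have : Continuous fun t : ℝ => x + t • e := by fun_prop
      exact (this.tendsto' 0 x (by simp)).mono_left nhdsWithin_le_nhds
    refine tendsto_nhds_unique (hx.tendsto.comp hT) ?_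
    refine tendsto_const_nhds.congr' ?_
    filter_upwards [hT.eventually hx2, self_mem_nhdsWithin] with t ht ht0
    refine (ht ?_).symm
    simp only [map_add, hx0, zero_add, map_smul]
    exact smul_ne_zero ht0 he
  · exact hx2.self_of_nhds hx0

end AnalyticTools

end CRGeometry

end

/-! ### Normal coordinates for a complexified defining function. -/

noncomputable section

namespace CRGeometry

theorem fderiv_apply_eq_of_hasDerivAt_comp {𝕜 E F : Type*} [NontriviallyNormedField 𝕜]
    [NormedAddCommGroup E] [NormedSpace 𝕜 E] [NormedAddCommGroup F] [NormedSpace 𝕜 F]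
    {f : E → F} {γ : 𝕜 → E} {x v : E} {w : F} {s : 𝕜} (hf : DifferentiableAt 𝕜 f x)
    (hγ : HasDerivAt γ v s) (hx : γ s = x) (h : HasDerivAt (fun t => f (γ t)) w s) :
    fderiv 𝕜 f x v = w := by
  subst hx
  exact (hf.hasFDerivAt.comp_hasDerivAt s hγ).unique h

theorem tendsto_zero_of_continuousAt {E F : Type*} [TopologicalSpace E] [Zero E]
    [TopologicalSpace F] [Zero F] {f : E → F} (hf : ContinuousAt f 0) (h : f 0 = 0) :
    Tendsto f (𝓝 0) (𝓝 0) := by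
  have := hf.tendsto
  rwa [h] at this

theorem analyticAt_comp {E F G : Type*} [NormedAddCommGroup E] [NormedSpace ℂ E]
    [NormedAddCommGroup F] [NormedSpace ℂ F] [NormedAddCommGroup G] [NormedSpace ℂ G]
    {g : F → G} {f : E → F} {x : E} {y : F} (hg : AnalyticAt ℂ g y) (hf : ContDiffAt ℂ ⊤ f x)
    (hy : f x = y) : AnalyticAt ℂ (fun t => g (f t)) x := by
  subst hy
  exact hg.fun_comp hf.analyticAt

instance {V W : Type*} [SeminormedAddCommGroup V] [StarAddMonoid V] [NormedStarGroup V]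
    [SeminormedAddCommGroup W] [StarAddMonoid W] [NormedStarGroup W] :
    NormedStarGroup (V × W) where
  norm_star_le x := by simp [Prod.norm_def]

theorem hasDerivAt_smul_const_zero {E : Type*} [NormedAddCommGroup E] [NormedSpace ℂ E] (v : E) :
    HasDerivAt (fun s : ℂ => s • v) v 0 := by
  simpa using (hasDerivAt_id (0 : ℂ)).smul_const v

section NormalCoordinates

variable {V : Type*} [NormedAddCommGroup V] [NormedSpace ℂ V] [StarAddMonoid V]

/-- A real-analytic curve in the hypersurface `ρ = 0`, transverse to the complex tangent space. -/
theorem exists_transverse_curve {ρ : (V × ℂ) × (V × ℂ) → ℂ} (hρ : AnalyticAt ℂ ρ 0) (h0 : ρ 0 = 0)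
    (hsymm : ∀ᶠ p in 𝓝 0, star (ρ (star p.2, star p.1)) = ρ p)
    (hd : ∀ p, fderiv ℂ ρ 0 p = (p.1.2 - p.2.2) / (2 * Complex.I)) :
    ∃ h : ℂ → ℂ, AnalyticAt ℂ h 0 ∧ h 0 = 0 ∧ HasDerivAt h 0 0 ∧
      (∀ᶠ t in 𝓝 0, star (h (star t)) = h t) ∧
      ∀ᶠ t in 𝓝 0, ρ ((0, t + Complex.I * h t), (0, t - Complex.I * h t)) = 0 := by
  -- For real `t`, `y` this is the point `(0, t + iy)` with its conjugate. By `hd`, the derivative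
  -- of `ρ` in `y` is `1`, so `ρ = 0` can be solved as `y = h t`.
  let L : ℂ × ℂ → (V × ℂ) × (V × ℂ) := fun p =>
    ((0, p.1 + Complex.I * p.2), (0, p.1 - Complex.I * p.2))
  have hL0 : L 0 = 0 := by simp [L, Prod.ext_iff]
  have hLc : Continuous L := by fun_prop
  let G : ℂ × ℂ → ℂ := fun p => ρ (L p)
  have hGa : AnalyticAt ℂ G 0 := analyticAt_comp hρ (by fun_prop) hL0
  have hG0 : G 0 = 0 := by simp only [G, hL0, h0]
  have hGd : ∀ a b : ℂ, fderiv ℂ G 0 (a, b) = b := by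
    intro a b
    refine fderiv_apply_eq_of_hasDerivAt_comp hGa.differentiableAt
      (hasDerivAt_smul_const_zero (a, b)) (by simp) ?_
    have h1 := hasDerivAt_smul_const_zero (L (a, b))
    have h2 : HasFDerivAt ρ (fderiv ℂ ρ 0) ((0 : ℂ) • L (a, b)) := by
      rw [zero_smul]; exact hρ.differentiableAt.hasFDerivAt
    have h3 := h2.comp_hasDerivAt (0 : ℂ) h1
    rw [hd] at h3
    convert! h3 using 1
    · ext s
      simp only [G, L, Function.comp_apply, Prod.smul_mk, smul_zero, smul_eq_mul]
      congr! 3 <;> ring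
    · simp only [L]
      field_simp
      ring
  obtain ⟨h, ha, hh0, hiff⟩ := exists_implicit hGa hG0 (by rw [hGd]; exact one_ne_zero)
  have hgr : Tendsto (fun t => (t, h t)) (𝓝 0) (𝓝 0) :=
    tendsto_zero_of_continuousAt (continuousAt_id.prodMk ha.continuousAt)
      (by simp [Prod.ext_iff, hh0])
  have heq : ∀ᶠ t in 𝓝 0, G (t, h t) = 0 := by
    filter_upwards [hgr.eventually hiff] with t ht
    exact ht.2 rfl
  refine ⟨h, ha, hh0, ?_, ?_, heq⟩
  · have h1 : HasDerivAt (fun t => (t, h t)) (1, deriv h 0) 0 :=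
      (hasDerivAt_id _).prodMk ha.differentiableAt.hasDerivAt
    have h2 : HasDerivAt (fun t => G (t, h t)) 0 0 :=
      (hasDerivAt_const (0 : ℂ) (0 : ℂ)).congr_of_eventuallyEq heq
    have := fderiv_apply_eq_of_hasDerivAt_comp hGa.differentiableAt h1
      (by simp [Prod.ext_iff, hh0]) h2
    rw [hGd] at this
    have h3 := ha.differentiableAt.hasDerivAt
    rwa [this] at h3
  -- By the reality of `ρ` the conjugated function solves the same implicit equation, so uniqueness
  -- makes `h` real on the reals.
  · have hst : Tendsto (fun t : ℂ => star t) (𝓝 0) (𝓝 0) := continuous_star.tendsto' _ _ (by simp)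
    have hpt : Tendsto (fun t => L (star t, h (star t))) (𝓝 0) (𝓝 0) :=
      (hLc.tendsto' 0 0 hL0).comp (hgr.comp hst)
    have hgr2 : Tendsto (fun t => (t, star (h (star t)))) (𝓝 0) (𝓝 (0 : ℂ × ℂ)) := by
      have h1 : Tendsto (fun t => star (h (star t))) (𝓝 0) (𝓝 0) := by
        have := (ha.continuousAt.tendsto.comp hst).star
        simpa [hh0] using this
      exact tendsto_id.prodMk_nhds h1
    filter_upwards [hgr2.eventually hiff, hst.eventually heq, hpt.eventually hsymm] with t h1 h2 h3
    refine h1.1 ?_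
    simp only [G] at h2 ⊢
    rw [h2] at h3
    rw [← star_eq_zero, ← h3]
    congr 2
    simp [L, Prod.ext_iff, sub_eq_add_neg]

/-- Normal coordinates of a real-analytic hypersurface in complexified form. -/
theorem exists_normal_coordinates [CompleteSpace V] [NormedStarGroup V] [StarModule ℂ V]
    {ρ : (V × ℂ) × (V × ℂ) → ℂ} (hρ : AnalyticAt ℂ ρ 0)
    (h0 : ρ 0 = 0) (hsymm : ∀ᶠ p in 𝓝 0, star (ρ (star p.2, star p.1)) = ρ p)
    (hd : ∀ p, fderiv ℂ ρ 0 p = (p.1.2 - p.2.2) / (2 * Complex.I)) :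
    ∃ (Ψ : V × ℂ → V × ℂ) (F : V × V × ℂ → ℂ), AnalyticAt ℂ Ψ 0 ∧ Ψ 0 = 0 ∧
      HasFDerivAt Ψ (ContinuousLinearMap.id ℂ (V × ℂ)) 0 ∧ AnalyticAt ℂ F 0 ∧
      (∀ᶠ y : V × ℂ in 𝓝 0, F (y.1, 0, y.2) = 0) ∧
      (∀ᶠ x : V × V × ℂ in 𝓝 0, star (F (star x.2.1, star x.1, star x.2.2)) = F x) ∧
      ∀ᶠ y : V × ℂ in 𝓝 0, ρ (Ψ y, star (Ψ y)) = 0 ↔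
        (y.2.im : ℂ) = F (y.1, star y.1, (y.2.re : ℂ)) := by
  obtain ⟨h, ha, hh0, hhd, hhs, hhz⟩ := exists_transverse_curve hρ h0 hsymm hd
  have hρd : HasFDerivAt ρ (fderiv ℂ ρ 0) 0 := hρ.differentiableAt.hasFDerivAt
  -- the new coordinate `w`
  let L : (V × ℂ) × ℂ → (V × ℂ) × (V × ℂ) := fun p =>
    ((p.1.1, p.2), (0, p.1.2 - Complex.I * h p.1.2))
  have hL0 : L 0 = 0 := by simp [L, Prod.ext_iff, hh0]
  let G : (V × ℂ) × ℂ → ℂ := fun p => ρ (L p)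
  have hha : ContDiffAt ℂ ⊤ (fun p : (V × ℂ) × ℂ => h p.1.2) 0 :=
    (analyticAt_comp (f := fun p : (V × ℂ) × ℂ => p.1.2) ha (by fun_prop) rfl).contDiffAt
  have hLc : ContDiffAt ℂ ⊤ L 0 :=
    ContDiffAt.prodMk (by fun_prop) (ContDiffAt.prodMk (by fun_prop)
      (ContDiffAt.sub (by fun_prop) (contDiffAt_const.mul hha)))
  have hGa : AnalyticAt ℂ G 0 := analyticAt_comp hρ hLc hL0
  have hG0 : G 0 = 0 := by simp only [G, hL0, h0]
  have hLd : ∀ (z : V) (t b : ℂ), HasDerivAt (fun s : ℂ => L (s • ((z, t), b))) ((z, b), (0, t))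
      0 := by
    intro z t b
    have hht : HasDerivAt (fun s : ℂ => h (s • t)) 0 0 := by
      have e2 : HasDerivAt h 0 ((0 : ℂ) • t) := by rwa [zero_smul]
      have := e2.comp (0 : ℂ) (hasDerivAt_smul_const_zero t)
      rwa [zero_mul] at this
    have e4 := (hasDerivAt_smul_const_zero t).sub (hht.const_mul Complex.I)
    rw [mul_zero, sub_zero] at e4
    exact ((hasDerivAt_smul_const_zero z).prodMk (hasDerivAt_smul_const_zero b)).prodMk
      ((hasDerivAt_const _ _).prodMk e4)
  have hGd : ∀ (z : V) (t b : ℂ), fderiv ℂ G 0 ((z, t), b) = (b - t) / (2 * Complex.I) := by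
    intro z t b
    refine fderiv_apply_eq_of_hasDerivAt_comp hGa.differentiableAt
      (hasDerivAt_smul_const_zero ((z, t), b)) (by simp) ?_
    have h2 : HasFDerivAt ρ (fderiv ℂ ρ 0) (L ((0 : ℂ) • ((z, t), b))) := by
      rw [zero_smul, hL0]; exact hρd
    have h3 := h2.comp_hasDerivAt (0 : ℂ) (hLd z t b)
    rw [hd] at h3
    exact h3
  -- The graph `w = g (z, t)` is the complexified hypersurface with the conjugate variables frozen
  -- at `(0, t - i h t)`; for real `t` it is the Segre variety of the point `(0, t + i h t)` of the
  -- curve.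
  obtain ⟨g, hga, hg0, hgiff⟩ := exists_implicit hGa hG0 (by
    have := hGd 0 0 1
    rw [show ((0 : V), (0 : ℂ)) = 0 from rfl] at this
    rw [this]; simp)
  have hgraph : Tendsto (fun y => (y, g y)) (𝓝 0) (𝓝 (0 : (V × ℂ) × ℂ)) :=
    tendsto_zero_of_continuousAt (continuousAt_id.prodMk hga.continuousAt)
      (by simp [Prod.ext_iff, hg0])
  have hgeq : ∀ᶠ y in 𝓝 0, G (y, g y) = 0 := by
    filter_upwards [hgraph.eventually hgiff] with t ht
    exact ht.2 rfl
  have hgd : fderiv ℂ g 0 = ContinuousLinearMap.snd ℂ V ℂ := by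
    refine ContinuousLinearMap.ext fun y => ?_
    have hγ : HasFDerivAt (fun y => (y, g y)) ((ContinuousLinearMap.id ℂ (V × ℂ)).prod
      (fderiv ℂ g 0)) 0 := (hasFDerivAt_id _).prodMk hga.differentiableAt.hasFDerivAt
    have h1 : HasFDerivAt G (fderiv ℂ G 0) ((0 : V × ℂ), g 0) := by
      rw [hg0]; exact hGa.differentiableAt.hasFDerivAt
    have hgeq' : (G ∘ fun y => (y, g y)) =ᶠ[𝓝 0] fun _ => 0 := hgeq
    have h2 := (h1.comp (0 : V × ℂ) hγ).unique
      ((hasFDerivAt_const (0 : ℂ) (0 : V × ℂ)).congr_of_eventuallyEq hgeq')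
    have h3 := DFunLike.congr_fun h2 y
    have h4 : fderiv ℂ G 0 ((y.1, y.2), fderiv ℂ g 0 y) = 0 := h3
    rw [hGd] at h4
    have : fderiv ℂ g 0 y - y.2 = 0 := by simpa using h4
    simpa using sub_eq_zero.1 this
  -- At `z = 0` the curve itself solves the equation of `g`, so uniqueness identifies the two.
  have hg1 : ∀ᶠ t : ℂ in 𝓝 0, g (0, t) = t + Complex.I * h t := by
    have hT : Tendsto (fun t : ℂ => (((0 : V), t), t + Complex.I * h t)) (𝓝 0) (𝓝 0) := by
      refine tendsto_zero_of_continuousAt ?_ (by simp [Prod.ext_iff, hh0])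
      have := ha.continuousAt
      fun_prop
    filter_upwards [hT.eventually hgiff, hhz] with t h1 h2
    exact (h1.1 h2).symm
  let Ψ : V × ℂ → V × ℂ := fun y => (y.1, g y)
  have hΨa : AnalyticAt ℂ Ψ 0 := by
    have := hga.contDiffAt (n := ⊤)
    exact ContDiffAt.analyticAt (by fun_prop)
  have hΨ0 : Ψ 0 = 0 := by simp [Ψ, Prod.ext_iff, hg0]
  have hΨd : HasFDerivAt Ψ (ContinuousLinearMap.id ℂ (V × ℂ)) 0 := by
    have h1 := hga.differentiableAt.hasFDerivAt
    rw [hgd] at h1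
    exact hasFDerivAt_fst.prodMk h1
  -- the graph function `F`
  let Ψs : V × ℂ → V × ℂ := fun y => star (Ψ (star y))
  have hΨsa : AnalyticAt ℂ Ψs 0 :=
    analyticAt_star_star (by rw [star_zero]; exact hΨa)
  have hΨs0 : Ψs 0 = 0 := by simp only [Ψs, star_zero, hΨ0]
  have hΨsd : HasFDerivAt Ψs (ContinuousLinearMap.id ℂ (V × ℂ)) 0 := by
    have := hΨd.star_star
    rw [star_zero] at this
    convert! this using 1
    refine ContinuousLinearMap.ext fun y => ?_
    simp
  -- The substitution `w = u + iv`, `ω = u - iv` with `u`, `v` complex; the derivative in `v` will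
  -- be `1`, so `v` can be solved for as `F (z, ζ, u)`.
  let A : (V × V × ℂ) × ℂ → (V × ℂ) × (V × ℂ) := fun p =>
    ((p.1.1, p.1.2.2 + Complex.I * p.2), (p.1.2.1, p.1.2.2 - Complex.I * p.2))
  have hA : ContDiff ℂ ⊤ A := by fun_prop
  have hA0 : A 0 = 0 := by simp [A, Prod.ext_iff]
  let Θ : (V × ℂ) × (V × ℂ) → (V × ℂ) × (V × ℂ) := fun p => (Ψ p.1, Ψs p.2)
  have hΘa : AnalyticAt ℂ Θ 0 := by
    exact (analyticAt_comp (f := Prod.fst) hΨa (by fun_prop) rfl).prod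
      (analyticAt_comp (f := Prod.snd) hΨsa (by fun_prop) rfl)
  have hΘ0 : Θ 0 = 0 := by simp [Θ, Prod.ext_iff, hΨ0, hΨs0]
  have hΘd : HasFDerivAt Θ (ContinuousLinearMap.id ℂ _) 0 := by
    have e1 : HasFDerivAt Ψ (ContinuousLinearMap.id ℂ (V × ℂ)) (0 : (V × ℂ) × (V × ℂ)).1 := hΨd
    have e2 : HasFDerivAt Ψs (ContinuousLinearMap.id ℂ (V × ℂ)) (0 : (V × ℂ) × (V × ℂ)).2 := hΨsd
    exact (e1.comp _ hasFDerivAt_fst).prodMk (e2.comp _ hasFDerivAt_snd)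
  let K : (V × V × ℂ) × ℂ → ℂ := fun p => ρ (Θ (A p))
  have hΘA : AnalyticAt ℂ (fun p => Θ (A p)) 0 := analyticAt_comp hΘa hA.contDiffAt hA0
  have hΘA0 : Θ (A 0) = 0 := by rw [hA0, hΘ0]
  have hKa : AnalyticAt ℂ K 0 := analyticAt_comp hρ hΘA.contDiffAt hΘA0
  have hK0 : K 0 = 0 := by simp only [K, hΘA0, h0]
  have hKd : fderiv ℂ K 0 (0, 1) = 1 := by
    refine fderiv_apply_eq_of_hasDerivAt_comp hKa.differentiableAt
      (hasDerivAt_smul_const_zero _) (by simp) ?_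
    have e1 : HasDerivAt (fun s : ℂ => A (s • (0, 1))) ((0, Complex.I), (0, -Complex.I)) 0 := by
      convert! hasDerivAt_smul_const_zero (((0, Complex.I), (0, -Complex.I)) :
        (V × ℂ) × (V × ℂ)) using 1
      ext s <;> simp [A, mul_comm]
    have e2 : HasFDerivAt Θ (ContinuousLinearMap.id ℂ _) (A ((0 : ℂ) • (0, 1))) := by
      rwa [zero_smul, hA0]
    have e3 := e2.comp_hasDerivAt (0 : ℂ) e1
    have e4 : HasFDerivAt ρ (fderiv ℂ ρ 0) (Θ (A ((0 : ℂ) • (0, 1)))) := by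
      rwa [zero_smul, hΘA0]
    have e5 := e4.comp_hasDerivAt (0 : ℂ) e3
    convert! e5 using 1
    rw [hd]
    simp only [ContinuousLinearMap.id_apply]
    field_simp
    ring
  obtain ⟨F, hFa, hF0, hFiff⟩ := exists_implicit hKa hK0 (by rw [hKd]; exact one_ne_zero)
  have hst : Tendsto (fun t : ℂ => star t) (𝓝 0) (𝓝 0) := continuous_star.tendsto' _ _ (by simp)
  refine ⟨Ψ, F, hΨa, hΨ0, hΨd, hFa, ?_, ?_, ?_⟩
  -- At `ζ = 0` the conjugated chart takes the value `(0, u - i h u)`. The equation defining `g`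
  -- then says that `v = 0` is a solution, and by uniqueness it is `F`.
  · have hT : Tendsto (fun y : V × ℂ => ((y.1, (0 : V), y.2), (0 : ℂ))) (𝓝 0) (𝓝 0) :=
      tendsto_zero_of_continuousAt (by fun_prop) (by simp [Prod.ext_iff])
    have h2 : Tendsto (fun y : V × ℂ => y.2) (𝓝 0) (𝓝 0) := continuous_snd.tendsto' _ _ rfl
    filter_upwards [hT.eventually hFiff, hgeq, h2.eventually hhs,
      (hst.comp h2).eventually hg1] with y h1 h3 h4 h5
    refine (h1.1 ?_).symm
    simp only [K, Θ, A, Ψ, Ψs, mul_zero, add_zero, sub_zero]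
    simp only [G, L] at h3
    have e : star ((0 : V), y.2) = (0, star y.2) := by simp [Prod.ext_iff]
    rw [← h3]
    congr 2
    rw [e, ← h4]
    simp only [Function.comp_apply] at h5
    refine Prod.ext (by simp) ?_
    change star (g (0, star y.2)) = _
    rw [h5]
    simp [sub_eq_add_neg]
  -- The reality of `ρ` shows that the conjugate of `F` solves the implicit equation of `F`.
  · have hs : Tendsto (fun x : V × V × ℂ => (star x.2.1, star x.1, star x.2.2)) (𝓝 0) (𝓝 0) :=
      tendsto_zero_of_continuousAt (by fun_prop) (by simp [Prod.ext_iff])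
    have hF1 : Tendsto (fun x => (x, F x)) (𝓝 0) (𝓝 0) :=
      tendsto_zero_of_continuousAt (continuousAt_id.prodMk hFa.continuousAt)
        (by simp [Prod.ext_iff, hF0])
    have hK1 : ∀ᶠ x in 𝓝 0, K (x, F x) = 0 := by
      filter_upwards [hF1.eventually hFiff] with x hx
      exact hx.2 rfl
    have hT : Tendsto (fun x : V × V × ℂ => (x, star (F (star x.2.1, star x.1, star x.2.2))))
        (𝓝 0) (𝓝 0) := by
      have h1 : Tendsto (fun x : V × V × ℂ => star (F (star x.2.1, star x.1, star x.2.2)))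
          (𝓝 0) (𝓝 0) := by
        have := (tendsto_zero_of_continuousAt hFa.continuousAt hF0).comp hs
        simpa using this.star
      exact tendsto_id.prodMk_nhds h1
    have hT2 : Tendsto (fun x => Θ (A x)) (𝓝 0) (𝓝 0) :=
      tendsto_zero_of_continuousAt hΘA.continuousAt hΘA0
    filter_upwards [hT.eventually hFiff, hs.eventually hK1,
      (hT2.comp (hF1.comp hs)).eventually hsymm] with x h1 h2 h3
    refine (h1.1 ?_).symm.symm
    simp only [Function.comp_apply] at h3
    simp only [K] at h2 ⊢
    rw [h2] at h3
    rw [← star_eq_zero, ← h3]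
    congr 2
    simp only [Θ, Ψs, star_star]
    congr 2
    · simp [A, Prod.ext_iff, sub_eq_add_neg]
    · congr 1
      simp [A, Prod.ext_iff, sub_eq_add_neg]
  · have hT : Tendsto (fun y : V × ℂ => ((y.1, star y.1, (y.2.re : ℂ)), (y.2.im : ℂ)))
        (𝓝 0) (𝓝 0) :=
      tendsto_zero_of_continuousAt (by fun_prop) (by simp [Prod.ext_iff])
    filter_upwards [hT.eventually hFiff] with y hy
    rw [← hy]
    have e1 : (y.2.re : ℂ) + Complex.I * y.2.im = y.2 := by
      rw [mul_comm]; exact Complex.re_add_im _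
    have e2 : (y.2.re : ℂ) - Complex.I * y.2.im = star y.2 := by
      apply Complex.ext <;> simp
    have e3 : ((star y.1, star y.2) : V × ℂ) = star y := rfl
    simp only [K, Θ, A, Ψs, e1, e2, e3, star_star]

end NormalCoordinates

end CRGeometry

end

/-! ### Reduction of a hypersurface to a graph without pure terms. -/

noncomputable section

namespace CRGeometry

/-- `(z, w) ↦ ψ (z, w)` is a local holomorphic parametrization of `ℂ³` in which `M` is given by
`Im w = F(z, z̄, Re w)`, where `F(z, ζ, u)` vanishes for `z = 0` and for `ζ = 0`. -/
structure IsNormalForm (M : LocalHypersurface 3) (ψ : (Fin 2 → ℂ) × ℂ → (Fin 3 → ℂ))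
    (F : (Fin 2 → ℂ) × (Fin 2 → ℂ) × ℂ → ℂ) : Prop where
  analyticAt_param : AnalyticAt ℂ ψ 0
  param_zero : ψ 0 = 0
  fderiv_param : ∃ A : ((Fin 2 → ℂ) × ℂ) ≃L[ℂ] (Fin 3 → ℂ),
    HasFDerivAt ψ (A : ((Fin 2 → ℂ) × ℂ) →L[ℂ] (Fin 3 → ℂ)) 0
  analyticAt_graph : AnalyticAt ℂ F 0
  graph_right : ∀ᶠ y : (Fin 2 → ℂ) × ℂ in 𝓝 0, F (y.1, 0, y.2) = 0
  graph_star : ∀ᶠ x : (Fin 2 → ℂ) × (Fin 2 → ℂ) × ℂ in 𝓝 0,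
    star (F (star x.2.1, star x.1, star x.2.2)) = F x
  mem_iff : ∀ᶠ y : (Fin 2 → ℂ) × ℂ in 𝓝 0, ψ y ∈ M.carrier ↔
    (y.2.im : ℂ) = F (y.1, star y.1, (y.2.re : ℂ))

theorem IsNormalForm.graph_left {M : LocalHypersurface 3} {ψ : (Fin 2 → ℂ) × ℂ → (Fin 3 → ℂ)}
    {F : (Fin 2 → ℂ) × (Fin 2 → ℂ) × ℂ → ℂ} (h : IsNormalForm M ψ F) :
    ∀ᶠ y : (Fin 2 → ℂ) × ℂ in 𝓝 0, F (0, y.1, y.2) = 0 := by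
  have h1 : Tendsto (fun y : (Fin 2 → ℂ) × ℂ => ((0 : Fin 2 → ℂ), y.1, y.2)) (𝓝 0) (𝓝 0) :=
    tendsto_zero_of_continuousAt (by fun_prop) (by simp [Prod.ext_iff])
  have h2 : Tendsto (fun y : (Fin 2 → ℂ) × ℂ => star y) (𝓝 0) (𝓝 0) :=
    tendsto_zero_of_continuousAt (by fun_prop) (by simp)
  filter_upwards [h1.eventually h.graph_star, h2.eventually h.graph_right] with y e1 e2
  rw [← e1, star_eq_zero]
  simpa using e2

/-- A symmetric complexification of a hypersurface. -/
theorem LocalHypersurface.exists_complexification {N : ℕ} (M : LocalHypersurface N)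
    (h0 : (0 : Fin N → ℂ) ∈ M.carrier) :
    ∃ ρ : (Fin N → ℂ) × (Fin N → ℂ) → ℂ, AnalyticAt ℂ ρ 0 ∧
      (∀ p, star (ρ (star p.2, star p.1)) = ρ p) ∧
      ∀ᶠ q in 𝓝 0, ρ (q, star q) = M.r q := by
  have hr : AnalyticAt ℝ (fun q => (M.r q : ℂ)) 0 :=
    (Complex.ofRealCLM.analyticAt _).comp (M.analytic_r 0 h0.1)
  obtain ⟨ρ, hρ, hρr⟩ := CRGeometry.exists_complexification
    (ι := Fin N ⊕ Fin N) (W := (Fin N → ℂ) × (Fin N → ℂ)) hr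
    (Sum.elim (fun j => Pi.single j 1) (fun j => Pi.single j Complex.I))
    (Sum.elim
      (fun j => (1 / 2 : ℂ) • ((ContinuousLinearMap.proj j).comp (ContinuousLinearMap.fst ℂ _ _)
        + (ContinuousLinearMap.proj j).comp (ContinuousLinearMap.snd ℂ _ _)))
      (fun j => (1 / (2 * Complex.I) : ℂ) •
        ((ContinuousLinearMap.proj j).comp (ContinuousLinearMap.fst ℂ _ _)
        - (ContinuousLinearMap.proj j).comp (ContinuousLinearMap.snd ℂ _ _))))
    (Sum.elim (fun j x => (x j).re) (fun j x => (x j).im)) (fun x => (x, star x)) (by fun_prop)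
    (by simp [Prod.ext_iff]) (by
      rintro (j | j) x
      · apply Complex.ext <;> simp; ring
      · simp [Complex.sub_conj]
        field_simp
        rw [Complex.I_sq]
        ring) (by
      intro x
      ext j
      simp only [Fintype.sum_sum_type, Sum.elim_inl, Sum.elim_inr, Finset.sum_apply,
        Pi.smul_apply, Pi.single_apply, mul_ite, mul_zero, Finset.sum_ite_eq, Finset.mem_univ,
        if_true, Complex.real_smul, mul_one]
      exact (Complex.re_add_im _).symm)
  -- Averaging with the conjugate enforces the symmetry, and changes nothing on the diagonal since
  -- `r` is real.
  refine ⟨fun p => (ρ p + star (ρ (star p.2, star p.1))) / 2, ?_, ?_, ?_⟩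
  · have h1 : AnalyticAt ℂ (fun p : (Fin N → ℂ) × (Fin N → ℂ) => ρ (p.2, p.1)) (star 0) :=
      analyticAt_comp hρ (by fun_prop) (by simp [Prod.ext_iff])
    exact (hρ.add (analyticAt_star_star h1)).div_const
  · intro p
    simp [add_comm]
  · filter_upwards [hρr] with q hq
    simp only [star_star, hq]
    simp

/-- The kernel of `ℓ` supplies the `z` directions, and a vector where `ℓ` equals `1 / 2i` supplies
the `w` direction. The factor is chosen so that `ℓ` plus its conjugate becomes `Im w`. -/
theorem exists_adapted_equiv (ℓ : (Fin 3 → ℂ) →ₗ[ℂ] ℂ) (hℓ : ℓ ≠ 0) :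
    ∃ A : ((Fin 2 → ℂ) × ℂ) ≃L[ℂ] (Fin 3 → ℂ), ∀ y, ℓ (A y) = y.2 / (2 * Complex.I) := by
  have hsurj : Function.Surjective ℓ := LinearMap.surjective hℓ
  have hk : Module.finrank ℂ (Fin 2 → ℂ) = Module.finrank ℂ (LinearMap.ker ℓ) := by
    have h1 := LinearMap.finrank_range_add_finrank_ker ℓ
    rw [LinearMap.range_eq_top.2 hsurj, finrank_top] at h1
    simp at h1 ⊢
    omega
  obtain ⟨x₀, hx₀⟩ := hsurj (1 / (2 * Complex.I))
  let κ : (Fin 2 → ℂ) ≃ₗ[ℂ] LinearMap.ker ℓ := LinearEquiv.ofFinrankEq _ _ hk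
  let B : ((Fin 2 → ℂ) × ℂ) →ₗ[ℂ] (Fin 3 → ℂ) :=
    ((LinearMap.ker ℓ).subtype ∘ₗ κ.toLinearMap).coprod (LinearMap.toSpanSingleton ℂ _ x₀)
  have hB : ∀ y, ℓ (B y) = y.2 / (2 * Complex.I) := by
    intro y
    have : ℓ (κ y.1 : Fin 3 → ℂ) = 0 := (κ y.1).2
    simp [B, this, hx₀, div_eq_mul_inv]
  have hinj : Function.Injective B := by
    refine (injective_iff_map_eq_zero B).2 fun y hy => ?_
    have h2 : y.2 = 0 := by
      have := hB y
      rw [hy, map_zero] at this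
      simpa using this.symm
    have h1 : (κ y.1 : Fin 3 → ℂ) = 0 := by simpa [B, h2] using hy
    have h3 : y.1 = 0 := by simpa using h1
    exact Prod.ext h3 h2
  refine ⟨(LinearMap.linearEquivOfInjective B hinj (by simp)).toContinuousLinearEquiv, fun y => ?_⟩
  simpa using hB y

/-- By its symmetry the complexified defining function has a differential at `0` of the form `ℓ`
plus the conjugate of `ℓ`, and `ℓ ≠ 0` because `dr ≠ 0`. A linear change adapted to `ℓ` turns this
differential into `(w - ω) / 2i`, as normal coordinates require. -/
theorem LocalHypersurface.exists_isNormalForm (M : LocalHypersurface 3)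
    (h0 : (0 : Fin 3 → ℂ) ∈ M.carrier) : ∃ ψ F, IsNormalForm M ψ F := by
  obtain ⟨ρ, hρ, hsymm, hr⟩ := M.exists_complexification h0
  set D := fderiv ℂ ρ 0
  have hD : HasFDerivAt ρ D 0 := hρ.differentiableAt.hasFDerivAt
  have hDs : ∀ ξ, D (0, ξ) = star (D (star ξ, 0)) := by
    intro ξ
    refine fderiv_apply_eq_of_hasDerivAt_comp hρ.differentiableAt
      (hasDerivAt_smul_const_zero _) (by simp) ?_
    have h1 : HasFDerivAt ρ D ((0 : ℂ) • (star ξ, (0 : Fin 3 → ℂ))) := by rwa [zero_smul]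
    have h2 := (h1.comp_hasDerivAt (0 : ℂ)
      (hasDerivAt_smul_const_zero (star ξ, (0 : Fin 3 → ℂ)))).conj_conj
    rw [map_zero] at h2
    convert! h2 using 1
    ext s
    rw [← hsymm]
    simp
  let ℓ : (Fin 3 → ℂ) →ₗ[ℂ] ℂ := D.toLinearMap ∘ₗ LinearMap.inl ℂ _ _
  have hℓD : ∀ p, D p = ℓ p.1 + star (ℓ (star p.2)) := by
    intro p
    have e1 : ℓ p.1 = D (p.1, 0) := rfl
    have e2 : star (ℓ (star p.2)) = D (0, p.2) := by rw [hDs]; rfl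
    rw [e1, e2, ← map_add]
    simp
  have hℓ : ℓ ≠ 0 := by
    intro hz
    refine M.regular_r 0 h0.1 h0.2 ?_
    have hD0 : D = 0 := by
      refine ContinuousLinearMap.ext fun p => ?_
      rw [hℓD, hz]
      simp
    have h1 : HasFDerivAt ρ (0 : _ →L[ℝ] ℂ) ((fun q : Fin 3 → ℂ => (q, star q)) 0) := by
      have := hD.restrictScalars ℝ
      rw [hD0] at this
      simp only [star_zero]
      exact this
    have h2 : DifferentiableAt ℝ (fun q : Fin 3 → ℂ => (q, star q)) 0 := by
      exact (differentiable_id.prodMk (starL' ℝ : (Fin 3 → ℂ) ≃L[ℝ] _).differentiable) 0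
    have h3 := h1.comp (0 : Fin 3 → ℂ) h2.hasFDerivAt
    have h4 : HasFDerivAt (fun q => (M.r q : ℂ)) (0 : (Fin 3 → ℂ) →L[ℝ] ℂ) 0 := by
      rw [ContinuousLinearMap.zero_comp] at h3
      refine h3.congr_of_eventuallyEq ?_
      filter_upwards [hr] with q hq using hq.symm
    have h5 := Complex.reCLM.hasFDerivAt.comp (0 : Fin 3 → ℂ) h4
    have h6 : HasFDerivAt M.r (0 : (Fin 3 → ℂ) →L[ℝ] ℝ) 0 := by
      simpa [Function.comp_def] using h5
    exact h6.fderiv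
  obtain ⟨A, hA⟩ := exists_adapted_equiv ℓ hℓ
  let As : (Fin 2 → ℂ) × ℂ → Fin 3 → ℂ := fun y => star (A (star y))
  have hAs : AnalyticAt ℂ As 0 := analyticAt_star_star (A.analyticAt _)
  let Θ : ((Fin 2 → ℂ) × ℂ) × ((Fin 2 → ℂ) × ℂ) → (Fin 3 → ℂ) × (Fin 3 → ℂ) :=
    fun p => (A p.1, As p.2)
  have hΘ0 : Θ 0 = 0 := by simp [Θ, As]
  have hΘa : AnalyticAt ℂ Θ 0 :=
    (analyticAt_comp (f := Prod.fst) (A.analyticAt 0) (by fun_prop) rfl).prod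
      (analyticAt_comp (f := Prod.snd) hAs (by fun_prop) rfl)
  have hΘs : ∀ (s : ℂ) p, Θ (s • p) = s • Θ p := by
    intro s p
    simp [Θ, As]
  have hTa : AnalyticAt ℂ (fun p => ρ (Θ p)) 0 := analyticAt_comp hρ hΘa.contDiffAt hΘ0
  have hρ0 : ρ 0 = 0 := by
    have := hr.self_of_nhds
    rw [h0.2, star_zero, Complex.ofReal_zero] at this
    exact this
  obtain ⟨Ψ, F, hΨ, hΨ0, hΨd, hF, hFr, hFs, hFM⟩ := exists_normal_coordinates hTa
    (by rw [hΘ0, hρ0]) (by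
      refine Eventually.of_forall fun p => ?_
      rw [← hsymm]
      simp [Θ, As]) (by
      intro p
      refine fderiv_apply_eq_of_hasDerivAt_comp hTa.differentiableAt
        (hasDerivAt_smul_const_zero _) (by simp) ?_
      have h1 : HasFDerivAt ρ D ((0 : ℂ) • Θ p) := by rwa [zero_smul]
      have h2 := h1.comp_hasDerivAt (0 : ℂ) (hasDerivAt_smul_const_zero (Θ p))
      convert! h2 using 1
      · ext s
        simp [hΘs]
      · rw [hℓD]
        simp only [Θ, As, star_star, hA]
        simp [div_eq_mul_inv]
        ring)
  refine ⟨fun y => A (Ψ y), F, ?_, ?_, ⟨A, ?_⟩, hF, hFr, hFs, ?_⟩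
  · exact analyticAt_comp (A.analyticAt 0) hΨ.contDiffAt hΨ0
  · simp [hΨ0]
  · exact A.hasFDerivAt.comp (0 : (Fin 2 → ℂ) × ℂ) hΨd
  · have hT : Tendsto (fun y => A (Ψ y)) (𝓝 0) (𝓝 0) :=
      tendsto_zero_of_continuousAt (A.continuous.continuousAt.comp hΨ.continuousAt) (by simp [hΨ0])
    filter_upwards [hFM, hT.eventually hr, hT.eventually_mem (M.isOpen_U.mem_nhds h0.1)]
      with y h1 h2 h3
    rw [← h1]
    have e : Θ (Ψ y, star (Ψ y)) = (A (Ψ y), star (A (Ψ y))) := by simp [Θ, As]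
    rw [e, h2]
    simp [LocalHypersurface.carrier, h3]

end CRGeometry

end

/-! ### Derivatives along complexified tangent vectors. -/

noncomputable section

namespace CRGeometry

section ComplexDerivative

variable {N : ℕ} {E F : Type*} [NormedAddCommGroup E] [NormedSpace ℂ E]
  [NormedAddCommGroup F] [NormedSpace ℂ F]

/-- The derivative of a vector-valued function along a complexified tangent vector. -/
def cderiv (h : (Fin N → ℂ) → E) (p : Fin N → ℂ) (Z : CVec N) : E :=
  (1 / 2 : ℂ) • (fderiv ℝ h p (Z.1 + star Z.2)
    - Complex.I • fderiv ℝ h p (Complex.I • (Z.1 - star Z.2)))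

theorem apply_eq_sum_re_im (D : (Fin N → ℂ) →L[ℝ] E) (v : Fin N → ℂ) :
    D v = ∑ j, (((v j).re : ℂ) • D (Pi.single j 1) + ((v j).im : ℂ) • D (Pi.single j Complex.I)) := by
  have hv : v = ∑ j, ((v j).re • (Pi.single j 1 : Fin N → ℂ)
      + (v j).im • (Pi.single j Complex.I : Fin N → ℂ)) := by
    ext k
    simp only [Finset.sum_apply, Pi.add_apply, Pi.smul_apply, Pi.single_apply, Complex.real_smul,
      mul_ite, mul_one, mul_zero, Finset.sum_add_distrib, Finset.sum_ite_eq, Finset.mem_univ,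
      if_true]
    exact (Complex.re_add_im _).symm
  conv_lhs => rw [hv]
  simp only [map_sum, map_add, map_smul, Complex.coe_smul]

/-- Writing `Z = X + iY` with `X`, `Y` real, their `ℂ^N` coordinates are `(Z.1 + star Z.2) / 2` and
`-i (Z.1 - star Z.2) / 2`; the right side is the derivative along `X` plus `i` times that along `Y`.
In this form the chain and product rules need no coordinates. -/
theorem deriveAlong_eq_cderiv (f : (Fin N → ℂ) → ℂ) (p : Fin N → ℂ) (Z : CVec N) :
    deriveAlong f p Z = cderiv f p Z := by
  simp only [deriveAlong, LinearMap.coe_mk, AddHom.coe_mk, cderiv]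
  rw [apply_eq_sum_re_im _ (Z.1 + star Z.2), apply_eq_sum_re_im _ (Complex.I • (Z.1 - star Z.2)),
    Finset.smul_sum, ← Finset.sum_sub_distrib, Finset.smul_sum]
  refine Finset.sum_congr rfl fun j _ => ?_
  simp only [dz, dzbar, smul_eq_mul, Pi.add_apply, Pi.smul_apply, Pi.sub_apply, Pi.star_apply,
    Complex.add_re, Complex.add_im, Complex.mul_re, Complex.mul_im, Complex.sub_re, Complex.sub_im,
    Complex.I_re, Complex.I_im, Complex.star_def, Complex.conj_re, Complex.conj_im]
  push_cast
  generalize fderiv ℝ f p (Pi.single j 1) = X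
  generalize fderiv ℝ f p (Pi.single j Complex.I) = Y
  conv_lhs => rw [← Complex.re_add_im (Z.1 j), ← Complex.re_add_im (Z.2 j)]
  ring_nf
  simp only [Complex.I_sq]
  ring

theorem cderiv_pi {n : ℕ} {h : (Fin N → ℂ) → Fin n → ℂ} {p : Fin N → ℂ}
    (hh : DifferentiableAt ℝ h p) (Z : CVec N) (j : Fin n) :
    deriveAlong (fun q => h q j) p Z = cderiv h p Z j := by
  rw [deriveAlong_eq_cderiv]
  have : fderiv ℝ (fun q => h q j) p = (ContinuousLinearMap.proj j).comp (fderiv ℝ h p) :=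
    (hasFDerivAt_pi'.1 hh.hasFDerivAt j).fderiv
  simp [cderiv, this]

theorem cderiv_prodMk {h : (Fin N → ℂ) → E} {k : (Fin N → ℂ) → F} {p : Fin N → ℂ}
    (hh : DifferentiableAt ℝ h p) (hk : DifferentiableAt ℝ k p) (Z : CVec N) :
    cderiv (fun q => (h q, k q)) p Z = (cderiv h p Z, cderiv k p Z) := by
  simp [cderiv, hh.fderiv_prodMk hk]

theorem cderiv_comp {G : E → F} {h : (Fin N → ℂ) → E} {p : Fin N → ℂ}
    (hG : DifferentiableAt ℂ G (h p)) (hh : DifferentiableAt ℝ h p) (Z : CVec N) :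
    cderiv (fun q => G (h q)) p Z = fderiv ℂ G (h p) (cderiv h p Z) := by
  have h1 := (hG.hasFDerivAt.restrictScalars ℝ).comp p hh.hasFDerivAt
  have h2 : fderiv ℝ (fun q => G (h q)) p = _ := h1.fderiv
  simp [cderiv, h2]

theorem cderiv_clm_apply {B : (Fin N → ℂ) → E →L[ℂ] F} {h : (Fin N → ℂ) → E} {p : Fin N → ℂ}
    (hB : DifferentiableAt ℝ B p) (hh : DifferentiableAt ℝ h p) (Z : CVec N) :
    cderiv (fun q => B q (h q)) p Z = cderiv B p Z (h p) + B p (cderiv h p Z) := by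
  have h1 := ((ContinuousLinearMap.restrictScalarsL ℂ E F ℝ ℝ).hasFDerivAt.comp p
    hB.hasFDerivAt).clm_apply hh.hasFDerivAt
  have h2 : fderiv ℝ (fun q => B q (h q)) p = _ := h1.fderiv
  simp only [cderiv, h2]
  simp
  module

theorem cderiv_star [StarAddMonoid E] [NormedStarGroup E] [StarModule ℂ E]
    {h : (Fin N → ℂ) → E} {p : Fin N → ℂ} (hh : DifferentiableAt ℝ h p) (Z : CVec N) :
    cderiv (fun q => star (h q)) p Z = star (cderiv h p (star Z.2, star Z.1)) := by
  have : StarModule ℝ E := ⟨fun c x => by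
    rw [← Complex.coe_smul, star_smul, ← Complex.coe_smul]; simp⟩
  have h1 : fderiv ℝ (fun q => star (h q)) p = _ :=
    (((starL' ℝ : E ≃L[ℝ] E).hasFDerivAt).comp p hh.hasFDerivAt).fderiv
  have e : Complex.I • (star Z.2 - Z.1) = -(Complex.I • (Z.1 - star Z.2)) := by
    rw [← smul_neg, neg_sub]
  simp [cderiv, h1, e, add_comm]
  module

theorem cderiv_of_differentiableAt {Φ : (Fin N → ℂ) → E} {p : Fin N → ℂ}
    (hΦ : DifferentiableAt ℂ Φ p) (Z : CVec N) : cderiv Φ p Z = fderiv ℂ Φ p Z.1 := by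
  have h1 : fderiv ℝ Φ p = _ := (hΦ.hasFDerivAt.restrictScalars ℝ).fderiv
  simp only [cderiv, h1]
  simp only [ContinuousLinearMap.coe_restrictScalars', map_smul, map_add, map_sub]
  rw [smul_smul, Complex.I_mul_I]
  module

end ComplexDerivative

namespace LocalHypersurface

variable {N : ℕ} (M : LocalHypersurface N) {p : Fin N → ℂ}

theorem fderiv_ofReal_r (hp : p ∈ M.carrier) (v : Fin N → ℂ) :
    fderiv ℝ (fun q => (M.r q : ℂ)) p v = (fderiv ℝ M.r p v : ℝ) := by
  have := (Complex.ofRealCLM.hasFDerivAt.comp p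
    (M.analytic_r p hp.1).differentiableAt.hasFDerivAt).fderiv
  have h2 : fderiv ℝ (fun q => (M.r q : ℂ)) p = _ := this
  rw [h2]
  simp

/-- As `r` is real, the two differentials are, up to factors, the real and imaginary parts of one
number, so they vanish separately. -/
theorem mem_CT_iff (hp : p ∈ M.carrier) {Z : CVec N} :
    Z ∈ M.CT p ↔ fderiv ℝ M.r p (Z.1 + star Z.2) = 0 ∧
      fderiv ℝ M.r p (Complex.I • (Z.1 - star Z.2)) = 0 := by
  rw [CT, LinearMap.mem_ker, deriveAlong_eq_cderiv, cderiv, M.fderiv_ofReal_r hp,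
    M.fderiv_ofReal_r hp]
  constructor
  · intro h
    have h1 := congrArg Complex.re h
    have h2 := congrArg Complex.im h
    simp [-map_add, -map_smul, -map_sub] at h1 h2
    exact ⟨h1, h2⟩
  · rintro ⟨h1, h2⟩
    simp [h1, h2]

theorem mem_T10_iff {X : CVec N} : X ∈ M.T10 p ↔ X ∈ M.CT p ∧ X.2 = 0 := by
  simp [T10]

theorem mem_T01_iff {X : CVec N} : X ∈ M.T01 p ↔ X ∈ M.CT p ∧ X.1 = 0 := by
  simp [T01]

theorem star_mem_CT (hp : p ∈ M.carrier) {Z : CVec N} (hZ : Z ∈ M.CT p) :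
    ((star Z.2, star Z.1) : CVec N) ∈ M.CT p := by
  rw [M.mem_CT_iff hp] at hZ ⊢
  simp only [star_star]
  have e : Complex.I • (star Z.2 - Z.1) = -(Complex.I • (Z.1 - star Z.2)) := by
    rw [← smul_neg, neg_sub]
  rw [e, map_neg, add_comm, hZ.1, hZ.2]
  simp

/-- Tangential derivatives of a function that vanishes on the hypersurface vanish. -/
theorem deriveAlong_eq_zero (hp : p ∈ M.carrier) {h : (Fin N → ℂ) → ℂ} (hh : AnalyticAt ℝ h p)
    (hz : ∀ᶠ q in 𝓝[M.carrier] p, h q = 0) {Z : CVec N} (hZ : Z ∈ M.CT p) :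
    deriveAlong h p Z = 0 := by
  obtain ⟨h1, h2⟩ := (M.mem_CT_iff hp).1 hZ
  have hr := (M.analytic_r p hp.1).hasStrictFDerivAt
  have hz' : ∀ᶠ q in 𝓝[{x | M.r x = M.r p}] p, h q = 0 := by
    rw [eventually_nhdsWithin_iff] at hz ⊢
    filter_upwards [hz, M.isOpen_U.mem_nhds hp.1] with q hq hqU hqr
    exact hq ⟨hqU, (show M.r q = M.r p from hqr).trans hp.2⟩
  -- Lagrange multipliers: `T ∘ h` vanishes on a level set of `r`, so `p` is trivially an extremum.
  -- Since `dr ≠ 0`, the multiplier of `d(T ∘ h)` is nonzero, and `d(T ∘ h)` is proportional to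
  -- `dr`.
  have key : ∀ T : ℂ →L[ℝ] ℝ, ∀ v, fderiv ℝ M.r p v = 0 → T (fderiv ℝ h p v) = 0 := by
    intro T v hv
    have hT := T.hasStrictFDerivAt.comp p hh.hasStrictFDerivAt
    have hext : IsLocalExtrOn (T ∘ h) {x | M.r x = M.r p} p := by
      refine Or.inl ?_
      have h0 : h p = 0 := hz'.self_of_nhdsWithin rfl
      filter_upwards [hz'] with q hq
      simp [hq, h0]
    obtain ⟨a, b, hab, he⟩ := hext.exists_multipliers_of_hasStrictFDerivAt_1d hr hT
    have hb : b ≠ 0 := by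
      rintro rfl
      have ha : a ≠ 0 := fun ha => hab (by simp [ha])
      refine M.regular_r p hp.1 hp.2 ?_
      simpa [ha] using he
    have := DFunLike.congr_fun he v
    simpa [hv, hb] using this
  have key2 : ∀ v, fderiv ℝ M.r p v = 0 → fderiv ℝ h p v = 0 := fun v hv =>
    Complex.ext (key Complex.reCLM v hv) (key Complex.imCLM v hv)
  rw [deriveAlong_eq_cderiv, cderiv, key2 _ h1, key2 _ h2]
  simp

/-- Extend `X` as a constant field and project it to the tangent spaces along a fixed `e` with
`∂r(e) ≠ 0`. -/
theorem exists_isT10Section (hp : p ∈ M.carrier) {X : CVec N} (hX : X ∈ M.T10 p) :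
    ∃ L, M.IsT10Section p L ∧ L p = X := by
  have hra : AnalyticAt ℝ (fun q => (M.r q : ℂ)) p :=
    (Complex.ofRealCLM.analyticAt _).comp (M.analytic_r p hp.1)
  have hda : ∀ Z : CVec N, AnalyticAt ℝ (fun q => deriveAlong (fun q => (M.r q : ℂ)) q Z) p := by
    intro Z
    simp only [deriveAlong_eq_cderiv, cderiv]
    have h1 : ∀ v, AnalyticAt ℝ (fun q => fderiv ℝ (fun q => (M.r q : ℂ)) q v) p := fun v =>
      (ContinuousLinearMap.apply ℝ ℂ v).analyticAt _ |>.comp hra.fderiv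
    have h2 : ∀ (c : ℂ) {f : (Fin N → ℂ) → ℂ}, AnalyticAt ℝ f p →
        AnalyticAt ℝ (fun q => c • f q) p := fun c f hf => (analyticAt_const (v := c)).smul hf
    exact h2 _ ((h1 _).sub (h2 _ (h1 _)))
  obtain ⟨e, he⟩ : ∃ e : Fin N → ℂ, deriveAlong (fun q => (M.r q : ℂ)) p (e, 0) ≠ 0 := by
    by_contra! hcon
    refine M.regular_r p hp.1 hp.2 (ContinuousLinearMap.ext fun v => ?_)
    have : ((v, 0) : CVec N) ∈ M.CT p := hcon v
    simpa using ((M.mem_CT_iff hp).1 this).1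
  obtain ⟨hX1, hX2⟩ := M.mem_T10_iff.1 hX
  have hXe : X = (X.1, 0) := Prod.ext rfl hX2
  refine ⟨fun q => (X.1, 0) - (deriveAlong (fun q => (M.r q : ℂ)) q (X.1, 0)
    / deriveAlong (fun q => (M.r q : ℂ)) q (e, 0)) • ((e, 0) : CVec N), ⟨?_, ?_⟩, ?_⟩
  · exact analyticAt_const.sub (((hda _).div (hda _) he).smul analyticAt_const)
  · refine nhdsWithin_le_nhds ?_
    filter_upwards [(hda (e, 0)).continuousAt.eventually_ne he] with q hq
    refine M.mem_T10_iff.2 ⟨?_, by simp⟩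
    rw [CT, LinearMap.mem_ker, map_sub, map_smul, smul_eq_mul, div_mul_cancel₀ _ hq, sub_self]
  · have : deriveAlong (fun q => (M.r q : ℂ)) p (X.1, 0) = 0 := by rw [← hXe]; exact hX1
    simp only [this, zero_div, zero_smul, sub_zero]
    exact hXe.symm

end LocalHypersurface

end CRGeometry

end

/-! ### The Levi form through mixed second derivatives. -/

noncomputable section

namespace CRGeometry

section LeviForm

variable {N : ℕ} {E : Type*} [NormedAddCommGroup E] [NormedSpace ℂ E]
  [StarAddMonoid E]

/-- The pair `(Φ, Φ̄)` of a map and its complex conjugate. -/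
def conjPair (Φ : (Fin N → ℂ) → E) (q : Fin N → ℂ) : E × E := (Φ q, star (Φ q))

/-- The image of a complexified tangent vector under the differential of `(Φ, Φ̄)`, where `Φ` is
holomorphic. -/
def push (Φ : (Fin N → ℂ) → E) (q : Fin N → ℂ) (Z : CVec N) : E × E :=
  (fderiv ℂ Φ q Z.1, star (fderiv ℂ Φ q (star Z.2)))

theorem push_left (Φ : (Fin N → ℂ) → E) (q : Fin N → ℂ) (a : Fin N → ℂ) :
    push Φ q (a, 0) = (fderiv ℂ Φ q a, 0) := by simp [push]

theorem push_right (Φ : (Fin N → ℂ) → E) (q : Fin N → ℂ) (b : Fin N → ℂ) :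
    push Φ q (0, b) = (0, star (fderiv ℂ Φ q (star b))) := by simp [push]

/-- Near `p ∈ M`, the tangent spaces of `M` are given by the differential of a function
`s (Φ, Φ̄)`, where `s` and `Φ` are holomorphic. -/
structure IsDefining (M : LocalHypersurface N) (Φ : (Fin N → ℂ) → E) (s : E × E → ℂ)
    (p : Fin N → ℂ) : Prop where
  mem : p ∈ M.carrier
  analyticAt_chart : AnalyticAt ℂ Φ p
  bijective_fderiv : Function.Bijective (fderiv ℂ Φ p)
  analyticAt_fun : AnalyticAt ℂ s (conjPair Φ p)
  tangent : ∀ᶠ q in 𝓝[M.carrier] p, ∀ Z, Z ∈ M.CT q ↔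
    fderiv ℂ s (conjPair Φ q) (push Φ q Z) = 0

/-- The differential of `Φ` depends holomorphically on the point, so an antiholomorphic derivative
only meets the coefficients `a`. -/
theorem cderiv_fderiv_apply {F : Type*} [NormedAddCommGroup F] [NormedSpace ℂ F] [CompleteSpace F]
    {Φ : (Fin N → ℂ) → F} {p : Fin N → ℂ}
    (hΦ : AnalyticAt ℂ Φ p) {a : (Fin N → ℂ) → Fin N → ℂ} (ha : DifferentiableAt ℝ a p)
    (b : Fin N → ℂ) :
    cderiv (fun q => fderiv ℂ Φ q (a q)) p (0, b) = fderiv ℂ Φ p (cderiv a p (0, b)) := by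
  rw [cderiv_clm_apply (hΦ.fderiv.differentiableAt.restrictScalars ℝ) ha,
    cderiv_of_differentiableAt hΦ.fderiv.differentiableAt]
  simp

theorem cderiv_const {F : Type*} [NormedAddCommGroup F] [NormedSpace ℂ F] (c : F)
    (p : Fin N → ℂ) (Z : CVec N) : cderiv (fun _ => c) p Z = 0 := by
  simp [cderiv]

variable {M : LocalHypersurface N} {Φ : (Fin N → ℂ) → E} {s : E × E → ℂ} {p : Fin N → ℂ}
  {L L' : (Fin N → ℂ) → CVec N}

theorem LocalHypersurface.cderiv_eq_zero {n : ℕ} (hp : p ∈ M.carrier)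
    {h : (Fin N → ℂ) → Fin n → ℂ}
    (hh : AnalyticAt ℝ h p) (hz : ∀ᶠ q in 𝓝[M.carrier] p, h q = 0) {Z : CVec N}
    (hZ : Z ∈ M.CT p) : cderiv h p Z = 0 := by
  ext j
  rw [← cderiv_pi hh.differentiableAt]
  refine M.deriveAlong_eq_zero hp (analyticAt_pi_iff.1 hh j) ?_ hZ
  filter_upwards [hz] with q hq
  simp [hq]

theorem LocalHypersurface.IsT10Section.mem (hp : p ∈ M.carrier) (hL : M.IsT10Section p L) :
    L p ∈ M.T10 p := hL.2.self_of_nhdsWithin hp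

theorem LocalHypersurface.IsT10Section.analyticAt_fst (hL : M.IsT10Section p L) :
    AnalyticAt ℝ (fun q => (L q).1) p :=
  (ContinuousLinearMap.fst ℝ (Fin N → ℂ) (Fin N → ℂ)).analyticAt _ |>.comp hL.1

theorem LocalHypersurface.IsT10Section.analyticAt_snd (hL : M.IsT10Section p L) :
    AnalyticAt ℝ (fun q => (L q).2) p :=
  (ContinuousLinearMap.snd ℝ (Fin N → ℂ) (Fin N → ℂ)).analyticAt _ |>.comp hL.1

theorem analyticAt_real_star {F : Type*} [NormedAddCommGroup F] [NormedSpace ℝ F] [StarAddMonoid F]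
    [NormedStarGroup F] [StarModule ℝ F] {h : (Fin N → ℂ) → F} (hh : AnalyticAt ℝ h p) :
    AnalyticAt ℝ (fun q => star (h q)) p :=
  ((starL' ℝ : F ≃L[ℝ] F).analyticAt _).comp hh

/-- The `(1,0)` part of the conjugate of `L'` vanishes on `M` only, as sections are ambient
extensions. This suffices because `L p` is tangent to `M`, and only the derivative of the
coefficients of `L` remains. -/
theorem bracket_conjField_fst (hp : p ∈ M.carrier) (hL : M.IsT10Section p L)
    (hL' : M.IsT10Section p L') :
    (bracket L (conjField L') p).1 = -cderiv (fun q => (L q).1) p (0, star (L' p).1) := by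
  have h1 : cderiv (fun q => star (L' q).2) p (L p) = 0 := by
    refine LocalHypersurface.cderiv_eq_zero hp (analyticAt_real_star hL'.analyticAt_snd) ?_
      (M.mem_T10_iff.1 (hL.mem hp)).1
    filter_upwards [hL'.2] with q hq
    rw [(M.mem_T10_iff.1 hq).2, star_zero]
  have h2 : conjField L' p = (0, star (L' p).1) := by
    have : conjField L' p = (star (L' p).2, star (L' p).1) := rfl
    rw [this, (M.mem_T10_iff.1 (hL'.mem hp)).2, star_zero]
  ext j
  have e1 : deriveAlong (fun q => (conjField L' q).1 j) p (L p)
      = cderiv (fun q => star (L' q).2) p (L p) j :=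
    cderiv_pi (h := fun q => star (L' q).2)
      (analyticAt_real_star hL'.analyticAt_snd).differentiableAt _ j
  have e2 := cderiv_pi hL.analyticAt_fst.differentiableAt (conjField L' p) j
  rw [h2] at e2
  simp only [bracket, e1, e2, h1, h2]
  simp

theorem bracket_conjField_snd (hp : p ∈ M.carrier) (hL : M.IsT10Section p L)
    (hL' : M.IsT10Section p L') :
    (bracket L (conjField L') p).2 = star (cderiv (fun q => (L' q).1) p (0, star (L p).1)) := by
  have h1 : cderiv (fun q => (L q).2) p (conjField L' p) = 0 := by
    refine LocalHypersurface.cderiv_eq_zero hp hL.analyticAt_snd ?_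
      (M.star_mem_CT hp (M.mem_T10_iff.1 (hL'.mem hp)).1)
    filter_upwards [hL.2] with q hq
    rw [(M.mem_T10_iff.1 hq).2]
  have h2 := cderiv_star hL'.analyticAt_fst.differentiableAt (L p)
  rw [(M.mem_T10_iff.1 (hL.mem hp)).2, star_zero] at h2
  ext j
  have e1 : deriveAlong (fun q => (conjField L' q).2 j) p (L p)
      = cderiv (fun q => star (L' q).1) p (L p) j :=
    cderiv_pi (h := fun q => star (L' q).1)
      (analyticAt_real_star hL'.analyticAt_fst).differentiableAt _ j
  have e2 := cderiv_pi hL.analyticAt_snd.differentiableAt (conjField L' p) j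
  simp only [bracket, e1, e2, h1, h2]
  simp

theorem IsDefining.analyticAt_fderiv_apply [CompleteSpace E] (h : IsDefining M Φ s p)
    {a : (Fin N → ℂ) → Fin N → ℂ} (ha : AnalyticAt ℝ a p) : AnalyticAt ℝ (fun q => fderiv ℂ Φ q (a q)) p := by
  have hB' : AnalyticAt ℝ (fun q => ContinuousLinearMap.restrictScalarsL ℂ (Fin N → ℂ) E ℝ ℝ
      (fderiv ℂ Φ q)) p :=
    ((ContinuousLinearMap.restrictScalarsL ℂ (Fin N → ℂ) E ℝ ℝ).analyticAt _).comp
      (h.analyticAt_chart.fderiv.restrictScalars (𝕜 := ℝ))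
  exact ((hB'.contDiffAt (n := ⊤)).clm_apply (ha.contDiffAt (n := ⊤))).analyticAt

theorem IsDefining.mem_CT_iff (h : IsDefining M Φ s p) (Z : CVec N) :
    Z ∈ M.CT p ↔ fderiv ℂ s (conjPair Φ p) (push Φ p Z) = 0 :=
  h.tangent.self_of_nhdsWithin h.mem Z

variable [NormedStarGroup E] [StarModule ℂ E]

theorem differentiableAt_conjPair (hΦ : AnalyticAt ℂ Φ p) :
    DifferentiableAt ℝ (conjPair Φ) p := by
  have : StarModule ℝ E := ⟨fun c x => by
    rw [← Complex.coe_smul, star_smul, ← Complex.coe_smul]; simp⟩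
  have h1 := hΦ.differentiableAt.restrictScalars ℝ
  exact h1.prodMk (((starL' ℝ : E ≃L[ℝ] E).differentiableAt).comp p h1)

theorem cderiv_conjPair (hΦ : AnalyticAt ℂ Φ p) (Z : CVec N) :
    cderiv (conjPair Φ) p Z = push Φ p Z := by
  have : StarModule ℝ E := ⟨fun c x => by
    rw [← Complex.coe_smul, star_smul, ← Complex.coe_smul]; simp⟩
  have h1 := hΦ.differentiableAt.restrictScalars ℝ
  have h2 : DifferentiableAt ℝ (fun q => star (Φ q)) p :=
    ((starL' ℝ : E ≃L[ℝ] E).differentiableAt).comp p h1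
  have h3 := cderiv_prodMk h1 h2 Z
  rw [cderiv_star h1, cderiv_of_differentiableAt hΦ.differentiableAt,
    cderiv_of_differentiableAt hΦ.differentiableAt] at h3
  exact h3

theorem cderiv_comp_conjPair {F : Type*} [NormedAddCommGroup F] [NormedSpace ℂ F]
    {G : E × E → F} (hΦ : AnalyticAt ℂ Φ p) (hG : DifferentiableAt ℂ G (conjPair Φ p))
    (Z : CVec N) :
    cderiv (fun q => G (conjPair Φ q)) p Z = fderiv ℂ G (conjPair Φ p) (push Φ p Z) := by
  rw [cderiv_comp hG (differentiableAt_conjPair hΦ), cderiv_conjPair hΦ]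

/-- The differential of `s (Φ, Φ̄)` along a vector field `(a, b)` differentiated along `M`. -/
theorem fderiv_fderiv_add_eq_zero [CompleteSpace E] (h : IsDefining M Φ s p)
    {v : (Fin N → ℂ) → E × E} (hv : AnalyticAt ℝ v p)
    (hz : ∀ᶠ q in 𝓝[M.carrier] p, fderiv ℂ s (conjPair Φ q) (v q) = 0)
    {Z : CVec N} (hZ : Z ∈ M.CT p) :
    fderiv ℂ (fderiv ℂ s) (conjPair Φ p) (push Φ p Z) (v p)
      + fderiv ℂ s (conjPair Φ p) (cderiv v p Z) = 0 := by
  have : StarModule ℝ E := ⟨fun c x => by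
    rw [← Complex.coe_smul, star_smul, ← Complex.coe_smul]; simp⟩
  have hΦr : AnalyticAt ℝ Φ p := h.analyticAt_chart.restrictScalars
  have hpa : AnalyticAt ℝ (conjPair Φ) p := hΦr.prod (analyticAt_real_star hΦr)
  have hB : AnalyticAt ℝ (fun q => fderiv ℂ s (conjPair Φ q)) p :=
    (h.analyticAt_fun.fderiv.restrictScalars (𝕜 := ℝ)).comp hpa
  have hB' : AnalyticAt ℝ (fun q => ContinuousLinearMap.restrictScalarsL ℂ (E × E) ℂ ℝ ℝ
      (fderiv ℂ s (conjPair Φ q))) p :=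
    ((ContinuousLinearMap.restrictScalarsL ℂ (E × E) ℂ ℝ ℝ).analyticAt _).comp hB
  have hf : AnalyticAt ℝ (fun q => fderiv ℂ s (conjPair Φ q) (v q)) p := by
    have := (hB'.contDiffAt (n := ⊤)).clm_apply (hv.contDiffAt (n := ⊤))
    exact this.analyticAt
  have h1 := M.deriveAlong_eq_zero h.mem hf hz hZ
  rw [deriveAlong_eq_cderiv, cderiv_clm_apply hB.differentiableAt hv.differentiableAt,
    cderiv_comp_conjPair h.analyticAt_chart h.analyticAt_fun.fderiv.differentiableAt] at h1
  exact h1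

variable [CompleteSpace E]

/-- Differentiate the tangency equation of `L` along the conjugate of `L'`. The product rule trades
the derivative of the coefficients, which is minus the `(1,0)` part of the bracket, for a mixed
second derivative of `s`. -/
theorem IsDefining.fderiv_bracket_fst (h : IsDefining M Φ s p) (hL : M.IsT10Section p L)
    (hL' : M.IsT10Section p L') :
    fderiv ℂ s (conjPair Φ p) (push Φ p ((bracket L (conjField L') p).1, 0))
      = fderiv ℂ (fderiv ℂ s) (conjPair Φ p) (0, star (fderiv ℂ Φ p (L' p).1))
        (fderiv ℂ Φ p (L p).1, 0) := by
  have hκ := h.analyticAt_fderiv_apply hL.analyticAt_fst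
  have hv : AnalyticAt ℝ (fun q => ((fderiv ℂ Φ q (L q).1, 0) : E × E)) p :=
    hκ.prod analyticAt_const
  have hZ : ((0, star (L' p).1) : CVec N) ∈ M.CT p := by
    have h1 := M.mem_T10_iff.1 (hL'.mem h.mem)
    have := M.star_mem_CT h.mem h1.1
    rwa [h1.2, star_zero] at this
  have := fderiv_fderiv_add_eq_zero h hv (by
    filter_upwards [h.tangent, hL.2] with q h1 h2
    have h3 := M.mem_T10_iff.1 h2
    rw [← push_left, ← h1, ← h3.2]
    exact h3.1) hZ
  rw [cderiv_prodMk hκ.differentiableAt (differentiableAt_const _), cderiv_const,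
    cderiv_fderiv_apply h.analyticAt_chart hL.analyticAt_fst.differentiableAt, push_right,
    star_star] at this
  rw [bracket_conjField_fst h.mem hL hL', push_left, map_neg]
  have e : ((-(fderiv ℂ Φ p) (cderiv (fun q => (L q).1) p (0, star (L' p).1)), 0) : E × E)
      = -(((fderiv ℂ Φ p) (cderiv (fun q => (L q).1) p (0, star (L' p).1)), 0) : E × E) := by
    simp
  rw [e, map_neg]
  linear_combination -this

theorem IsDefining.fderiv_bracket_snd (h : IsDefining M Φ s p) (hL : M.IsT10Section p L)
    (hL' : M.IsT10Section p L') :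
    fderiv ℂ s (conjPair Φ p) (push Φ p (0, (bracket L (conjField L') p).2))
      = -fderiv ℂ (fderiv ℂ s) (conjPair Φ p) (fderiv ℂ Φ p (L p).1, 0)
        (0, star (fderiv ℂ Φ p (L' p).1)) := by
  have : StarModule ℝ E := ⟨fun c x => by
    rw [← Complex.coe_smul, star_smul, ← Complex.coe_smul]; simp⟩
  have hκ := h.analyticAt_fderiv_apply hL'.analyticAt_fst
  have hκs : AnalyticAt ℝ (fun q => star (fderiv ℂ Φ q (L' q).1)) p := analyticAt_real_star hκ
  have hv : AnalyticAt ℝ (fun q => ((0, star (fderiv ℂ Φ q (L' q).1)) : E × E)) p :=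
    analyticAt_const.prod hκs
  have h2 := M.mem_T10_iff.1 (hL.mem h.mem)
  have hLp : L p = ((L p).1, 0) := Prod.ext rfl h2.2
  have := fderiv_fderiv_add_eq_zero h hv (by
    have hc : ∀ᶠ q in 𝓝[M.carrier] p, q ∈ M.carrier := self_mem_nhdsWithin
    filter_upwards [h.tangent, hL'.2, hc] with q h1 h2 h4
    have h3 := M.mem_T10_iff.1 h2
    have h5 := M.star_mem_CT h4 h3.1
    rw [h3.2, star_zero, h1, push_right, star_star] at h5
    exact h5) h2.1
  rw [cderiv_prodMk (differentiableAt_const _) hκs.differentiableAt, cderiv_const,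
    cderiv_star hκ.differentiableAt, h2.2, star_zero,
    cderiv_fderiv_apply h.analyticAt_chart hL'.analyticAt_fst.differentiableAt, hLp,
    push_left] at this
  rw [bracket_conjField_snd h.mem hL hL', push_right, star_star]
  linear_combination this

/-- The Levi form in terms of the mixed second derivatives of a defining function. -/
theorem IsDefining.leviForm_eq_zero_iff (h : IsDefining M Φ s p) (hL : M.IsT10Section p L)
    (hL' : M.IsT10Section p L') :
    M.leviForm L L' p = 0 ↔
      fderiv ℂ (fderiv ℂ s) (conjPair Φ p) (0, star (fderiv ℂ Φ p (L' p).1))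
        (fderiv ℂ Φ p (L p).1, 0) = 0 := by
  have hsym : IsSymmSndFDerivAt ℂ s (conjPair Φ p) :=
    (h.analyticAt_fun.contDiffAt (n := ⊤)).isSymmSndFDerivAt (by simp)
  rw [← h.fderiv_bracket_fst hL hL', ← h.mem_CT_iff, LocalHypersurface.leviForm,
    Submodule.Quotient.mk_eq_zero, Submodule.smul_mem_iff _ Complex.I_ne_zero]
  have e : bracket L (conjField L') p = ((bracket L (conjField L') p).1, 0)
      + (0, (bracket L (conjField L') p).2) := by simp
  constructor
  · intro hb
    obtain ⟨t, ht, t', ht', he⟩ := Submodule.mem_sup.1 hb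
    rw [M.mem_T10_iff] at ht
    rw [M.mem_T01_iff] at ht'
    rw [← he]
    have : ((t + t').1, (0 : Fin N → ℂ)) = t := Prod.ext (by simp [ht'.2]) ht.2.symm
    rw [this]
    exact ht.1
  · intro hb
    rw [e]
    -- By the symmetry of the second derivative, `ds` takes opposite values on the `(1,0)` and
    -- `(0,1)` parts of the bracket, so both are tangent as soon as one is.
    refine Submodule.add_mem_sup (M.mem_T10_iff.2 ⟨hb, rfl⟩) (M.mem_T01_iff.2 ⟨?_, rfl⟩)
    rw [h.mem_CT_iff, h.fderiv_bracket_snd hL hL', neg_eq_zero, hsym.eq,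
      ← h.fderiv_bracket_fst hL hL', ← h.mem_CT_iff]
    exact hb

theorem IsDefining.mem_K10_iff (h : IsDefining M Φ s p) {X : CVec N} :
    X ∈ M.K10 p ↔ X ∈ M.T10 p ∧ ∀ Y ∈ M.T10 p,
      fderiv ℂ (fderiv ℂ s) (conjPair Φ p) (0, star (fderiv ℂ Φ p Y.1))
        (fderiv ℂ Φ p X.1, 0) = 0 := by
  constructor
  · rintro ⟨L, hL, rfl, hK⟩
    refine ⟨hL.mem h.mem, fun Y hY => ?_⟩
    obtain ⟨L', hL', rfl⟩ := M.exists_isT10Section h.mem hY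
    exact (h.leviForm_eq_zero_iff hL hL').1 (hK L' hL')
  · rintro ⟨hX, hK⟩
    obtain ⟨L, hL, rfl⟩ := M.exists_isT10Section h.mem hX
    exact ⟨L, hL, rfl, fun L' hL' => (h.leviForm_eq_zero_iff hL hL').2 (hK _ (hL'.mem h.mem))⟩

end LeviForm

end CRGeometry

end

/-! ### The defining function of a graph, and what Levi rank one provides. -/

noncomputable section

namespace CRGeometry

theorem AnalyticAt.eventually_comp {E F G : Type*} [NormedAddCommGroup E] [NormedSpace ℂ E]
    [NormedAddCommGroup F] [NormedSpace ℂ F] [CompleteSpace F] [TopologicalSpace G]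
    {f : E → F} {x : E} {k : G → E} {y : G}
    (hf : AnalyticAt ℂ f x) (hk : Tendsto k (𝓝 y) (𝓝 x)) : ∀ᶠ t in 𝓝 y, AnalyticAt ℂ f (k t) :=
  hk.eventually hf.eventually_analyticAt

theorem hasFDerivAt_fderiv {E F : Type*} [NormedAddCommGroup E] [NormedSpace ℂ E]
    [NormedAddCommGroup F] [NormedSpace ℂ F] [CompleteSpace F] {f : E → F} {x : E}
    (hf : AnalyticAt ℂ f x) : HasFDerivAt (fderiv ℂ f) (fderiv ℂ (fderiv ℂ f) x) x :=
  hf.fderiv.differentiableAt.hasFDerivAt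

/-- The function `(z, w, ζ, ω) ↦ (w - ω) / 2i`. -/
def imPart : (((Fin 2 → ℂ) × ℂ) × ((Fin 2 → ℂ) × ℂ)) →L[ℂ] ℂ :=
  (1 / (2 * Complex.I) : ℂ) • ((ContinuousLinearMap.snd ℂ _ _).comp (ContinuousLinearMap.fst ℂ _ _)
    - (ContinuousLinearMap.snd ℂ _ _).comp (ContinuousLinearMap.snd ℂ _ _))

/-- The function `(z, w, ζ, ω) ↦ (z, ζ, (w + ω) / 2)`. -/
def graphPoint : (((Fin 2 → ℂ) × ℂ) × ((Fin 2 → ℂ) × ℂ)) →L[ℂ]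
    ((Fin 2 → ℂ) × (Fin 2 → ℂ) × ℂ) :=
  ((ContinuousLinearMap.fst ℂ _ _).comp (ContinuousLinearMap.fst ℂ _ _)).prod
    (((ContinuousLinearMap.fst ℂ _ _).comp (ContinuousLinearMap.snd ℂ _ _)).prod
      ((1 / 2 : ℂ) • ((ContinuousLinearMap.snd ℂ _ _).comp (ContinuousLinearMap.fst ℂ _ _)
    + (ContinuousLinearMap.snd ℂ _ _).comp (ContinuousLinearMap.snd ℂ _ _))))

theorem imPart_apply (p : ((Fin 2 → ℂ) × ℂ) × ((Fin 2 → ℂ) × ℂ)) :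
    imPart p = 1 / (2 * Complex.I) * (p.1.2 - p.2.2) := rfl

theorem graphPoint_apply (p : ((Fin 2 → ℂ) × ℂ) × ((Fin 2 → ℂ) × ℂ)) :
    graphPoint p = (p.1.1, p.2.1, 1 / 2 * (p.1.2 + p.2.2)) := rfl

/-- The complexified defining function of the graph of `F`. -/
def graphDefining (F : (Fin 2 → ℂ) × (Fin 2 → ℂ) × ℂ → ℂ)
    (p : ((Fin 2 → ℂ) × ℂ) × ((Fin 2 → ℂ) × ℂ)) : ℂ := imPart p - F (graphPoint p)

section

variable {F : (Fin 2 → ℂ) × (Fin 2 → ℂ) × ℂ → ℂ} {p : ((Fin 2 → ℂ) × ℂ) × ((Fin 2 → ℂ) × ℂ)}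

theorem analyticAt_graphDefining (hF : AnalyticAt ℂ F (graphPoint p)) :
    AnalyticAt ℂ (graphDefining F) p :=
  (imPart.analyticAt p).sub (hF.fun_comp (graphPoint.analyticAt p))

theorem hasFDerivAt_graphDefining (hF : AnalyticAt ℂ F (graphPoint p)) :
    HasFDerivAt (graphDefining F) (imPart - (fderiv ℂ F (graphPoint p)).comp graphPoint) p :=
  imPart.hasFDerivAt.sub (hF.differentiableAt.hasFDerivAt.comp p graphPoint.hasFDerivAt)

theorem fderiv_graphDefining (hF : AnalyticAt ℂ F (graphPoint p))
    (v : ((Fin 2 → ℂ) × ℂ) × ((Fin 2 → ℂ) × ℂ)) :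
    fderiv ℂ (graphDefining F) p v = imPart v - fderiv ℂ F (graphPoint p) (graphPoint v) := by
  rw [(hasFDerivAt_graphDefining hF).fderiv]
  rfl

theorem fderiv_fderiv_graphDefining (hF : AnalyticAt ℂ F (graphPoint p))
    (v w : ((Fin 2 → ℂ) × ℂ) × ((Fin 2 → ℂ) × ℂ)) :
    fderiv ℂ (fderiv ℂ (graphDefining F)) p v w
      = -fderiv ℂ (fderiv ℂ F) (graphPoint p) (graphPoint v) (graphPoint w) := by
  have h1 : fderiv ℂ (graphDefining F) =ᶠ[𝓝 p]
      fun q => imPart - (fderiv ℂ F (graphPoint q)).comp graphPoint := by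
    filter_upwards [AnalyticAt.eventually_comp hF graphPoint.continuous.continuousAt] with q hq
    exact (hasFDerivAt_graphDefining hq).fderiv
  have h2 : HasFDerivAt (fun q => fderiv ℂ F (graphPoint q))
      ((fderiv ℂ (fderiv ℂ F) (graphPoint p)).comp graphPoint) p :=
    (hasFDerivAt_fderiv hF).comp p graphPoint.hasFDerivAt
  have h3 := (hasFDerivAt_const imPart p).sub (h2.clm_comp (hasFDerivAt_const graphPoint p))
  rw [h1.fderiv_eq]
  have h4 : fderiv ℂ (fun q => imPart - (fderiv ℂ F (graphPoint q)).comp graphPoint) p = _ :=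
    h3.fderiv
  rw [h4]
  simp

end

section LeviRank

variable {N : ℕ} {E : Type*} [NormedAddCommGroup E] [NormedSpace ℂ E] [CompleteSpace E]
  [StarAddMonoid E] [NormedStarGroup E] [StarModule ℂ E]
  {M : LocalHypersurface N} {Φ : (Fin N → ℂ) → E} {s : E × E → ℂ} {p : Fin N → ℂ}

omit [CompleteSpace E] [NormedStarGroup E] [StarModule ℂ E] in
theorem IsDefining.mem_T10_iff (h : IsDefining M Φ s p) {X : CVec N} :
    X ∈ M.T10 p ↔ X.2 = 0 ∧ fderiv ℂ s (conjPair Φ p) (fderiv ℂ Φ p X.1, 0) = 0 := by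
  rw [M.mem_T10_iff, h.mem_CT_iff, and_comm]
  refine and_congr_right fun hX => ?_
  have : X = (X.1, 0) := Prod.ext rfl hX
  rw [this, push_left]

/-- Since `dΦ` is onto and `M.CT p` is stable under conjugation, the conjugates of the images of
`T^{1,0}` vectors are exactly the `β` annihilated by `ds`. Test vectors may thus be chosen freely in
the `ζ` coordinates. -/
theorem IsDefining.mem_K10_iff_forall (h : IsDefining M Φ s p) {X : CVec N} :
    X ∈ M.K10 p ↔ X ∈ M.T10 p ∧ ∀ β, fderiv ℂ s (conjPair Φ p) (0, β) = 0 →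
      fderiv ℂ (fderiv ℂ s) (conjPair Φ p) (0, β) (fderiv ℂ Φ p X.1, 0) = 0 := by
  rw [h.mem_K10_iff]
  refine and_congr_right fun _ => ⟨fun hX β hβ => ?_, fun hX Y hY => hX _ ?_⟩
  · obtain ⟨b, hb⟩ := h.bijective_fderiv.2 (star β)
    have h1 : ((0, star b) : CVec N) ∈ M.CT p := by
      rw [h.mem_CT_iff, push_right, star_star, hb, star_star]
      exact hβ
    have h2 := M.star_mem_CT h.mem h1
    simp only [star_star, star_zero] at h2
    have := hX (b, 0) (M.mem_T10_iff.2 ⟨h2, rfl⟩)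
    rwa [hb, star_star] at this
  · have h1 := M.mem_T10_iff.1 hY
    have h2 := M.star_mem_CT h.mem h1.1
    rwa [h1.2, star_zero, h.mem_CT_iff, push_right, star_star] at h2

theorem IsDefining.bracket_mem_CT (h : IsDefining M Φ s p) {L L' : (Fin N → ℂ) → CVec N}
    (hL : M.IsT10Section p L) (hL' : M.IsT10Section p L') (hz : M.leviForm L L' p = 0) :
    ((bracket L (conjField L') p).1, 0) ∈ M.CT p ∧
      (0, (bracket L (conjField L') p).2) ∈ M.CT p := by
  have hsym : IsSymmSndFDerivAt ℂ s (conjPair Φ p) :=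
    (h.analyticAt_fun.contDiffAt (n := ⊤)).isSymmSndFDerivAt (by simp)
  rw [h.leviForm_eq_zero_iff hL hL'] at hz
  rw [h.mem_CT_iff, h.mem_CT_iff, h.fderiv_bracket_fst hL hL', h.fderiv_bracket_snd hL hL',
    hsym.eq (fderiv ℂ Φ p (L p).1, 0), hz]
  simp

omit [CompleteSpace E] [NormedStarGroup E] [StarModule ℂ E] [StarAddMonoid E]
  [NormedAddCommGroup E] [NormedSpace ℂ E] in
theorem LocalHypersurface.le_finrank_T10 (M : LocalHypersurface N) (p : Fin N → ℂ) :
    N ≤ Module.finrank ℂ (M.T10 p) + 1 := by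
  let ℓ : (Fin N → ℂ) →ₗ[ℂ] ℂ :=
    deriveAlong (fun q => (M.r q : ℂ)) p ∘ₗ LinearMap.inl ℂ (Fin N → ℂ) (Fin N → ℂ)
  have h1 := LinearMap.finrank_range_add_finrank_ker ℓ
  have h2 : Module.finrank ℂ (LinearMap.range ℓ) ≤ 1 := by
    simpa using Submodule.finrank_le (LinearMap.range ℓ)
  have h3 : (LinearMap.ker ℓ).map (LinearMap.inl ℂ (Fin N → ℂ) (Fin N → ℂ)) ≤ M.T10 p := by
    rintro _ ⟨a, ha, rfl⟩
    exact M.mem_T10_iff.2 ⟨ha, rfl⟩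
  have h4 : Module.finrank ℂ (LinearMap.ker ℓ) ≤ Module.finrank ℂ (M.T10 p) :=
    (Submodule.equivMapOfInjective _ LinearMap.inl_injective _).finrank_eq.le.trans
      (Submodule.finrank_mono h3)
  simp at h1
  omega

/-- In `ℂ³` the space `T^{1,0}` has dimension at least two, more than the rank. -/
theorem LocalHypersurface.exists_mem_K10_ne_zero {M : LocalHypersurface 3} {p : Fin 3 → ℂ}
    (h : M.leviRank p = 1) : ∃ X ∈ M.K10 p, X ≠ 0 := by
  by_contra! hcon
  have h1 : (M.K10 p).submoduleOf (M.T10 p) = ⊥ := by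
    rw [eq_bot_iff]
    intro x hx
    exact Submodule.mem_bot ℂ |>.2 (Subtype.ext (hcon _ hx))
  have h2 := M.le_finrank_T10 p
  rw [leviRank, h1, (Submodule.quotEquivOfEqBot _ rfl).finrank_eq] at h
  omega

theorem LocalHypersurface.exists_mem_T10_notMem_K10 {M : LocalHypersurface N}
    (h : M.leviRank p = 1) : ∃ X ∈ M.T10 p, X ∉ M.K10 p := by
  by_contra! hcon
  have h1 : (M.K10 p).submoduleOf (M.T10 p) = ⊤ := by
    rw [eq_top_iff]
    intro x _
    exact hcon _ x.2
  rw [leviRank, h1] at h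
  have : Subsingleton (M.T10 p ⧸ (⊤ : Submodule ℂ (M.T10 p))) :=
    Submodule.Quotient.subsingleton_iff.2 rfl
  rw [Module.finrank_zero_of_subsingleton] at h
  exact absurd h (by norm_num)

end LeviRank

end CRGeometry

end

/-! ### Charts of the normal form and tangent spaces of the graph. -/

noncomputable section

namespace CRGeometry

theorem eventually_fderiv_eq_zero_of_comp {E E' F : Type*} [NormedAddCommGroup E]
    [NormedSpace ℂ E] [NormedAddCommGroup E'] [NormedSpace ℂ E'] [NormedAddCommGroup F]
    [NormedSpace ℂ F] [CompleteSpace F] {f : E → F} (hf : AnalyticAt ℂ f 0) (i : E' →L[ℂ] E)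
    (h : ∀ᶠ y in 𝓝 0, f (i y) = 0) :
    (∀ᶠ y in 𝓝 0, ∀ v, fderiv ℂ f (i y) (i v) = 0) ∧
      ∀ᶠ y in 𝓝 0, ∀ v w, fderiv ℂ (fderiv ℂ f) (i y) (i v) (i w) = 0 := by
  have hi : Tendsto i (𝓝 0) (𝓝 0) := tendsto_zero_of_continuousAt i.continuous.continuousAt (by simp)
  have h1 : ∀ᶠ y in 𝓝 0, ∀ v, fderiv ℂ f (i y) (i v) = 0 := by
    filter_upwards [AnalyticAt.eventually_comp hf hi, h.eventually_nhds] with y hy1 hy2 v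
    have e1 := hy1.differentiableAt.hasFDerivAt.comp y i.hasFDerivAt
    have e2 : HasFDerivAt (f ∘ i) (0 : E' →L[ℂ] F) y :=
      (hasFDerivAt_const (0 : F) y).congr_of_eventuallyEq hy2
    exact DFunLike.congr_fun (e1.unique e2) v
  refine ⟨h1, ?_⟩
  filter_upwards [AnalyticAt.eventually_comp hf hi, h1.eventually_nhds] with y hy1 hy2 v w
  have e1 := ((hasFDerivAt_fderiv hy1).comp y i.hasFDerivAt).clm_apply (hasFDerivAt_const (i w) y)
  have e2 : HasFDerivAt (fun y => fderiv ℂ f (i y) (i w)) (0 : E' →L[ℂ] F) y :=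
    (hasFDerivAt_const (0 : F) y).congr_of_eventuallyEq (hy2.mono fun t ht => ht w)
  simpa using DFunLike.congr_fun (e1.unique e2) v

/-- The coefficient `∂s/∂w` of a graph. -/
def wCoeff (F : (Fin 2 → ℂ) × (Fin 2 → ℂ) × ℂ → ℂ) (x : (Fin 2 → ℂ) × (Fin 2 → ℂ) × ℂ) : ℂ :=
  1 / (2 * Complex.I) - fderiv ℂ F x (0, 0, 1) / 2

/-- The coefficient `∂s/∂w̄` of a graph. -/
def wbarCoeff (F : (Fin 2 → ℂ) × (Fin 2 → ℂ) × ℂ → ℂ) (x : (Fin 2 → ℂ) × (Fin 2 → ℂ) × ℂ) : ℂ :=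
  -(1 / (2 * Complex.I)) - fderiv ℂ F x (0, 0, 1) / 2

/-- The coefficients `∂F/∂ζ_k(z, 0, 0)`. -/
def gmap (F : (Fin 2 → ℂ) × (Fin 2 → ℂ) × ℂ → ℂ) (z : Fin 2 → ℂ) (k : Fin 2) : ℂ :=
  fderiv ℂ F (z, 0, 0) (0, Pi.single k 1, 0)

section

variable {F : (Fin 2 → ℂ) × (Fin 2 → ℂ) × ℂ → ℂ} {p : ((Fin 2 → ℂ) × ℂ) × ((Fin 2 → ℂ) × ℂ)}

theorem fderiv_apply_split (D : ((Fin 2 → ℂ) × (Fin 2 → ℂ) × ℂ) →L[ℂ] ℂ)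
    (a b : Fin 2 → ℂ) (t : ℂ) : D (a, b, t) = D (a, 0, 0) + D (0, b, 0) + t * D (0, 0, 1) := by
  rw [← smul_eq_mul, ← map_smul, ← map_add, ← map_add]
  simp

theorem fderiv_graphDefining_left (hF : AnalyticAt ℂ F (graphPoint p)) (α : (Fin 2 → ℂ) × ℂ) :
    fderiv ℂ (graphDefining F) p (α, 0)
      = wCoeff F (graphPoint p) * α.2 - fderiv ℂ F (graphPoint p) (α.1, 0, 0) := by
  rw [fderiv_graphDefining hF, imPart_apply, graphPoint_apply (α, 0), fderiv_apply_split, wCoeff]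
  have e : ((0 : Fin 2 → ℂ), (0 : Fin 2 → ℂ), (0 : ℂ)) = 0 := rfl
  simp only [Prod.fst_zero, Prod.snd_zero, e, map_zero]
  ring

theorem fderiv_graphDefining_right (hF : AnalyticAt ℂ F (graphPoint p)) (β : (Fin 2 → ℂ) × ℂ) :
    fderiv ℂ (graphDefining F) p (0, β)
      = wbarCoeff F (graphPoint p) * β.2 - fderiv ℂ F (graphPoint p) (0, β.1, 0) := by
  rw [fderiv_graphDefining hF, imPart_apply, graphPoint_apply (0, β), fderiv_apply_split, wbarCoeff]
  have e : ((0 : Fin 2 → ℂ), (0 : Fin 2 → ℂ), (0 : ℂ)) = 0 := rfl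
  simp only [Prod.fst_zero, Prod.snd_zero, e, map_zero]
  ring

end

section Chart

variable {M : LocalHypersurface 3} {ψ : (Fin 2 → ℂ) × ℂ → (Fin 3 → ℂ)}
  {F : (Fin 2 → ℂ) × (Fin 2 → ℂ) × ℂ → ℂ} {Φ : (Fin 3 → ℂ) → (Fin 2 → ℂ) × ℂ}

theorem IsNormalForm.exists_openPartialHomeomorph (h : IsNormalForm M ψ F) :
    ∃ e : OpenPartialHomeomorph ((Fin 2 → ℂ) × ℂ) (Fin 3 → ℂ),
      (∀ y, e y = ψ y) ∧ 0 ∈ e.source ∧ AnalyticAt ℂ e.symm 0 := by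
  obtain ⟨A, hA⟩ := h.fderiv_param
  have hc : ContDiffAt ℂ ⊤ ψ 0 := h.analyticAt_param.contDiffAt
  refine ⟨hc.toOpenPartialHomeomorph ψ hA (by simp), fun y => rfl,
    hc.mem_toOpenPartialHomeomorph_source hA (by simp), ?_⟩
  have := (hc.to_localInverse hA (by simp)).analyticAt
  rw [h.param_zero] at this
  exact this

/-- `Φ` is a local inverse of the parametrization `ψ`. -/
structure IsLocalChart (ψ : (Fin 2 → ℂ) × ℂ → (Fin 3 → ℂ)) (Φ : (Fin 3 → ℂ) → (Fin 2 → ℂ) × ℂ) :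
    Prop where
  analyticAt : AnalyticAt ℂ Φ 0
  map_zero : Φ 0 = 0
  left_inv : ∀ᶠ y in 𝓝 0, Φ (ψ y) = y
  right_inv : ∀ᶠ q in 𝓝 0, ψ (Φ q) = q

theorem IsNormalForm.exists_isLocalChart (h : IsNormalForm M ψ F) : ∃ Φ, IsLocalChart ψ Φ := by
  obtain ⟨e, he, h0, ha⟩ := h.exists_openPartialHomeomorph
  have h1 : e 0 = 0 := by rw [he, h.param_zero]
  refine ⟨e.symm, ha, ?_, ?_, ?_⟩
  · rw [← h1, e.left_inv h0]
  · filter_upwards [e.open_source.mem_nhds h0] with y hy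
    rw [← he, e.left_inv hy]
  · have h2 : (0 : Fin 3 → ℂ) ∈ e.target := by rw [← h1]; exact e.map_source h0
    filter_upwards [e.open_target.mem_nhds h2] with q hq
    rw [← he, e.right_inv hq]

theorem IsLocalChart.tendsto (hΦ : IsLocalChart ψ Φ) : Tendsto Φ (𝓝 0) (𝓝 0) :=
  tendsto_zero_of_continuousAt hΦ.analyticAt.continuousAt hΦ.map_zero

theorem continuous_conj_graphPoint :
    Continuous fun y : (Fin 2 → ℂ) × ℂ => graphPoint (y, star y) := by fun_prop

theorem IsLocalChart.tendsto_graphPoint (hΦ : IsLocalChart ψ Φ) :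
    Tendsto (fun q => graphPoint (conjPair Φ q)) (𝓝 0) (𝓝 0) := by
  have h1 : Tendsto (fun y : (Fin 2 → ℂ) × ℂ => graphPoint (y, star y)) (𝓝 0) (𝓝 0) :=
    tendsto_zero_of_continuousAt continuous_conj_graphPoint.continuousAt
      (by rw [star_zero]; exact _root_.map_zero graphPoint)
  exact h1.comp hΦ.tendsto

theorem graphPoint_conj (y : (Fin 2 → ℂ) × ℂ) :
    graphPoint (y, star y) = (y.1, star y.1, (y.2.re : ℂ)) := by
  rw [graphPoint_apply]
  simp [Complex.add_conj]

theorem imPart_conj (y : (Fin 2 → ℂ) × ℂ) : imPart (y, star y) = (y.2.im : ℂ) := by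
  rw [imPart_apply]
  simp only [Prod.snd_star, Complex.star_def, Complex.sub_conj]
  field_simp
  push_cast
  ring

theorem IsLocalChart.eventually_bijective (h : IsNormalForm M ψ F) (hΦ : IsLocalChart ψ Φ) :
    ∀ᶠ q in 𝓝 0, Function.Bijective (fderiv ℂ Φ q) := by
  filter_upwards [hΦ.analyticAt.eventually_analyticAt,
    AnalyticAt.eventually_comp h.analyticAt_param hΦ.tendsto,
    hΦ.tendsto.eventually hΦ.left_inv.eventually_nhds, hΦ.right_inv.eventually_nhds]
    with q h1 h2 h3 h4
  have e1 : HasFDerivAt (fun q => ψ (Φ q)) _ q :=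
    h2.differentiableAt.hasFDerivAt.comp q h1.differentiableAt.hasFDerivAt
  have e2 : HasFDerivAt (fun q => ψ (Φ q)) (ContinuousLinearMap.id ℂ (Fin 3 → ℂ)) q :=
    (hasFDerivAt_id q).congr_of_eventuallyEq h4
  have e3 : HasFDerivAt Φ (fderiv ℂ Φ q) (ψ (Φ q)) := by
    rw [h4.self_of_nhds]; exact h1.differentiableAt.hasFDerivAt
  have e4 : HasFDerivAt (fun y => Φ (ψ y)) _ (Φ q) :=
    e3.comp (Φ q) h2.differentiableAt.hasFDerivAt
  have e5 : HasFDerivAt (fun y => Φ (ψ y)) (ContinuousLinearMap.id ℂ ((Fin 2 → ℂ) × ℂ)) (Φ q) :=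
    (hasFDerivAt_id _).congr_of_eventuallyEq h3
  exact Function.bijective_iff_has_inverse.2 ⟨fderiv ℂ ψ (Φ q),
    fun v => DFunLike.congr_fun (e1.unique e2) v, fun v => DFunLike.congr_fun (e4.unique e5) v⟩

theorem IsNormalForm.fderiv_right (h : IsNormalForm M ψ F) :
    (∀ᶠ y : (Fin 2 → ℂ) × ℂ in 𝓝 0, ∀ v : (Fin 2 → ℂ) × ℂ,
      fderiv ℂ F (y.1, 0, y.2) (v.1, 0, v.2) = 0) ∧
    ∀ᶠ y : (Fin 2 → ℂ) × ℂ in 𝓝 0, ∀ v w : (Fin 2 → ℂ) × ℂ,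
      fderiv ℂ (fderiv ℂ F) (y.1, 0, y.2) (v.1, 0, v.2) (w.1, 0, w.2) = 0 :=
  eventually_fderiv_eq_zero_of_comp h.analyticAt_graph
    ((ContinuousLinearMap.fst ℂ (Fin 2 → ℂ) ℂ).prod
      ((0 : _ →L[ℂ] (Fin 2 → ℂ)).prod (ContinuousLinearMap.snd ℂ (Fin 2 → ℂ) ℂ))) h.graph_right

theorem IsNormalForm.fderiv_left (h : IsNormalForm M ψ F) :
    (∀ᶠ y : (Fin 2 → ℂ) × ℂ in 𝓝 0, ∀ v : (Fin 2 → ℂ) × ℂ,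
      fderiv ℂ F (0, y.1, y.2) (0, v.1, v.2) = 0) ∧
    ∀ᶠ y : (Fin 2 → ℂ) × ℂ in 𝓝 0, ∀ v w : (Fin 2 → ℂ) × ℂ,
      fderiv ℂ (fderiv ℂ F) (0, y.1, y.2) (0, v.1, v.2) (0, w.1, w.2) = 0 :=
  eventually_fderiv_eq_zero_of_comp h.analyticAt_graph
    ((0 : _ →L[ℂ] (Fin 2 → ℂ)).prod ((ContinuousLinearMap.fst ℂ (Fin 2 → ℂ) ℂ).prod
      (ContinuousLinearMap.snd ℂ (Fin 2 → ℂ) ℂ))) h.graph_left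

/-- `F` vanishes on `ζ = 0` and on `z = 0`, and these two subspaces span. -/
theorem IsNormalForm.fderiv_zero (h : IsNormalForm M ψ F) : fderiv ℂ F 0 = 0 := by
  refine ContinuousLinearMap.ext fun v => ?_
  have h1 := h.fderiv_right.1.self_of_nhds (v.1, v.2.2)
  have h2 := h.fderiv_left.1.self_of_nhds (v.2.1, 0)
  have e : v = (v.1, 0, v.2.2) + (0, v.2.1, 0) := by simp
  rw [e, map_add]
  exact (congrArg₂ (· + ·) h1 h2).trans (by simp)

theorem IsNormalForm.wCoeff_ne_zero (h : IsNormalForm M ψ F) :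
    ∀ᶠ x in 𝓝 0, AnalyticAt ℂ F x ∧ wCoeff F x ≠ 0 ∧ wbarCoeff F x ≠ 0 := by
  have h1 : ContinuousAt (fun x => fderiv ℂ F x (0, 0, 1)) 0 :=
    (ContinuousLinearMap.apply ℂ ℂ (0, 0, 1)).continuous.continuousAt.comp
      h.analyticAt_graph.fderiv.continuousAt
  have h2 : ContinuousAt (wCoeff F) 0 := continuousAt_const.sub (h1.div_const _)
  have h3 : ContinuousAt (wbarCoeff F) 0 := continuousAt_const.sub (h1.div_const _)
  filter_upwards [h.analyticAt_graph.eventually_analyticAt,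
    h2.eventually_ne (y := 0) (by simp [wCoeff, h.fderiv_zero]),
    h3.eventually_ne (y := 0) (by simp [wbarCoeff, h.fderiv_zero])] with x e1 e2 e3
  exact ⟨e1, e2, e3⟩

/-- The graph function vanishes on `M`, so its differential kills the tangent spaces of `M`. It is
nonzero because `∂s/∂w ≠ 0` near `0`, and two hyperplanes, one inside the other, coincide. -/
theorem IsLocalChart.eventually_isDefining (h : IsNormalForm M ψ F) (hΦ : IsLocalChart ψ Φ) :
    ∀ᶠ q in 𝓝 0, q ∈ M.carrier → IsDefining M Φ (graphDefining F) q := by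
  have hgood := (hΦ.eventually_bijective h).and (hΦ.analyticAt.eventually_analyticAt.and
    (hΦ.tendsto_graphPoint.eventually h.wCoeff_ne_zero))
  have hzero : ∀ᶠ q in 𝓝 0, q ∈ M.carrier → graphDefining F (conjPair Φ q) = 0 := by
    filter_upwards [hΦ.tendsto.eventually h.mem_iff, hΦ.right_inv] with q h1 h2 hq
    rw [h2] at h1
    rw [graphDefining, conjPair, imPart_conj, graphPoint_conj, h1.1 hq, sub_self]
  have htan : ∀ᶠ q in 𝓝 0, q ∈ M.carrier → ∀ Z, Z ∈ M.CT q ↔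
      fderiv ℂ (graphDefining F) (conjPair Φ q) (push Φ q Z) = 0 := by
    filter_upwards [hgood, hzero.eventually_nhds] with q ⟨h1, h2, h3, h4, _⟩ h5 hq
    have hs := analyticAt_graphDefining h3
    have hda : ∀ Z, deriveAlong (fun q => graphDefining F (conjPair Φ q)) q Z
        = fderiv ℂ (graphDefining F) (conjPair Φ q) (push Φ q Z) := fun Z => by
      rw [deriveAlong_eq_cderiv, cderiv_comp_conjPair h2 hs.differentiableAt]
    have hΦr : AnalyticAt ℝ Φ q := h2.restrictScalars
    have hle : ∀ Z ∈ M.CT q, deriveAlong (fun q => graphDefining F (conjPair Φ q)) q Z = 0 := by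
      intro Z hZ
      refine M.deriveAlong_eq_zero hq ?_ (eventually_nhdsWithin_iff.2 h5) hZ
      exact (hs.restrictScalars (𝕜 := ℝ)).comp (hΦr.prod (analyticAt_real_star hΦr))
    intro Z
    rw [← hda]
    refine ⟨hle Z, fun hZ => ?_⟩
    by_contra hcon
    have hcon' : deriveAlong (fun q => (M.r q : ℂ)) q Z ≠ 0 := hcon
    obtain ⟨a, ha⟩ := h1.2 (0, 1)
    have hW : deriveAlong (fun q => graphDefining F (conjPair Φ q)) q (a, 0) ≠ 0 := by
      rw [hda, push_left, ha, fderiv_graphDefining_left h3]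
      have e : ((0 : Fin 2 → ℂ), (0 : Fin 2 → ℂ), (0 : ℂ)) = 0 := rfl
      simpa [e] using h4
    refine hW ?_
    -- A `Z` killed by `ds` but not tangent could correct `(a, 0)` to a tangent vector without
    -- changing `ds`, which is nonzero there.
    have := hle ((a, 0) - (deriveAlong (fun q => (M.r q : ℂ)) q (a, 0) /
      deriveAlong (fun q => (M.r q : ℂ)) q Z) • Z) (by
        rw [LocalHypersurface.CT, LinearMap.mem_ker, map_sub, map_smul, smul_eq_mul,
          div_mul_cancel₀ _ hcon', sub_self])
    rwa [map_sub, map_smul, hZ, smul_zero, sub_zero] at this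
  filter_upwards [hgood, htan.eventually_nhds] with q ⟨h1, h2, h3, h4, _⟩ h5 hq
  exact ⟨hq, h2, h1, analyticAt_graphDefining h3, eventually_nhdsWithin_iff.2 h5⟩

end Chart

end CRGeometry

end

/-! ### The Levi determinant vanishes identically, and so does the Jacobian of `gmap`. -/

noncomputable section

namespace CRGeometry

/-- The direction `(c e_j, ∂F/∂z_j / 2)` in the coordinates `(z, ζ, u)`, tangent to the graph
of `F`. -/
def holDir (F : (Fin 2 → ℂ) × (Fin 2 → ℂ) × ℂ → ℂ) (x : (Fin 2 → ℂ) × (Fin 2 → ℂ) × ℂ)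
    (j : Fin 2) : (Fin 2 → ℂ) × (Fin 2 → ℂ) × ℂ :=
  (wCoeff F x • Pi.single j 1, 0, fderiv ℂ F x (Pi.single j 1, 0, 0) / 2)

/-- The direction `(c' e_k, ∂F/∂ζ_k / 2)` in the coordinates `(z, ζ, u)`, tangent to the graph
of `F`. -/
def antiholDir (F : (Fin 2 → ℂ) × (Fin 2 → ℂ) × ℂ → ℂ) (x : (Fin 2 → ℂ) × (Fin 2 → ℂ) × ℂ)
    (k : Fin 2) : (Fin 2 → ℂ) × (Fin 2 → ℂ) × ℂ :=
  (0, wbarCoeff F x • Pi.single k 1, fderiv ℂ F x (0, Pi.single k 1, 0) / 2)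

/-- The complexified Levi matrix of the graph of `F`. -/
def leviMat (F : (Fin 2 → ℂ) × (Fin 2 → ℂ) × ℂ → ℂ) (x : (Fin 2 → ℂ) × (Fin 2 → ℂ) × ℂ) :
    Matrix (Fin 2) (Fin 2) ℂ :=
  Matrix.of fun j k => fderiv ℂ (fderiv ℂ F) x (antiholDir F x k) (holDir F x j)

theorem contDiffAt_antiholDir {F : (Fin 2 → ℂ) × (Fin 2 → ℂ) × ℂ → ℂ} (hF : AnalyticAt ℂ F 0)
    (k : Fin 2) : ContDiffAt ℂ ⊤ (fun x => antiholDir F x k) 0 := by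
  have h3 : ∀ v, ContDiffAt ℂ ⊤ (fun x => fderiv ℂ F x v) 0 := fun v =>
    hF.fderiv.contDiffAt.clm_apply contDiffAt_const
  have h5 : ContDiffAt ℂ ⊤ (wbarCoeff F) 0 := contDiffAt_const.sub ((h3 _).div_const _)
  exact contDiffAt_const.prodMk ((h5.smul contDiffAt_const).prodMk ((h3 _).div_const _))

theorem analyticAt_leviMat_det {F : (Fin 2 → ℂ) × (Fin 2 → ℂ) × ℂ → ℂ} (hF : AnalyticAt ℂ F 0) :
    AnalyticAt ℂ (fun x => (leviMat F x).det) 0 := by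
  have h1 : ContDiffAt ℂ ⊤ (fderiv ℂ F) 0 := hF.fderiv.contDiffAt
  have h2 : ContDiffAt ℂ ⊤ (fderiv ℂ (fderiv ℂ F)) 0 := hF.fderiv.fderiv.contDiffAt
  have h3 : ∀ v, ContDiffAt ℂ ⊤ (fun x => fderiv ℂ F x v) 0 := fun v =>
    h1.clm_apply contDiffAt_const
  have h4 : ContDiffAt ℂ ⊤ (wCoeff F) 0 := contDiffAt_const.sub ((h3 _).div_const _)
  have h6 : ∀ j, ContDiffAt ℂ ⊤ (fun x => holDir F x j) 0 := fun j =>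
    (h4.smul contDiffAt_const).prodMk (contDiffAt_const.prodMk ((h3 _).div_const _))
  have h7 := contDiffAt_antiholDir hF
  have h8 : ∀ j k, ContDiffAt ℂ ⊤ (fun x => leviMat F x j k) 0 := fun j k =>
    (h2.clm_apply (h7 k)).clm_apply (h6 j)
  have h9 := ((h8 0 0).mul (h8 1 1)).sub ((h8 0 1).mul (h8 1 0))
  refine ContDiffAt.analyticAt (𝕜 := ℂ) ?_
  simpa only [Matrix.det_fin_two] using h9

theorem sum_smul_holDir (F : (Fin 2 → ℂ) × (Fin 2 → ℂ) × ℂ → ℂ)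
    (x : (Fin 2 → ℂ) × (Fin 2 → ℂ) × ℂ) (a : Fin 2 → ℂ) :
    ∑ j, a j • holDir F x j = (wCoeff F x • a, 0, fderiv ℂ F x (a, 0, 0) / 2) := by
  have ha : ((a, 0, 0) : (Fin 2 → ℂ) × (Fin 2 → ℂ) × ℂ)
      = a 0 • (Pi.single 0 1, 0, 0) + a 1 • (Pi.single 1 1, 0, 0) := by
    ext j
    · fin_cases j <;> simp
    · simp
    · simp
  rw [ha, map_add, map_smul, map_smul, Fin.sum_univ_two]
  simp only [holDir]
  ext j
  · fin_cases j <;> simp [mul_comm]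
  · simp
  · simp
    ring

section

variable {M : LocalHypersurface 3} {ψ : (Fin 2 → ℂ) × ℂ → (Fin 3 → ℂ)}
  {F : (Fin 2 → ℂ) × (Fin 2 → ℂ) × ℂ → ℂ} {Φ : (Fin 3 → ℂ) → (Fin 2 → ℂ) × ℂ}

theorem fderiv_graphDefining_antiholDir {p : ((Fin 2 → ℂ) × ℂ) × ((Fin 2 → ℂ) × ℂ)}
    (hF : AnalyticAt ℂ F (graphPoint p)) (k : Fin 2) :
    fderiv ℂ (graphDefining F) p (0, wbarCoeff F (graphPoint p) • Pi.single k 1,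
      fderiv ℂ F (graphPoint p) (0, Pi.single k 1, 0)) = 0 := by
  rw [fderiv_graphDefining_right hF]
  have e : ((0, wbarCoeff F (graphPoint p) • Pi.single k 1, 0) : (Fin 2 → ℂ) × (Fin 2 → ℂ) × ℂ)
      = wbarCoeff F (graphPoint p) • (0, Pi.single k 1, 0) := by simp
  rw [e, map_smul, smul_eq_mul, sub_self]

theorem graphPoint_antiholDir (x : (Fin 2 → ℂ) × (Fin 2 → ℂ) × ℂ) (k : Fin 2) :
    graphPoint (0, wbarCoeff F x • Pi.single k 1, fderiv ℂ F x (0, Pi.single k 1, 0))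
      = antiholDir F x k := by
  rw [graphPoint_apply, antiholDir]
  simp
  ring

/-- A nonzero Levi kernel vector has nonzero `z`-part, as tangency determines its `w`-part; this
`z`-part is a left null vector of the Levi matrix. -/
theorem IsDefining.leviMat_det_eq_zero {q : Fin 3 → ℂ}
    (h : IsDefining M Φ (graphDefining F) q)
    (hF : AnalyticAt ℂ F (graphPoint (conjPair Φ q)))
    (hc : wCoeff F (graphPoint (conjPair Φ q)) ≠ 0) (hL : M.leviRank q = 1) :
    (leviMat F (graphPoint (conjPair Φ q))).det = 0 := by
  obtain ⟨X, hX, hX0⟩ := LocalHypersurface.exists_mem_K10_ne_zero hL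
  obtain ⟨hXT, hXK⟩ := h.mem_K10_iff_forall.1 hX
  obtain ⟨hX2, hXs⟩ := h.mem_T10_iff.1 hXT
  set x := graphPoint (conjPair Φ q)
  set α := fderiv ℂ Φ q X.1
  rw [fderiv_graphDefining_left hF, sub_eq_zero] at hXs
  have hα : α.1 ≠ 0 := by
    intro h0
    rw [h0] at hXs
    have e : ((0 : Fin 2 → ℂ), (0 : Fin 2 → ℂ), (0 : ℂ)) = 0 := rfl
    rw [e, map_zero, mul_eq_zero] at hXs
    have h1 : α = 0 := Prod.ext h0 (hXs.resolve_left hc)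
    have h2 : X.1 = 0 := h.bijective_fderiv.1 (by rw [map_zero]; exact h1)
    exact hX0 (Prod.ext h2 hX2)
  refine Matrix.exists_vecMul_eq_zero_iff.1 ⟨α.1, hα, ?_⟩
  have hg : ∑ j, α.1 j • holDir F x j = wCoeff F x • graphPoint (α, 0) := by
    rw [sum_smul_holDir, graphPoint_apply, ← hXs]
    simp
    ring
  ext k
  have h1 := hXK _ (fderiv_graphDefining_antiholDir hF k)
  rw [fderiv_fderiv_graphDefining hF, graphPoint_antiholDir, neg_eq_zero] at h1
  have h2 : fderiv ℂ (fderiv ℂ F) x (antiholDir F x k) (∑ j, α.1 j • holDir F x j) = 0 := by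
    rw [hg, map_smul, h1, smul_zero]
  rw [map_sum] at h2
  simpa [Matrix.vecMul, dotProduct, leviMat] using h2

theorem IsNormalForm.graph_real (h : IsNormalForm M ψ F) :
    ∀ᶠ x : (Fin 2 → ℂ) × (Fin 2 → ℂ) × ℂ in 𝓝 0, x.2.1 = star x.1 ∧ x.2.2.im = 0 →
      ((F x).re : ℂ) = F x := by
  filter_upwards [h.graph_star] with x hx ⟨h1, h2⟩
  have e : star x.2.2 = x.2.2 := Complex.conj_eq_iff_im.2 h2
  have e2 : (star x.2.1, star x.1, star x.2.2) = x := by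
    rw [e, h1, star_star, ← h1]
  rw [e2] at hx
  exact Complex.conj_eq_iff_re.1 hx

/-- On `ζ = z̄`, `u` real, the determinant vanishes by the rank assumption. This set is the fixed
space of an antilinear involution, so a holomorphic function vanishing on it vanishes near `0`. -/
theorem IsNormalForm.eventually_leviMat_det (h : IsNormalForm M ψ F)
    (hL : ∀ p ∈ M.carrier, M.leviRank p = 1) : ∀ᶠ x in 𝓝 0, (leviMat F x).det = 0 := by
  obtain ⟨Φ, hΦ⟩ := h.exists_isLocalChart
  refine eventually_eq_zero_of_totallyReal (analyticAt_leviMat_det h.analyticAt_graph)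
    (V := {x | x.2.1 = star x.1 ∧ x.2.2.im = 0})
    -- `a` and `b` are the real and imaginary parts relative to the involution `(z, ζ, u) ↦ (ζ̄, z̄,
    -- ū)`.
    (a := fun x => ((1 / 2 : ℂ) • (x.1 + star x.2.1), (1 / 2 : ℂ) • (x.2.1 + star x.1),
      (x.2.2.re : ℂ)))
    (b := fun x => ((1 / (2 * Complex.I) : ℂ) • (x.1 - star x.2.1),
      (1 / (2 * Complex.I) : ℂ) • (x.2.1 - star x.1), (x.2.2.im : ℂ)))
    (by fun_prop) (by fun_prop) (by simp [Prod.ext_iff]) (by simp [Prod.ext_iff]) ?_ ?_ ?_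
  · intro x
    have e : Complex.I * (1 / (2 * Complex.I)) = 1 / 2 := by field_simp
    ext j
    · simp only [Prod.fst_add, Prod.smul_fst, smul_smul, e]
      simp
      ring
    · simp only [Prod.fst_add, Prod.snd_add, Prod.smul_snd, Prod.smul_fst, smul_smul, e]
      simp
      ring
    · simp [mul_comm Complex.I, Complex.re_add_im]
  · intro x t
    constructor
    · ext j
      simp
      ring
    · simp
  -- Above a point `x` of the real set lies the point `(z, u + iF)` of `M`, and `graphPoint` of it
  -- with its conjugate returns `x`.
  · have hF0 : F 0 = 0 := h.graph_right.self_of_nhds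
    have h1 : Tendsto (fun x : (Fin 2 → ℂ) × (Fin 2 → ℂ) × ℂ => (x.1, x.2.2 + Complex.I * F x))
        (𝓝 0) (𝓝 0) := by
      have := h.analyticAt_graph.continuousAt
      refine tendsto_zero_of_continuousAt ?_ (by simp [hF0])
      fun_prop
    have h2 : Tendsto ψ (𝓝 0) (𝓝 0) :=
      tendsto_zero_of_continuousAt h.analyticAt_param.continuousAt h.param_zero
    filter_upwards [h.graph_real, h1.eventually hΦ.left_inv, h1.eventually h.mem_iff,
      (h2.comp h1).eventually (hΦ.eventually_isDefining h), h.wCoeff_ne_zero]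
      with x e1 e2 e3 e4 e5 hx
    set y : (Fin 2 → ℂ) × ℂ := (x.1, x.2.2 + Complex.I * F x) with hy
    have hre := e1 hx
    have him : (F x).im = 0 := by rw [← hre]; simp
    have hyre : (y.2.re : ℂ) = x.2.2 := by
      apply Complex.ext <;> simp [hy, him, hx.2]
    have hyim : (y.2.im : ℂ) = F x := by
      apply Complex.ext <;> simp [hy, him, hx.2]
    have hyx : (y.1, star y.1, (y.2.re : ℂ)) = x := by
      rw [hyre]
      exact Prod.ext rfl (Prod.ext hx.1.symm rfl)
    have hmem : ψ y ∈ M.carrier := by rw [e3, hyim, hyx]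
    have hg : graphPoint (conjPair Φ (ψ y)) = x := by
      rw [conjPair, e2, graphPoint_conj, hyx]
    have hdef : IsDefining M Φ (graphDefining F) (ψ y) := e4 hmem
    have := hdef.leviMat_det_eq_zero (by rw [hg]; exact e5.1) (by rw [hg]; exact e5.2.1)
      (hL _ hmem)
    rwa [hg] at this

theorem tendsto_zSection : Tendsto (fun z : Fin 2 → ℂ => (z, (0 : Fin 2 → ℂ), (0 : ℂ))) (𝓝 0) (𝓝 0) :=
  tendsto_zero_of_continuousAt (by fun_prop) rfl

theorem analyticAt_gmap (hF : AnalyticAt ℂ F 0) : AnalyticAt ℂ (gmap F) 0 := by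
  refine analyticAt_pi_iff.2 fun k => ?_
  have h1 : ContDiffAt ℂ ⊤ (fderiv ℂ F) ((0 : Fin 2 → ℂ), (0 : Fin 2 → ℂ), (0 : ℂ)) :=
    hF.fderiv.contDiffAt
  have h2 : ContDiffAt ℂ ⊤ (fun z : Fin 2 → ℂ => (z, (0 : Fin 2 → ℂ), (0 : ℂ))) 0 := by fun_prop
  have h3 : ContDiffAt ℂ ⊤ (fun z : Fin 2 → ℂ => fderiv ℂ F (z, (0 : Fin 2 → ℂ), (0 : ℂ))) 0 :=
    h1.comp (0 : Fin 2 → ℂ) h2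
  exact (h3.clm_apply contDiffAt_const).analyticAt

theorem fderiv_gmap {z : Fin 2 → ℂ} (hF : AnalyticAt ℂ F (z, 0, 0)) (v : Fin 2 → ℂ) (k : Fin 2) :
    fderiv ℂ (gmap F) z v k = fderiv ℂ (fderiv ℂ F) (z, 0, 0) (v, 0, 0) (0, Pi.single k 1, 0) := by
  have h1 : HasFDerivAt (fun z : Fin 2 → ℂ => (z, (0 : Fin 2 → ℂ), (0 : ℂ)))
      (ContinuousLinearMap.inl ℂ (Fin 2 → ℂ) ((Fin 2 → ℂ) × ℂ)) z :=
    hasFDerivAt_prodMk_left z _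
  have h2 := fun k : Fin 2 => ((hasFDerivAt_fderiv hF).comp z h1).clm_apply
    (hasFDerivAt_const ((0, Pi.single k 1, 0) : (Fin 2 → ℂ) × (Fin 2 → ℂ) × ℂ) z)
  have h3 : HasFDerivAt (gmap F) (ContinuousLinearMap.pi fun k => _) z := hasFDerivAt_pi.2 h2
  rw [h3.fderiv]
  simp [Prod.mk_zero_zero]

/-- On `ζ = 0`, `u = 0` all derivatives of `F` in the `(z, u)` directions vanish, so the Levi matrix
reduces to `1/4` times the Jacobian matrix of `gmap F`. -/
theorem IsNormalForm.eventually_det_gmap (h : IsNormalForm M ψ F)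
    (hL : ∀ p ∈ M.carrier, M.leviRank p = 1) :
    ∀ᶠ z in 𝓝 0, (Matrix.of fun j k => fderiv ℂ (gmap F) z (Pi.single j 1) k).det = 0 := by
  have h1 : Tendsto (fun z : Fin 2 → ℂ => (z, (0 : ℂ))) (𝓝 0) (𝓝 0) :=
    tendsto_zero_of_continuousAt (by fun_prop) rfl
  filter_upwards [tendsto_zSection.eventually (h.eventually_leviMat_det hL),
    h1.eventually h.fderiv_right.1, h1.eventually h.fderiv_right.2,
    AnalyticAt.eventually_comp h.analyticAt_graph tendsto_zSection] with z e1 e2 e3 e4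
  have hw : wCoeff F (z, 0, 0) = 1 / (2 * Complex.I) := by
    have := e2 (0, 1)
    simp only at this
    rw [wCoeff, this]
    simp
  have hw' : wbarCoeff F (z, 0, 0) = -(1 / (2 * Complex.I)) := by
    have := e2 (0, 1)
    simp only at this
    rw [wbarCoeff, this]
    simp
  have hsym : IsSymmSndFDerivAt ℂ F (z, 0, 0) :=
    (e4.contDiffAt (n := ⊤)).isSymmSndFDerivAt (by simp)
  have key : ∀ j k, leviMat F (z, 0, 0) j k = -(1 / (2 * Complex.I)) * (1 / (2 * Complex.I))
      * fderiv ℂ (gmap F) z (Pi.single j 1) k := by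
    intro j k
    have d1 : holDir F (z, 0, 0) j = (1 / (2 * Complex.I)) • (Pi.single j 1, 0, 0) := by
      have := e2 (Pi.single j 1, 0)
      simp only at this
      rw [holDir, hw, this]
      simp
    have d2 : antiholDir F (z, 0, 0) k = (-(1 / (2 * Complex.I))) • (0, Pi.single k 1, 0)
        + (fderiv ℂ F (z, 0, 0) (0, Pi.single k 1, 0) / 2) • (0, 0, 1) := by
      rw [antiholDir, hw']
      simp
    have d3 := e3 (0, 1) (Pi.single j 1, 0)
    simp only at d3
    rw [fderiv_gmap e4, hsym.eq]
    simp only [leviMat, Matrix.of_apply]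
    rw [d1, d2]
    simp only [map_add, map_smul, add_apply, smul_apply, d3, smul_eq_mul]
    ring
  rw [Matrix.det_fin_two] at e1 ⊢
  simp only [key] at e1
  simp only [Matrix.of_apply]
  have hne : (-(1 / (2 * Complex.I)) * (1 / (2 * Complex.I)) : ℂ) ≠ 0 := by simp
  have e5 : (-(1 / (2 * Complex.I)) * (1 / (2 * Complex.I)) : ℂ) ^ 2 *
      (fderiv ℂ (gmap F) z (Pi.single 0 1) 0 * fderiv ℂ (gmap F) z (Pi.single 1 1) 1 -
        fderiv ℂ (gmap F) z (Pi.single 0 1) 1 * fderiv ℂ (gmap F) z (Pi.single 1 1) 0) = 0 := by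
    linear_combination e1
  exact (mul_eq_zero.1 e5).resolve_left (pow_ne_zero 2 hne)

end

end CRGeometry

end

/-! ### Levi kernel and Freeman form at the origin. -/

noncomputable section

namespace CRGeometry

theorem fderiv_eq_star_fderiv {E : Type*} [NormedAddCommGroup E] [NormedSpace ℂ E] {f g : E → ℂ}
    {σ : E → E} {x : E} (hσ : ∀ x (t : ℂ) v, σ (x + t • v) = σ x + conj t • σ v)
    (hf : DifferentiableAt ℂ f x) (hg : DifferentiableAt ℂ g (σ x))
    (h : ∀ᶠ y in 𝓝 x, f y = star (g (σ y))) (v : E) :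
    fderiv ℂ f x v = star (fderiv ℂ g (σ x) (σ v)) := by
  have hline : ∀ (y w : E), HasDerivAt (fun t : ℂ => y + t • w) w 0 := fun y w => by
    simpa using (hasDerivAt_smul_const_zero w).const_add y
  refine fderiv_apply_eq_of_hasDerivAt_comp hf (hline x v) (by simp) ?_
  have h1 : HasFDerivAt g (fderiv ℂ g (σ x)) (σ x + (0 : ℂ) • σ v) := by
    rw [zero_smul, add_zero]; exact hg.hasFDerivAt
  have h2 := (h1.comp_hasDerivAt (0 : ℂ) (hline (σ x) (σ v))).conj_conj
  rw [map_zero] at h2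
  refine h2.congr_of_eventuallyEq ?_
  have h3 : Tendsto (fun t : ℂ => x + t • v) (𝓝 0) (𝓝 x) := by
    have := (hline x v).continuousAt.tendsto
    simpa using this
  filter_upwards [h3.eventually h] with t ht
  rw [ht, hσ]
  simp

section

variable {M : LocalHypersurface 3} {ψ : (Fin 2 → ℂ) × ℂ → (Fin 3 → ℂ)}
  {F : (Fin 2 → ℂ) × (Fin 2 → ℂ) × ℂ → ℂ} {Φ : (Fin 3 → ℂ) → (Fin 2 → ℂ) × ℂ}

/-- The conjugation `(z, ζ, u) ↦ (ζ̄, z̄, ū)`. -/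
def swapStar (x : (Fin 2 → ℂ) × (Fin 2 → ℂ) × ℂ) : (Fin 2 → ℂ) × (Fin 2 → ℂ) × ℂ :=
  (star x.2.1, star x.1, star x.2.2)

theorem swapStar_add_smul (x : (Fin 2 → ℂ) × (Fin 2 → ℂ) × ℂ) (t : ℂ)
    (v : (Fin 2 → ℂ) × (Fin 2 → ℂ) × ℂ) :
    swapStar (x + t • v) = swapStar x + conj t • swapStar v := by
  simp [swapStar]

theorem tendsto_swapStar : Tendsto swapStar (𝓝 0) (𝓝 0) :=
  tendsto_zero_of_continuousAt (by unfold swapStar; fun_prop) (by simp [swapStar, Prod.ext_iff])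

theorem IsNormalForm.fderiv_swapStar (h : IsNormalForm M ψ F) :
    ∀ᶠ x in 𝓝 0, ∀ v, fderiv ℂ F x v = star (fderiv ℂ F (swapStar x) (swapStar v)) := by
  filter_upwards [h.graph_star.eventually_nhds, h.analyticAt_graph.eventually_analyticAt,
    AnalyticAt.eventually_comp h.analyticAt_graph tendsto_swapStar] with x h1 h2 h3 v
  exact fderiv_eq_star_fderiv swapStar_add_smul h2.differentiableAt h3.differentiableAt
    (h1.mono fun y hy => hy.symm) v

theorem IsNormalForm.fderiv_fderiv_swapStar (h : IsNormalForm M ψ F) :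
    ∀ᶠ x in 𝓝 0, ∀ v w, fderiv ℂ (fderiv ℂ F) x v w
      = star (fderiv ℂ (fderiv ℂ F) (swapStar x) (swapStar v) (swapStar w)) := by
  filter_upwards [h.fderiv_swapStar.eventually_nhds, h.analyticAt_graph.eventually_analyticAt,
    AnalyticAt.eventually_comp h.analyticAt_graph tendsto_swapStar] with x h1 h2 h3 v w
  have e : ∀ {y} (_ : AnalyticAt ℂ F y) w, HasFDerivAt (fun y => fderiv ℂ F y w)
      ((fderiv ℂ (fderiv ℂ F) y).flip w) y := fun hy w => by
    simpa using (hasFDerivAt_fderiv hy).clm_apply (hasFDerivAt_const w _)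
  have := fderiv_eq_star_fderiv swapStar_add_smul (e h2 w).differentiableAt
    (e h3 (swapStar w)).differentiableAt (h1.mono fun y hy => hy w) v
  rwa [(e h2 w).fderiv, (e h3 (swapStar w)).fderiv] at this

theorem fderiv_apply_mid (D : ((Fin 2 → ℂ) × (Fin 2 → ℂ) × ℂ) →L[ℂ] ℂ) (b : Fin 2 → ℂ) :
    D (0, b, 0) = ∑ k, b k * D (0, Pi.single k 1, 0) := by
  simp only [← smul_eq_mul, ← map_smul, ← map_sum]
  congr 1
  ext j
  · simp
  · fin_cases j <;> simp [Fin.sum_univ_two]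
  · simp

theorem fderiv_fderiv_apply_gmap {z : Fin 2 → ℂ} (hF : AnalyticAt ℂ F (z, 0, 0))
    (a b : Fin 2 → ℂ) : fderiv ℂ (fderiv ℂ F) (z, 0, 0) (a, 0, 0) (0, b, 0)
      = ∑ k, b k * fderiv ℂ (gmap F) z a k := by
  rw [fderiv_apply_mid]
  simp only [fderiv_gmap hF]

/-- Hermitian symmetry of the Levi matrix at the origin, a fixed point of the conjugation. -/
theorem IsNormalForm.star_fderiv_gmap (h : IsNormalForm M ψ F) (j k : Fin 2) :
    star (fderiv ℂ (gmap F) 0 (Pi.single j 1) k) = fderiv ℂ (gmap F) 0 (Pi.single k 1) j := by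
  have hF : AnalyticAt ℂ F ((0 : Fin 2 → ℂ), 0, 0) := h.analyticAt_graph
  have hsym : IsSymmSndFDerivAt ℂ F ((0 : Fin 2 → ℂ), 0, 0) :=
    (hF.contDiffAt (n := ⊤)).isSymmSndFDerivAt (by simp)
  have h1 := h.fderiv_fderiv_swapStar.self_of_nhds (Pi.single j 1, 0, 0) (0, Pi.single k 1, 0)
  rw [fderiv_gmap hF, fderiv_gmap hF, hsym.eq (Pi.single k 1, 0, 0)]
  have e : ∀ i : Fin 2, star (Pi.single i 1 : Fin 2 → ℂ) = Pi.single i 1 := fun i => by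
    ext j; fin_cases i <;> fin_cases j <;> simp
  have e0 : swapStar 0 = 0 := by simp [swapStar, Prod.ext_iff]
  rw [e0] at h1
  simp only [swapStar, star_zero, e] at h1
  exact (congrArg star h1).trans (star_star _)

theorem IsNormalForm.isDefining_zero (h : IsNormalForm M ψ F) (hΦ : IsLocalChart ψ Φ)
    (h0 : 0 ∈ M.carrier) : IsDefining M Φ (graphDefining F) 0 :=
  (hΦ.eventually_isDefining h).self_of_nhds h0

theorem IsLocalChart.conjPair_zero (hΦ : IsLocalChart ψ Φ) : conjPair Φ 0 = 0 := by
  simp [conjPair, hΦ.map_zero]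

theorem IsNormalForm.mem_T10_zero_iff (h : IsNormalForm M ψ F) (hΦ : IsLocalChart ψ Φ)
    (h0 : 0 ∈ M.carrier) {X : CVec 3} : X ∈ M.T10 0 ↔ X.2 = 0 ∧ (fderiv ℂ Φ 0 X.1).2 = 0 := by
  have hg : graphPoint (0 : ((Fin 2 → ℂ) × ℂ) × ((Fin 2 → ℂ) × ℂ)) = 0 := map_zero _
  rw [(h.isDefining_zero hΦ h0).mem_T10_iff, hΦ.conjPair_zero,
    fderiv_graphDefining_left (by rw [hg]; exact h.analyticAt_graph), hg, h.fderiv_zero]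
  simp [h.wCoeff_ne_zero.self_of_nhds.2.1]

/-- At the origin `dF = 0`, so tangency means that the `w`-part is zero, and pairing with the `ζ`
directions leaves the mixed Hessian of `F`, which is `d(gmap F)(0)`. -/
theorem IsNormalForm.mem_K10_zero_iff (h : IsNormalForm M ψ F) (hΦ : IsLocalChart ψ Φ)
    (h0 : 0 ∈ M.carrier) {X : CVec 3} : X ∈ M.K10 0 ↔ X.2 = 0 ∧ (fderiv ℂ Φ 0 X.1).2 = 0 ∧
      fderiv ℂ (gmap F) 0 (fderiv ℂ Φ 0 X.1).1 = 0 := by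
  have hg : graphPoint (0 : ((Fin 2 → ℂ) × ℂ) × ((Fin 2 → ℂ) × ℂ)) = 0 := map_zero _
  have hF : AnalyticAt ℂ F ((0 : Fin 2 → ℂ), 0, 0) := h.analyticAt_graph
  have hsym : IsSymmSndFDerivAt ℂ F ((0 : Fin 2 → ℂ), 0, 0) :=
    (hF.contDiffAt (n := ⊤)).isSymmSndFDerivAt (by simp)
  have hF' : AnalyticAt ℂ F (graphPoint (0 : ((Fin 2 → ℂ) × ℂ) × ((Fin 2 → ℂ) × ℂ))) := by
    rw [hg]; exact h.analyticAt_graph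
  rw [(h.isDefining_zero hΦ h0).mem_K10_iff_forall, h.mem_T10_zero_iff hΦ h0, hΦ.conjPair_zero,
    and_assoc]
  refine and_congr_right fun _ => and_congr_right fun hα => ?_
  set α := fderiv ℂ Φ 0 X.1
  have hαg : graphPoint (α, 0) = (α.1, 0, 0) := by rw [graphPoint_apply]; simp [hα]
  have key : ∀ b : Fin 2 → ℂ, fderiv ℂ (fderiv ℂ (graphDefining F)) 0 (0, (b, 0)) (α, 0)
      = -∑ k, b k * fderiv ℂ (gmap F) 0 α.1 k := fun b => by
    have hbg : graphPoint (0, ((b, 0) : (Fin 2 → ℂ) × ℂ)) = (0, b, 0) := by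
      rw [graphPoint_apply]; simp
    rw [fderiv_fderiv_graphDefining hF', hαg, hbg, hg, ← fderiv_fderiv_apply_gmap hF, ← hsym.eq]
    rfl
  constructor
  · intro hK
    ext k
    have h1 := hK (Pi.single k 1, 0) (by
      rw [fderiv_graphDefining_right hF', hg, h.fderiv_zero]
      simp)
    rw [key] at h1
    fin_cases k <;> simpa [Fin.sum_univ_two] using h1
  · intro hA β hβ
    rw [fderiv_graphDefining_right hF', hg, h.fderiv_zero] at hβ
    have hβ2 : β.2 = 0 := by simpa [h.wCoeff_ne_zero.self_of_nhds.2.2] using hβ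
    have : β = (β.1, 0) := Prod.ext rfl hβ2
    rw [this, key, hA]
    simp

theorem IsNormalForm.fderiv_gmap_zero_ne (h : IsNormalForm M ψ F) (h0 : 0 ∈ M.carrier)
    (hL : M.leviRank 0 = 1) : fderiv ℂ (gmap F) 0 ≠ 0 := by
  intro hA
  obtain ⟨Φ, hΦ⟩ := h.exists_isLocalChart
  obtain ⟨X, hX, hXK⟩ := LocalHypersurface.exists_mem_T10_notMem_K10 hL
  rw [h.mem_T10_zero_iff hΦ h0] at hX
  rw [h.mem_K10_zero_iff hΦ h0] at hXK
  exact hXK ⟨hX.1, hX.2, by simp [hA]⟩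

/-- On `z = 0` the derivatives of `F` in the `(ζ, u)` directions vanish, so the direction
`antiholDir` becomes constant and `t` drops out. Conjugation moves the remaining mixed derivative to
`ζ = 0`, where it is one of `gmap F`. -/
theorem IsNormalForm.fderiv_fderiv_antiholDir (h : IsNormalForm M ψ F) :
    ∀ᶠ ζ : Fin 2 → ℂ in 𝓝 0, ∀ a t k,
      fderiv ℂ (fderiv ℂ F) (0, ζ, 0) (antiholDir F (0, ζ, 0) k) (a, 0, t)
        = -(1 / (2 * Complex.I))
          * ∑ j, a j * star (fderiv ℂ (gmap F) (star ζ) (Pi.single k 1) j) := by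
  have h1 : Tendsto (fun ζ : Fin 2 → ℂ => ((0 : Fin 2 → ℂ), ζ, (0 : ℂ))) (𝓝 0) (𝓝 0) :=
    tendsto_zero_of_continuousAt (by fun_prop) rfl
  have h2 : Tendsto (fun ζ : Fin 2 → ℂ => (ζ, (0 : ℂ))) (𝓝 0) (𝓝 0) :=
    tendsto_zero_of_continuousAt (by fun_prop) rfl
  have h3 : Tendsto (fun ζ : Fin 2 → ℂ => star ζ) (𝓝 0) (𝓝 0) :=
    tendsto_zero_of_continuousAt (by fun_prop) (by simp)
  filter_upwards [h1.eventually h.fderiv_fderiv_swapStar, h2.eventually h.fderiv_left.1,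
    h2.eventually h.fderiv_left.2, AnalyticAt.eventually_comp h.analyticAt_graph
    (tendsto_zSection.comp h3)] with ζ e1 e2 e3 e4 a t k
  have hw' : wbarCoeff F (0, ζ, 0) = -(1 / (2 * Complex.I)) := by
    have := e2 (0, 1)
    simp only at this
    rw [wbarCoeff, this]
    simp
  have d1 : antiholDir F (0, ζ, 0) k = (-(1 / (2 * Complex.I))) • (0, Pi.single k 1, 0) := by
    have := e2 (Pi.single k 1, 0)
    simp only at this
    rw [antiholDir, hw', this]
    simp
  have d2 : ((a, 0, t) : (Fin 2 → ℂ) × (Fin 2 → ℂ) × ℂ) = (a, 0, 0) + (0, 0, t) := by simp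
  have d3 := e3 (Pi.single k 1, 0) (0, t)
  simp only at d3
  have e : star (Pi.single k 1 : Fin 2 → ℂ) = Pi.single k 1 := by
    ext j; fin_cases k <;> fin_cases j <;> simp
  have d4 := e1 (0, Pi.single k 1, 0) (a, 0, 0)
  simp only [swapStar, star_zero, e] at d4
  rw [d1, d2, map_smul, smul_apply, map_add, d3, add_zero, d4, fderiv_fderiv_apply_gmap e4,
    smul_eq_mul]
  simp

/-- If the first derivative of `gmap F` at the origin is the projection to the first coordinate,
then the Freeman form is given by the second derivative of the second component of `gmap F`. -/
theorem IsNormalForm.exists_fderiv_fderiv_gmap_ne (h : IsNormalForm M ψ F) (h0 : 0 ∈ M.carrier)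
    (hL : M.leviRank 0 = 1) (hFr : M.FreemanNondegenerate 0)
    (hA : ∀ v, fderiv ℂ (gmap F) 0 v = ![v 0, 0]) :
    ∃ v, fderiv ℂ (fderiv ℂ (gmap F)) 0 v (Pi.single 0 1) 1 ≠ 0 := by
  by_contra! hcon
  obtain ⟨Φ, hΦ⟩ := h.exists_isLocalChart
  obtain ⟨X, hX, hXK⟩ := LocalHypersurface.exists_mem_T10_notMem_K10 hL
  obtain ⟨L, hLs, rfl⟩ := M.exists_isT10Section h0 hX
  obtain ⟨K, hK, hKL⟩ := hFr.2 L hLs hXK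
  refine hKL ?_
  have hdef := h.isDefining_zero hΦ h0
  have hKs : M.IsT10Section 0 K := hK.1
  have hK0 : K 0 ∈ M.K10 0 := hK.2.self_of_nhdsWithin h0
  obtain ⟨-, -, hK3⟩ := (h.mem_K10_zero_iff hΦ h0).1 hK0
  obtain ⟨-, hL2⟩ := (h.mem_T10_zero_iff hΦ h0).1 hX
  set κ : (Fin 3 → ℂ) → (Fin 2 → ℂ) × ℂ := fun q => fderiv ℂ Φ q (K q).1 with hκdef
  have hκ : AnalyticAt ℝ κ 0 := hdef.analyticAt_fderiv_apply hKs.analyticAt_fst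
  have hκ0 : (κ 0).1 0 = 0 := by
    rw [hA] at hK3
    simpa using congrFun hK3 0
  set Z : CVec 3 := (0, star (L 0).1) with hZ
  have hZT : Z ∈ M.CT 0 := by
    have h1 := M.mem_T10_iff.1 hX
    have := M.star_mem_CT h0 h1.1
    rwa [h1.2, star_zero] at this
  set lam := (fderiv ℂ Φ 0 (L 0).1).1 with hlam
  have hpush : push Φ 0 Z = (0, (star lam, 0)) := by
    rw [hZ, push_right, star_star]
    have : fderiv ℂ Φ 0 (L 0).1 = (lam, 0) := Prod.ext rfl hL2
    rw [this]
    simp [Prod.ext_iff]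
  set γ := cderiv κ 0 Z with hγ
  -- Pairing with the tangent direction `antiholDir` of index `0` makes `H` applied to a Levi kernel
  -- field zero along `M`. Differentiating this along the conjugate of `L` is the heart of the
  -- argument.
  let H : (Fin 2 → ℂ) × (Fin 2 → ℂ) × ℂ → ((Fin 2 → ℂ) × (Fin 2 → ℂ) × ℂ) →L[ℂ] ℂ :=
    fun x => fderiv ℂ (fderiv ℂ F) x (antiholDir F x 0)
  have hHa : AnalyticAt ℂ H 0 :=
    ((h.analyticAt_graph.fderiv.fderiv.contDiffAt (n := ⊤)).clm_apply
      (contDiffAt_antiholDir h.analyticAt_graph 0)).analyticAt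
  have hH : DifferentiableAt ℂ H 0 := hHa.differentiableAt
  have hγ0 : γ.1 0 = 0 := by
    have hg0 : graphPoint (conjPair Φ 0) = 0 := by rw [hΦ.conjPair_zero, map_zero]
    have hHg : DifferentiableAt ℂ (fun p => H (graphPoint p)) (conjPair Φ 0) := by
      have : DifferentiableAt ℂ H (graphPoint (conjPair Φ 0)) := by rw [hg0]; exact hH
      exact this.comp _ graphPoint.differentiableAt
    let ι : ((Fin 2 → ℂ) × ℂ) →L[ℂ] ((Fin 2 → ℂ) × (Fin 2 → ℂ) × ℂ) :=
      graphPoint.comp (ContinuousLinearMap.inl ℂ _ _)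
    have hι : ∀ α, ι α = (α.1, 0, 1 / 2 * α.2) := fun α => by
      simp [ι, graphPoint_apply]
    have hB : DifferentiableAt ℝ (fun q => H (graphPoint (conjPair Φ q))) 0 :=
      DifferentiableAt.comp (0 : Fin 3 → ℂ) (hHg.restrictScalars ℝ)
        (differentiableAt_conjPair hΦ.analyticAt)
    have hικ : DifferentiableAt ℝ (fun q => ι (κ q)) 0 :=
      DifferentiableAt.comp (0 : Fin 3 → ℂ) (ι.differentiableAt.restrictScalars ℝ)
        hκ.differentiableAt
    have hvan : ∀ᶠ q in 𝓝[M.carrier] 0, H (graphPoint (conjPair Φ q)) (ι (κ q)) = 0 := by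
      have hc : ∀ᶠ q in 𝓝[M.carrier] (0 : Fin 3 → ℂ), q ∈ M.carrier := self_mem_nhdsWithin
      have hd : ∀ᶠ q in 𝓝[M.carrier] (0 : Fin 3 → ℂ),
          (q ∈ M.carrier → IsDefining M Φ (graphDefining F) q) ∧
          AnalyticAt ℂ F (graphPoint (conjPair Φ q)) :=
        nhdsWithin_le_nhds ((hΦ.eventually_isDefining h).and
          (AnalyticAt.eventually_comp h.analyticAt_graph hΦ.tendsto_graphPoint))
      filter_upwards [hc, hd, hK.2] with q e1 ⟨e2, e3⟩ e4
      have e5 := ((e2 e1).mem_K10_iff_forall.1 e4).2 _ (fderiv_graphDefining_antiholDir e3 0)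
      rw [fderiv_fderiv_graphDefining e3, graphPoint_antiholDir, neg_eq_zero] at e5
      exact e5
    have hda : AnalyticAt ℝ (fun q => H (graphPoint (conjPair Φ q)) (ι (κ q))) 0 := by
      have hΦr : AnalyticAt ℝ Φ 0 := hΦ.analyticAt.restrictScalars
      have e1 : AnalyticAt ℂ (fun p => H (graphPoint p)) (conjPair Φ 0) := by
        have : AnalyticAt ℂ H (graphPoint (conjPair Φ 0)) := by rw [hg0]; exact hHa
        exact this.fun_comp (graphPoint.analyticAt _)
      have e2 : AnalyticAt ℝ (fun q => H (graphPoint (conjPair Φ q))) 0 :=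
        (e1.restrictScalars (𝕜 := ℝ)).comp (f := conjPair Φ)
          (hΦr.prod (analyticAt_real_star hΦr))
      have e3 : AnalyticAt ℝ (fun q => ContinuousLinearMap.restrictScalarsL ℂ ((Fin 2 → ℂ) × (Fin 2 → ℂ) × ℂ) ℂ ℝ ℝ
          (H (graphPoint (conjPair Φ q)))) 0 :=
        ((ContinuousLinearMap.restrictScalarsL ℂ ((Fin 2 → ℂ) × (Fin 2 → ℂ) × ℂ) ℂ ℝ ℝ).analyticAt _).comp e2
      have e4 : AnalyticAt ℝ (fun q => ι (κ q)) 0 :=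
        ((ι.analyticAt _).restrictScalars (𝕜 := ℝ)).comp hκ
      exact ((e3.contDiffAt (n := ⊤)).clm_apply (e4.contDiffAt (n := ⊤))).analyticAt
    have hz := M.deriveAlong_eq_zero h0 hda hvan hZT
    rw [deriveAlong_eq_cderiv, cderiv_clm_apply hB hικ,
      cderiv_comp_conjPair hΦ.analyticAt hHg, cderiv_comp ι.differentiableAt hκ.differentiableAt,
      hpush, ι.fderiv, hι, hι, hg0] at hz
    -- The kernel vector has first coordinate `0`, so only the derivative of the conjugate of
    -- `∂g₂/∂z₁` enters, which `hcon` kills.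
    have hH1 : fderiv ℂ (fun p => H (graphPoint p)) (conjPair Φ 0) (0, (star lam, 0))
        ((κ 0).1, 0, 1 / 2 * (κ 0).2) = 0 := by
      have hd : DifferentiableAt ℂ
          (fun p => H (graphPoint p) ((κ 0).1, 0, 1 / 2 * (κ 0).2)) (conjPair Φ 0) :=
        hHg.clm_apply (differentiableAt_const _)
      have e1 : fderiv ℂ (fun p => H (graphPoint p)) (conjPair Φ 0) (0, (star lam, 0))
          ((κ 0).1, 0, 1 / 2 * (κ 0).2) = fderiv ℂ (fun p => H (graphPoint p)
          ((κ 0).1, 0, 1 / 2 * (κ 0).2)) (conjPair Φ 0) (0, (star lam, 0)) := by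
        rw [fderiv_clm_apply hHg (differentiableAt_const _)]
        simp
      rw [e1]
      refine fderiv_apply_eq_of_hasDerivAt_comp hd
        (hasDerivAt_smul_const_zero _) (by rw [hΦ.conjPair_zero, zero_smul]) ?_
      have hgd : AnalyticAt ℂ (fderiv ℂ (gmap F)) 0 := (analyticAt_gmap h.analyticAt_graph).fderiv
      have d1 : HasFDerivAt (fun z => fderiv ℂ (gmap F) z (Pi.single 0 1) 1)
          ((ContinuousLinearMap.proj 1).comp
            ((fderiv ℂ (fderiv ℂ (gmap F)) 0).flip (Pi.single 0 1))) ((0 : ℂ) • lam) := by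
        rw [zero_smul]
        have := hgd.differentiableAt.hasFDerivAt.clm_apply
          (hasFDerivAt_const (Pi.single 0 1 : Fin 2 → ℂ) (0 : Fin 2 → ℂ))
        simp only [ContinuousLinearMap.comp_zero, zero_add] at this
        exact hasFDerivAt_pi'.1 this 1
      have d2 := (d1.comp_hasDerivAt (0 : ℂ) (hasDerivAt_smul_const_zero lam)).conj_conj
      rw [map_zero] at d2
      have d3 := d2.const_mul (-(1 / (2 * Complex.I)) * (κ 0).1 1)
      have hval : ((ContinuousLinearMap.proj (R := ℂ) (φ := fun _ : Fin 2 => ℂ) 1).comp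
            ((fderiv ℂ (fderiv ℂ (gmap F)) 0).flip (Pi.single 0 1))) lam = 0 := hcon lam
      rw [hval, map_zero, mul_zero] at d3
      refine d3.congr_of_eventuallyEq ?_
      have ht : Tendsto (fun t : ℂ => t • star lam) (𝓝 0) (𝓝 0) :=
        tendsto_zero_of_continuousAt (by fun_prop) (by simp)
      filter_upwards [ht.eventually h.fderiv_fderiv_antiholDir] with t e
      have e2 : graphPoint (t • ((0, (star lam, 0)) : ((Fin 2 → ℂ) × ℂ) × ((Fin 2 → ℂ) × ℂ)))
          = (0, t • star lam, 0) := by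
        rw [graphPoint_apply]; simp
      simp only [H, e2]
      rw [e]
      simp [Fin.sum_univ_two, hκ0]
      ring
    rw [hH1, zero_add] at hz
    -- What is left of the differentiated equation is `-γ₁ / 2i = 0`. As the `(1,0)` part of the
    -- bracket is `-γ`, that part lies in the Levi kernel, against nondegeneracy.
    have hH2 := h.fderiv_fderiv_antiholDir.self_of_nhds γ.1 (1 / 2 * γ.2) 0
    rw [star_zero, hA] at hH2
    have hz' := hH2.symm.trans hz
    simpa [Fin.sum_univ_two] using hz'
  have hb1 : fderiv ℂ Φ 0 (bracket K (conjField L) 0).1 = -γ := by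
    rw [bracket_conjField_fst h0 hKs hLs, map_neg, ← cderiv_fderiv_apply hΦ.analyticAt
      hKs.analyticAt_fst.differentiableAt]
  have hlevi : M.leviForm K L 0 = 0 := by
    rw [hdef.leviForm_eq_zero_iff hKs hLs]
    exact (hdef.mem_K10_iff.1 (hK.2.self_of_nhdsWithin h0)).2 _ hX
  obtain ⟨hc1, hc2⟩ := hdef.bracket_mem_CT hKs hLs hlevi
  have e : bracket K (conjField L) 0 = ((bracket K (conjField L) 0).1, 0)
      + (0, (bracket K (conjField L) 0).2) := by simp
  rw [LocalHypersurface.freemanForm, Submodule.Quotient.mk_eq_zero, e]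
  refine Submodule.add_mem_sup ?_ (M.mem_T01_iff.2 ⟨hc2, rfl⟩)
  have hT := (h.mem_T10_zero_iff hΦ h0).1 (M.mem_T10_iff.2 ⟨hc1, rfl⟩)
  rw [h.mem_K10_zero_iff hΦ h0]
  refine ⟨hT.1, hT.2, ?_⟩
  simp only [hb1, hA]
  simp [hγ0]

end

end CRGeometry

end

/-! ### Effect of coordinate changes on the normal form. -/

noncomputable section

namespace CRGeometry

section

variable {M : LocalHypersurface 3} {ψ : (Fin 2 → ℂ) × ℂ → (Fin 3 → ℂ)}
  {F : (Fin 2 → ℂ) × (Fin 2 → ℂ) × ℂ → ℂ}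

theorem IsNormalForm.change (h : IsNormalForm M ψ F) {f : (Fin 2 → ℂ) → (Fin 2 → ℂ)}
    (hf : AnalyticAt ℂ f 0) (hf0 : f 0 = 0) {B : (Fin 2 → ℂ) ≃L[ℂ] (Fin 2 → ℂ)}
    (hB : HasFDerivAt f (B : (Fin 2 → ℂ) →L[ℂ] (Fin 2 → ℂ)) 0) :
    IsNormalForm M (fun y => ψ (f y.1, y.2))
      (fun x => F (f x.1, star (f (star x.2.1)), x.2.2)) := by
  have hfc : ContDiffAt ℂ ⊤ f 0 := hf.contDiffAt
  have hfs : ContDiffAt ℂ ⊤ (fun ζ => star (f (star ζ))) 0 :=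
    (analyticAt_star_star (x := (0 : Fin 2 → ℂ)) (by rwa [star_zero])).contDiffAt
  have h1 : ContDiffAt ℂ ⊤ (fun y : (Fin 2 → ℂ) × ℂ => (f y.1, y.2)) 0 :=
    (hfc.comp (0 : (Fin 2 → ℂ) × ℂ) contDiffAt_fst).prodMk contDiffAt_snd
  have h2 : ContDiffAt ℂ ⊤ (fun x : (Fin 2 → ℂ) × (Fin 2 → ℂ) × ℂ =>
      (f x.1, star (f (star x.2.1)), x.2.2)) 0 :=
    (hfc.comp (0 : (Fin 2 → ℂ) × (Fin 2 → ℂ) × ℂ) contDiffAt_fst).prodMk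
      ((hfs.comp (0 : (Fin 2 → ℂ) × (Fin 2 → ℂ) × ℂ) (contDiffAt_fst.comp _ contDiffAt_snd)).prodMk
        (contDiffAt_snd.comp _ contDiffAt_snd))
  have h10 : (fun y : (Fin 2 → ℂ) × ℂ => (f y.1, y.2)) 0 = 0 := by simp [hf0, Prod.ext_iff]
  have h20 : (fun x : (Fin 2 → ℂ) × (Fin 2 → ℂ) × ℂ =>
      (f x.1, star (f (star x.2.1)), x.2.2)) 0 = 0 := by simp [hf0, Prod.ext_iff]
  have t1 := tendsto_zero_of_continuousAt h1.continuousAt h10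
  have t2 := tendsto_zero_of_continuousAt h2.continuousAt h20
  obtain ⟨A, hA⟩ := h.fderiv_param
  refine ⟨analyticAt_comp h.analyticAt_param h1 h10, ?_,
    ⟨(B.prodCongr (ContinuousLinearEquiv.refl ℂ ℂ)).trans A, ?_⟩,
    analyticAt_comp h.analyticAt_graph h2 h20, ?_, ?_, ?_⟩
  · exact (congrArg ψ h10).trans h.param_zero
  · have d1 : HasFDerivAt (fun y : (Fin 2 → ℂ) × ℂ => (f y.1, y.2))
        ((B.prodCongr (ContinuousLinearEquiv.refl ℂ ℂ) :
          ((Fin 2 → ℂ) × ℂ) ≃L[ℂ] ((Fin 2 → ℂ) × ℂ)) :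
          ((Fin 2 → ℂ) × ℂ) →L[ℂ] ((Fin 2 → ℂ) × ℂ)) 0 := by
      have d0 : HasFDerivAt (fun y : (Fin 2 → ℂ) × ℂ => f y.1)
          ((B : (Fin 2 → ℂ) →L[ℂ] (Fin 2 → ℂ)).comp (ContinuousLinearMap.fst ℂ _ _)) 0 :=
        HasFDerivAt.comp (g := f) (0 : (Fin 2 → ℂ) × ℂ) hB hasFDerivAt_fst
      exact d0.prodMk (hasFDerivAt_snd (p := (0 : (Fin 2 → ℂ) × ℂ)))
    have d2 : HasFDerivAt ψ (A : ((Fin 2 → ℂ) × ℂ) →L[ℂ] (Fin 3 → ℂ))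
        ((fun y : (Fin 2 → ℂ) × ℂ => (f y.1, y.2)) 0) := by rw [h10]; exact hA
    exact d2.comp (0 : (Fin 2 → ℂ) × ℂ) d1
  · filter_upwards [t1.eventually h.graph_right] with y hy
    simpa [hf0] using hy
  · filter_upwards [t2.eventually h.graph_star] with x hx
    simpa using hx
  · filter_upwards [t1.eventually h.mem_iff] with y hy
    simpa using hy

/-- A derivative in `ζ` at `ζ = 0` sees only the linear part of the conjugated change, whereas the
dependence on `z` is composed with all of `f`. This asymmetry lets a nonlinear change straighten
`gmap F`. -/
theorem IsNormalForm.gmap_change (h : IsNormalForm M ψ F) {f : (Fin 2 → ℂ) → (Fin 2 → ℂ)}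
    (hf : AnalyticAt ℂ f 0) (hf0 : f 0 = 0) {B : (Fin 2 → ℂ) →L[ℂ] (Fin 2 → ℂ)}
    (hB : HasFDerivAt f B 0) :
    ∀ᶠ z in 𝓝 0, ∀ k, gmap (fun x => F (f x.1, star (f (star x.2.1)), x.2.2)) z k
      = ∑ l, star (B (Pi.single k 1) l) * gmap F (f z) l := by
  have hfc : ContDiffAt ℂ ⊤ f 0 := hf.contDiffAt
  have hfs : ContDiffAt ℂ ⊤ (fun ζ => star (f (star ζ))) 0 :=
    (analyticAt_star_star (x := (0 : Fin 2 → ℂ)) (by rwa [star_zero])).contDiffAt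
  have h2 : ContDiffAt ℂ ⊤ (fun x : (Fin 2 → ℂ) × (Fin 2 → ℂ) × ℂ =>
      (f x.1, star (f (star x.2.1)), x.2.2)) 0 :=
    (hfc.comp (0 : (Fin 2 → ℂ) × (Fin 2 → ℂ) × ℂ) contDiffAt_fst).prodMk
      ((hfs.comp (0 : (Fin 2 → ℂ) × (Fin 2 → ℂ) × ℂ) (contDiffAt_fst.comp _ contDiffAt_snd)).prodMk
        (contDiffAt_snd.comp _ contDiffAt_snd))
  have h20 : (fun x : (Fin 2 → ℂ) × (Fin 2 → ℂ) × ℂ =>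
      (f x.1, star (f (star x.2.1)), x.2.2)) 0 = 0 := by simp [hf0, Prod.ext_iff]
  have h3 := analyticAt_comp h.analyticAt_graph h2 h20
  have tf : Tendsto f (𝓝 0) (𝓝 0) := tendsto_zero_of_continuousAt hf.continuousAt hf0
  filter_upwards [AnalyticAt.eventually_comp h3 tendsto_zSection,
    AnalyticAt.eventually_comp h.analyticAt_graph (tendsto_zSection.comp tf)] with z e1 e2 k
  have hBs : HasDerivAt (fun t : ℂ => star (f (star (t • (Pi.single k 1 : Fin 2 → ℂ)))))
      (star (B (Pi.single k 1))) 0 := by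
    refine hasDerivAt_pi.2 fun l => ?_
    have d0 : HasFDerivAt f B ((0 : ℂ) • (Pi.single k 1 : Fin 2 → ℂ)) := by rwa [zero_smul]
    have d1 := hasDerivAt_pi.1 (d0.comp_hasDerivAt (0 : ℂ)
      (hasDerivAt_smul_const_zero (Pi.single k 1 : Fin 2 → ℂ))) l
    have d2 := d1.conj_conj
    rw [map_zero] at d2
    have e : star (Pi.single k 1 : Fin 2 → ℂ) = Pi.single k 1 := by
      ext j; fin_cases k <;> fin_cases j <;> simp
    convert! d2 using 1
    ext t
    simp [star_smul, e]
  have hsum : ∑ l, star (B (Pi.single k 1) l) * gmap F (f z) l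
      = fderiv ℂ F (f z, 0, 0) (0, star (B (Pi.single k 1)), 0) := by
    rw [fderiv_apply_mid]
    rfl
  rw [hsum, gmap]
  have e0 : (z, (0 : Fin 2 → ℂ), (0 : ℂ)) + (0 : ℂ) • (0, Pi.single k 1, 0) = (z, 0, 0) := by simp
  have dl : HasDerivAt (fun t : ℂ => (z, (0 : Fin 2 → ℂ), (0 : ℂ)) + t • (0, Pi.single k 1, 0))
      ((0 : Fin 2 → ℂ), (Pi.single k 1 : Fin 2 → ℂ), (0 : ℂ)) 0 :=
    (hasDerivAt_smul_const_zero _).const_add _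
  refine fderiv_apply_eq_of_hasDerivAt_comp e1.differentiableAt dl e0 ?_
  have dF : HasFDerivAt F (fderiv ℂ F (f z, 0, 0))
      (f z, star (f (star ((0 : ℂ) • (Pi.single k 1 : Fin 2 → ℂ)))), (0 : ℂ)) := by
    simp only [zero_smul, star_zero, hf0]
    exact e2.differentiableAt.hasFDerivAt
  have dk := dF.comp_hasDerivAt (0 : ℂ) (((hasDerivAt_const (0 : ℂ) (f z)).prodMk
    (hBs.prodMk (hasDerivAt_const (0 : ℂ) (0 : ℂ)))))
  convert! dk using 1
  ext t
  simp

theorem IsNormalForm.flip (h : IsNormalForm M ψ F) :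
    IsNormalForm M (fun y => ψ (y.1, -y.2)) (fun x => -F (x.1, x.2.1, -x.2.2)) := by
  have h1 : ContDiff ℂ ⊤ (fun y : (Fin 2 → ℂ) × ℂ => (y.1, -y.2)) := by fun_prop
  have h2 : ContDiff ℂ ⊤ (fun x : (Fin 2 → ℂ) × (Fin 2 → ℂ) × ℂ => (x.1, x.2.1, -x.2.2)) := by
    fun_prop
  have h10 : (fun y : (Fin 2 → ℂ) × ℂ => (y.1, -y.2)) 0 = 0 := by simp [Prod.ext_iff]
  have h20 : (fun x : (Fin 2 → ℂ) × (Fin 2 → ℂ) × ℂ => (x.1, x.2.1, -x.2.2)) 0 = 0 := by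
    simp [Prod.ext_iff]
  have t1 := tendsto_zero_of_continuousAt h1.continuous.continuousAt h10
  have t2 := tendsto_zero_of_continuousAt h2.continuous.continuousAt h20
  obtain ⟨A, hA⟩ := h.fderiv_param
  refine ⟨analyticAt_comp h.analyticAt_param h1.contDiffAt h10, ?_,
    ⟨((ContinuousLinearEquiv.refl ℂ (Fin 2 → ℂ)).prodCongr (ContinuousLinearEquiv.neg ℂ)).trans A,
      ?_⟩,
    (analyticAt_comp h.analyticAt_graph h2.contDiffAt h20).neg, ?_, ?_, ?_⟩
  · exact (congrArg ψ h10).trans h.param_zero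
  · have d1 := ((ContinuousLinearEquiv.refl ℂ (Fin 2 → ℂ)).prodCongr
      (ContinuousLinearEquiv.neg ℂ (M := ℂ))).hasFDerivAt (x := 0)
    have d2 : HasFDerivAt ψ (A : ((Fin 2 → ℂ) × ℂ) →L[ℂ] (Fin 3 → ℂ))
        (((ContinuousLinearEquiv.refl ℂ (Fin 2 → ℂ)).prodCongr
      (ContinuousLinearEquiv.neg ℂ (M := ℂ))) 0) := by rw [map_zero]; exact hA
    exact d2.comp (0 : (Fin 2 → ℂ) × ℂ) d1
  · filter_upwards [t1.eventually h.graph_right] with y hy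
    simpa using hy
  · filter_upwards [t2.eventually h.graph_star] with x hx
    rw [← hx]
    simp
  · filter_upwards [t1.eventually h.mem_iff] with y hy
    rw [hy]
    simp [neg_eq_iff_eq_neg]

theorem IsNormalForm.gmap_flip (h : IsNormalForm M ψ F) :
    ∀ᶠ z in 𝓝 0, gmap (fun x => -F (x.1, x.2.1, -x.2.2)) z = -gmap F z := by
  filter_upwards [AnalyticAt.eventually_comp h.analyticAt_graph tendsto_zSection] with z e
  ext k
  let C : ((Fin 2 → ℂ) × (Fin 2 → ℂ) × ℂ) ≃L[ℂ] ((Fin 2 → ℂ) × (Fin 2 → ℂ) × ℂ) :=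
    (ContinuousLinearEquiv.refl ℂ (Fin 2 → ℂ)).prodCongr
      ((ContinuousLinearEquiv.refl ℂ (Fin 2 → ℂ)).prodCongr (ContinuousLinearEquiv.neg ℂ))
  have hC : C (z, 0, 0) = (z, 0, 0) := by simp [C]
  have d1 : HasFDerivAt F (fderiv ℂ F (z, 0, 0)) (C (z, 0, 0)) := by
    rw [hC]; exact e.differentiableAt.hasFDerivAt
  have d2 := (d1.comp (z, (0 : Fin 2 → ℂ), (0 : ℂ)) C.hasFDerivAt).neg
  have d3 : fderiv ℂ (fun x : (Fin 2 → ℂ) × (Fin 2 → ℂ) × ℂ => -F (x.1, x.2.1, -x.2.2)) (z, 0, 0)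
      = _ := d2.fderiv
  rw [gmap, d3]
  simp [C, gmap]

theorem exists_local_inverse {θ : (Fin 2 → ℂ) → (Fin 2 → ℂ)} (hθ : AnalyticAt ℂ θ 0)
    (hθ0 : θ 0 = 0) {B : (Fin 2 → ℂ) ≃L[ℂ] (Fin 2 → ℂ)}
    (hB : HasFDerivAt θ (B : (Fin 2 → ℂ) →L[ℂ] (Fin 2 → ℂ)) 0) :
    ∃ f : (Fin 2 → ℂ) → (Fin 2 → ℂ), AnalyticAt ℂ f 0 ∧ f 0 = 0 ∧
      HasFDerivAt f (B.symm : (Fin 2 → ℂ) →L[ℂ] (Fin 2 → ℂ)) 0 ∧ ∀ᶠ z in 𝓝 0, θ (f z) = z := by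
  have hc : ContDiffAt ℂ ⊤ θ 0 := hθ.contDiffAt
  have hs := hc.hasStrictFDerivAt' hB (by simp)
  have h1 := (hc.to_localInverse hB (by simp)).analyticAt
  have h2 := hs.to_localInverse.hasFDerivAt
  have h3 := hs.eventually_right_inverse
  have h4 := hs.localInverse_apply_image
  rw [hθ0] at h1 h2 h3 h4
  exact ⟨_, h1, h4, h2, h3⟩

end

end CRGeometry

end

/-! ### Normalization of `gmap`. -/

noncomputable section

namespace CRGeometry

/-- A symmetrically normalized graph: `∂F/∂ζ_1(z, 0, 0) = z_1` and
`∂F/∂ζ_2(z, 0, 0) = z_1² / 2 + O(3)`. -/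
structure IsNormalized (F : (Fin 2 → ℂ) × (Fin 2 → ℂ) × ℂ → ℂ) : Prop where
  gmap_zero : ∀ᶠ z in 𝓝 0, gmap F z 0 = z 0
  gmap_one : ∀ᶠ z in 𝓝 0, fderiv ℂ (gmap F) z (Pi.single 1 1) 1 = 0
  gmap_one_fderiv : ∀ v, fderiv ℂ (gmap F) 0 v 1 = 0
  gmap_one_sndFDeriv : fderiv ℂ (fderiv ℂ (gmap F)) 0 (Pi.single 0 1) (Pi.single 0 1) 1 = 1

section

variable {M : LocalHypersurface 3}

theorem hasFDerivAt_gmap_apply {F : (Fin 2 → ℂ) × (Fin 2 → ℂ) × ℂ → ℂ} {z : Fin 2 → ℂ}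
    (hF : AnalyticAt ℂ (gmap F) z) (k : Fin 2) :
    HasFDerivAt (fun z => gmap F z k) ((ContinuousLinearMap.proj k).comp (fderiv ℂ (gmap F) z)) z :=
  hasFDerivAt_pi'.1 hF.differentiableAt.hasFDerivAt k

/-- A nonzero Hermitian matrix of determinant zero with vanishing first diagonal entry has vanishing
off-diagonal entries, hence a nonzero second one: swap the variables. The diagonal entry is real,
and `w ↦ -w` adjusts its sign. -/
theorem IsNormalForm.exists_fderiv_gmap_re_pos {ψ : (Fin 2 → ℂ) × ℂ → (Fin 3 → ℂ)}
    {F : (Fin 2 → ℂ) × (Fin 2 → ℂ) × ℂ → ℂ} (h : IsNormalForm M ψ F) (h0 : 0 ∈ M.carrier)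
    (hL : ∀ p ∈ M.carrier, M.leviRank p = 1) :
    ∃ ψ F, IsNormalForm M ψ F ∧ 0 < (fderiv ℂ (gmap F) 0 (Pi.single 0 1) 0).re := by
  have step : ∃ ψ F, IsNormalForm M ψ F ∧ fderiv ℂ (gmap F) 0 (Pi.single 0 1) 0 ≠ 0 := by
    by_cases h1 : fderiv ℂ (gmap F) 0 (Pi.single 0 1) 0 = 0
    swap
    · exact ⟨ψ, F, h, h1⟩
    have hdet := (h.eventually_det_gmap hL).self_of_nhds
    rw [Matrix.det_fin_two] at hdet
    simp only [Matrix.of_apply, h1, zero_mul, zero_sub, neg_eq_zero] at hdet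
    rw [← h.star_fderiv_gmap 0 1, mul_eq_zero, star_eq_zero, or_self] at hdet
    have hdet' : fderiv ℂ (gmap F) 0 (Pi.single 1 1) 0 = 0 := by
      rw [← h.star_fderiv_gmap 0 1, hdet, star_zero]
    have h2 : fderiv ℂ (gmap F) 0 (Pi.single 1 1) 1 ≠ 0 := by
      intro h2
      refine h.fderiv_gmap_zero_ne h0 (hL 0 h0) (ContinuousLinearMap.ext fun v => ?_)
      have hv : v = v 0 • Pi.single 0 1 + v 1 • Pi.single 1 1 := by
        ext j; fin_cases j <;> simp
      rw [hv, map_add, map_smul, map_smul]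
      ext k
      fin_cases k <;> simp [h1, h2, hdet, hdet']
    let C : (Fin 2 → ℂ) ≃L[ℂ] (Fin 2 → ℂ) :=
      ContinuousLinearEquiv.piCongrLeft ℂ (fun _ => ℂ) (Equiv.swap (0 : Fin 2) 1)
    have hC : ∀ z, C z = ![z 1, z 0] := by
      intro z
      ext j
      have : ∀ j, C z (Equiv.swap (0 : Fin 2) 1 j) = z j := fun j =>
        Equiv.piCongrLeft_apply_apply (P := fun _ => ℂ) (Equiv.swap (0 : Fin 2) 1) z j
      fin_cases j
      · exact this 1
      · exact this 0
    have hCa : AnalyticAt ℂ C 0 := C.analyticAt 0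
    refine ⟨_, _, h.change hCa (map_zero C) C.hasFDerivAt, ?_⟩
    have hg := h.gmap_change hCa (map_zero C) C.hasFDerivAt
    have hga := analyticAt_gmap (h.change hCa (map_zero C) C.hasFDerivAt).analyticAt_graph
    have hFa : AnalyticAt ℂ (gmap F) (C 0) := by
      rw [map_zero]; exact analyticAt_gmap h.analyticAt_graph
    have d1 := hasFDerivAt_gmap_apply hga 0
    have d2 : HasFDerivAt (fun z => gmap F (C z) 1) _ 0 :=
      (hasFDerivAt_gmap_apply hFa 1).comp (0 : Fin 2 → ℂ) C.hasFDerivAt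
    have d3 := d1.unique (d2.congr_of_eventuallyEq (by
      filter_upwards [hg] with z hz
      rw [hz 0]
      simp [hC, Fin.sum_univ_two]))
    have d4 := DFunLike.congr_fun d3 (Pi.single 0 1)
    have hCe : C (Pi.single 0 1) = Pi.single 1 1 := by
      rw [hC]; ext j; fin_cases j <;> simp
    simp only [ContinuousLinearMap.comp_apply, ContinuousLinearMap.proj_apply, map_zero,
      ContinuousLinearEquiv.coe_coe, hCe] at d4
    rw [d4]
    exact h2
  obtain ⟨ψ₁, F₁, hN, hne⟩ := step
  have hreal : (fderiv ℂ (gmap F₁) 0 (Pi.single 0 1) 0).im = 0 :=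
    Complex.conj_eq_iff_im.1 (hN.star_fderiv_gmap 0 0)
  have hre : (fderiv ℂ (gmap F₁) 0 (Pi.single 0 1) 0).re ≠ 0 := fun hz =>
    hne (Complex.ext hz hreal)
  rcases hre.lt_or_gt with hlt | hgt
  · refine ⟨_, _, hN.flip, ?_⟩
    have e : gmap (fun x => -F₁ (x.1, x.2.1, -x.2.2)) =ᶠ[𝓝 0] fun z => -gmap F₁ z := hN.gmap_flip
    rw [e.fderiv_eq, fderiv_fun_neg]
    simpa using hlt
  · exact ⟨ψ₁, F₁, hN, hgt⟩

theorem IsNormalForm.exists_gmap_zero_eq {ψ : (Fin 2 → ℂ) × ℂ → (Fin 3 → ℂ)}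
    {F : (Fin 2 → ℂ) × (Fin 2 → ℂ) × ℂ → ℂ} (h : IsNormalForm M ψ F)
    (hpos : 0 < (fderiv ℂ (gmap F) 0 (Pi.single 0 1) 0).re) :
    ∃ ψ F, IsNormalForm M ψ F ∧ ∀ᶠ z in 𝓝 0, gmap F z 0 = z 0 := by
  set D := fderiv ℂ (gmap F) 0 with hD
  set r := Real.sqrt (D (Pi.single 0 1) 0).re with hr
  have hr0 : (r : ℂ) ≠ 0 := by
    exact_mod_cast (Real.sqrt_pos.2 hpos).ne'
  have hrr : D (Pi.single 0 1) 0 = r * r := by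
    have e : ((D (Pi.single 0 1) 0).re : ℂ) = D (Pi.single 0 1) 0 :=
      Complex.conj_eq_iff_re.1 (h.star_fderiv_gmap 0 0)
    rw [← e, ← Complex.ofReal_mul, Real.mul_self_sqrt hpos.le]
  have hg := analyticAt_gmap h.analyticAt_graph
  have hg0 : gmap F 0 = 0 := by
    ext k
    have : fderiv ℂ F ((0 : Fin 2 → ℂ), (0 : Fin 2 → ℂ), (0 : ℂ)) = 0 := h.fderiv_zero
    simp [gmap, this]
  -- The first component of `gmap F` becomes a coordinate. Dividing by `r`, the root of its
  -- derivative, is forced: the change multiplies it by `1 / r` again through the conjugated linear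
  -- part.
  let θ : (Fin 2 → ℂ) → (Fin 2 → ℂ) := fun z => ![gmap F z 0 / r, z 1]
  have hθa : AnalyticAt ℂ θ 0 := by
    refine analyticAt_pi_iff.2 fun k => ?_
    fin_cases k
    · exact (analyticAt_pi_iff.1 hg 0).div_const
    · exact (ContinuousLinearMap.proj (R := ℂ) (φ := fun _ : Fin 2 => ℂ) 1).analyticAt 0
  have hθ0 : θ 0 = 0 := by
    ext k
    fin_cases k <;> simp [θ, hg0]
  let T : (Fin 2 → ℂ) →ₗ[ℂ] (Fin 2 → ℂ) := (fderiv ℂ θ 0).toLinearMap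
  have hT : ∀ v, T v = ![D v 0 / r, v 1] := by
    intro v
    have d := hasFDerivAt_pi'.1 hθa.differentiableAt.hasFDerivAt
    have d0 : HasFDerivAt (fun z => gmap F z 0 / r) _ 0 := d 0
    have d1 : HasFDerivAt (fun z : Fin 2 → ℂ => z 1) _ 0 := d 1
    have e0 := d0.unique ((hasFDerivAt_gmap_apply hg 0).mul_const' (r : ℂ)⁻¹)
    have e1 := d1.unique (ContinuousLinearMap.proj (R := ℂ) (φ := fun _ : Fin 2 => ℂ) 1).hasFDerivAt
    have e0' := DFunLike.congr_fun e0 v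
    have e1' := DFunLike.congr_fun e1 v
    ext k
    fin_cases k
    · refine e0'.trans ?_
      simp [D, div_eq_mul_inv]
    · exact e1'
  have hinj : Function.Injective T := by
    refine (injective_iff_map_eq_zero T).2 fun v hv => ?_
    rw [hT] at hv
    have e1 : v 1 = 0 := congrFun hv 1
    have e0 : D v 0 / r = 0 := congrFun hv 0
    have ev : v = v 0 • Pi.single 0 1 := by
      ext j; fin_cases j <;> simp [e1]
    rw [ev, map_smul, Pi.smul_apply, hrr] at e0
    have : v 0 = 0 := by simpa [hr0] using e0
    rw [ev, this, zero_smul]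
  let B : (Fin 2 → ℂ) ≃L[ℂ] (Fin 2 → ℂ) :=
    (LinearEquiv.ofInjectiveEndo T hinj).toContinuousLinearEquiv
  have hBT : ∀ v, B v = T v := fun v => rfl
  have hB : HasFDerivAt θ (B : (Fin 2 → ℂ) →L[ℂ] (Fin 2 → ℂ)) 0 := by
    convert! hθa.differentiableAt.hasFDerivAt using 1
  obtain ⟨f, hf, hf0, hfd, hθf⟩ := exists_local_inverse hθa hθ0 hB
  refine ⟨_, _, h.change hf hf0 hfd, ?_⟩
  have hBe : B.symm (Pi.single 0 1) = (r : ℂ)⁻¹ • Pi.single 0 1 := by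
    rw [ContinuousLinearEquiv.symm_apply_eq, hBT, hT, map_smul]
    ext j
    fin_cases j
    · simp [hrr]
      field_simp
    · simp
  filter_upwards [h.gmap_change hf hf0 hfd, hθf] with z e1 e2
  have e3 := congrFun e2 0
  simp only [θ] at e3
  rw [e1, ← e3, ContinuousLinearEquiv.coe_coe, hBe]
  simp [Fin.sum_univ_two, div_eq_mul_inv, mul_comm]

theorem IsNormalForm.exists_isNormalized {ψ : (Fin 2 → ℂ) × ℂ → (Fin 3 → ℂ)}
    {F : (Fin 2 → ℂ) × (Fin 2 → ℂ) × ℂ → ℂ} (h : IsNormalForm M ψ F) (h0 : 0 ∈ M.carrier)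
    (hL : ∀ p ∈ M.carrier, M.leviRank p = 1) (hFr : M.FreemanNondegenerate 0)
    (hg0 : ∀ᶠ z in 𝓝 0, gmap F z 0 = z 0) :
    ∃ ψ F, IsNormalForm M ψ F ∧ IsNormalized F := by
  have hg := analyticAt_gmap h.analyticAt_graph
  have d0 : ∀ᶠ z in 𝓝 0, ∀ v, fderiv ℂ (gmap F) z v 0 = v 0 := by
    filter_upwards [hg.eventually_analyticAt, hg0.eventually_nhds] with z e1 e2 v
    have := (hasFDerivAt_gmap_apply e1 0).unique
      (((ContinuousLinearMap.proj (R := ℂ) (φ := fun _ : Fin 2 => ℂ) 0).hasFDerivAt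
        (x := z)).congr_of_eventuallyEq e2)
    exact DFunLike.congr_fun this v
  -- With first row `(1, 0)` for `dg₁`, the Jacobian determinant is just `∂g₂/∂z₂`.
  have d1 : ∀ᶠ z in 𝓝 0, fderiv ℂ (gmap F) z (Pi.single 1 1) 1 = 0 := by
    filter_upwards [d0, h.eventually_det_gmap hL] with z e1 e2
    rw [Matrix.det_fin_two] at e2
    simpa [e1] using e2
  have hA : ∀ v, fderiv ℂ (gmap F) 0 v = ![v 0, 0] := by
    intro v
    have hv : v = v 0 • Pi.single 0 1 + v 1 • Pi.single 1 1 := by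
      ext j; fin_cases j <;> simp
    have e1 : fderiv ℂ (gmap F) 0 (Pi.single 0 1) 1 = 0 := by
      rw [← h.star_fderiv_gmap 1 0, d0.self_of_nhds]
      simp
    ext k
    fin_cases k
    · exact d0.self_of_nhds v
    · conv_lhs => rw [hv, map_add, map_smul, map_smul]
      simp [e1, d1.self_of_nhds]
  obtain ⟨v, hv⟩ := h.exists_fderiv_fderiv_gmap_ne h0 (hL 0 h0) hFr hA
  have hflip : ∀ (g : (Fin 2 → ℂ) → (Fin 2 → ℂ)), AnalyticAt ℂ g 0 → ∀ w,
      HasFDerivAt (fun z => fderiv ℂ g z w 1) ((ContinuousLinearMap.proj 1).comp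
        ((fderiv ℂ (fderiv ℂ g) 0).flip w)) 0 := fun g hg w => by
    have := hg.fderiv.differentiableAt.hasFDerivAt.clm_apply
      (hasFDerivAt_const w (0 : Fin 2 → ℂ))
    simp only [ContinuousLinearMap.comp_zero, zero_add] at this
    exact hasFDerivAt_pi'.1 this 1
  have hsym : IsSymmSndFDerivAt ℂ (gmap F) 0 :=
    (hg.contDiffAt (n := ⊤)).isSymmSndFDerivAt (by simp)
  set c := fderiv ℂ (fderiv ℂ (gmap F)) 0 (Pi.single 0 1) (Pi.single 0 1) 1 with hc
  -- As `g₂` is independent of `z₂`, the nonzero derivative supplied by the Freeman form can only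
  -- come from `∂²g₂/∂z₁²`.
  have hc0 : c ≠ 0 := by
    intro hc0
    have e1 : fderiv ℂ (fderiv ℂ (gmap F)) 0 (Pi.single 1 1) (Pi.single 0 1) 1 = 0 := by
      rw [hsym.eq]
      have := (hflip _ hg (Pi.single 1 1)).unique
        ((hasFDerivAt_const (0 : ℂ) (0 : Fin 2 → ℂ)).congr_of_eventuallyEq d1)
      exact DFunLike.congr_fun this (Pi.single 0 1)
    have hv' : v = v 0 • Pi.single 0 1 + v 1 • Pi.single 1 1 := by
      ext j; fin_cases j <;> simp
    refine hv ?_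
    rw [hv', map_add, map_smul, map_smul]
    simp [e1, ← hc, hc0]
  -- Scaling `z₂` by `s` multiplies `g₂` by the conjugate of `s`, hence the conjugate here.
  set s : ℂ := star c⁻¹ with hs
  have hs0 : s ≠ 0 := by simp [hs, hc0]
  let u : Fin 2 → ℂˣ := ![1, Units.mk0 s hs0]
  let B : (Fin 2 → ℂ) ≃L[ℂ] (Fin 2 → ℂ) :=
    ContinuousLinearEquiv.piCongrRight fun j => ContinuousLinearEquiv.unitsEquivAut ℂ (u j)
  have hBv : ∀ z, B z = ![z 0, s * z 1] := by
    intro z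
    ext j
    fin_cases j <;> simp [B, u, mul_comm]
  have hBa : AnalyticAt ℂ B 0 := B.analyticAt 0
  have hNF := h.change hBa (map_zero B) B.hasFDerivAt
  refine ⟨_, _, hNF, ?_⟩
  have hch := h.gmap_change hBa (map_zero B) B.hasFDerivAt
  set F' : (Fin 2 → ℂ) × (Fin 2 → ℂ) × ℂ → ℂ :=
    fun x => F (B x.1, star (B (star x.2.1)), x.2.2) with hF'
  have tB : Tendsto B (𝓝 0) (𝓝 0) :=
    tendsto_zero_of_continuousAt B.continuous.continuousAt (map_zero B)
  have k0 : ∀ᶠ z in 𝓝 0, gmap F' z 0 = gmap F (B z) 0 := by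
    filter_upwards [hch] with z hz
    rw [hz 0]
    simp [hBv, Fin.sum_univ_two]
  have k1 : ∀ᶠ z in 𝓝 0, gmap F' z 1 = c⁻¹ * gmap F (B z) 1 := by
    filter_upwards [hch] with z hz
    rw [hz 1]
    simp [hBv, Fin.sum_univ_two, hs]
  have hg' := analyticAt_gmap hNF.analyticAt_graph
  have kd : ∀ᶠ z in 𝓝 0, ∀ v, fderiv ℂ (gmap F') z v 1
      = c⁻¹ * fderiv ℂ (gmap F) (B z) (B v) 1 := by
    filter_upwards [hg'.eventually_analyticAt, k1.eventually_nhds, tB.eventually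
      hg.eventually_analyticAt] with z e1 e2 e3 v
    have e4 := ((hasFDerivAt_gmap_apply e3 1).comp z B.hasFDerivAt).const_mul c⁻¹
    have e5 := (hasFDerivAt_gmap_apply e1 1).unique (e4.congr_of_eventuallyEq e2)
    simpa using DFunLike.congr_fun e5 v
  refine ⟨?_, ?_, ?_, ?_⟩
  · filter_upwards [k0, tB.eventually hg0] with z e1 e2
    rw [e1, e2, hBv]
    simp
  · have hBe : B (Pi.single 1 1) = s • Pi.single 1 1 := by
      rw [hBv]; ext j; fin_cases j <;> simp
    filter_upwards [kd, tB.eventually d1] with z e1 e2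
    rw [e1, hBe, map_smul, Pi.smul_apply, e2, smul_zero, mul_zero]
  · intro v
    rw [kd.self_of_nhds, map_zero, hA]
    simp
  · have hBe : B (Pi.single 0 1) = Pi.single 0 1 := by
      rw [hBv]; ext j; fin_cases j <;> simp
    have e1 := hflip _ hg (Pi.single 0 1)
    rw [← map_zero B] at e1
    have e2 := (e1.comp (0 : Fin 2 → ℂ) B.hasFDerivAt).const_mul c⁻¹
    have e3 := (hflip _ hg' (Pi.single 0 1)).unique (e2.congr_of_eventuallyEq (by
      filter_upwards [kd] with z hz
      rw [hz, hBe]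
      rfl))
    have e4 := DFunLike.congr_fun e3 (Pi.single 0 1)
    simp only [ContinuousLinearMap.comp_apply, ContinuousLinearMap.flip_apply, smul_apply,
      ContinuousLinearMap.proj_apply, ContinuousLinearEquiv.coe_coe, hBe, map_zero,
      smul_eq_mul] at e4
    rw [e4, ← hc, inv_mul_cancel₀ hc0]

theorem LocalHypersurface.exists_isNormalized (h0 : (0 : Fin 3 → ℂ) ∈ M.carrier)
    (hL : ∀ p ∈ M.carrier, M.leviRank p = 1) (hFr : M.FreemanNondegenerate 0) :
    ∃ ψ F, IsNormalForm M ψ F ∧ IsNormalized F := by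
  obtain ⟨ψ, F, h⟩ := M.exists_isNormalForm h0
  obtain ⟨ψ, F, h, hpos⟩ := h.exists_fderiv_gmap_re_pos h0 hL
  obtain ⟨ψ, F, h, hg⟩ := h.exists_gmap_zero_eq hpos
  exact h.exists_isNormalized h0 hL hFr hg

end

end CRGeometry

end

/-! ### Orders of vanishing from derivatives. -/

noncomputable section

namespace CRGeometry

section Taylor

variable {E F : Type*} [NormedAddCommGroup E] [NormedSpace ℂ E] [NormedAddCommGroup F]
  [NormedSpace ℂ F]

/-- The mean value inequality on the closed ball of radius `‖x‖`. -/
theorem isBigO_pow_succ_of_fderiv {f : E → F} {n : ℕ} (hf : ∀ᶠ x in 𝓝 0, DifferentiableAt ℂ f x)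
    (h0 : f 0 = 0) (h : fderiv ℂ f =O[𝓝 0] fun x => ‖x‖ ^ n) :
    f =O[𝓝 0] fun x => ‖x‖ ^ (n + 1) := by
  let _ : NormedSpace ℝ E := NormedSpace.restrictScalars ℝ ℂ E
  obtain ⟨C, hC, hb⟩ := h.exists_nonneg
  obtain ⟨ε, hε, hball⟩ := Metric.eventually_nhds_iff_ball.1 (hf.and hb.bound)
  refine IsBigO.of_bound C ?_
  filter_upwards [Metric.ball_mem_nhds (0 : E) hε] with x hx
  have hx' : ‖x‖ < ε := by simpa using hx
  have hsub : ∀ y ∈ Metric.closedBall (0 : E) ‖x‖, y ∈ Metric.ball (0 : E) ε := by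
    intro y hy
    simp only [mem_closedBall_zero_iff, mem_ball_zero_iff] at hy ⊢
    exact hy.trans_lt hx'
  have key := (convex_closedBall (0 : E) ‖x‖).norm_image_sub_le_of_norm_fderiv_le (𝕜 := ℂ)
    (f := f) (C := C * ‖x‖ ^ n) (fun y hy => (hball y (hsub y hy)).1) (fun y hy => by
      refine (hball y (hsub y hy)).2.trans ?_
      rw [norm_pow, norm_norm]
      have : ‖y‖ ≤ ‖x‖ := by simpa using hy
      gcongr) (x := 0) (y := x) (by simp) (by simp)
  rw [h0, sub_zero, sub_zero] at key
  rw [norm_pow, norm_norm, pow_succ, ← mul_assoc]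
  exact key

variable [CompleteSpace F]

theorem isBigO_pow_one {f : E → F} (hf : AnalyticAt ℂ f 0) (h0 : f 0 = 0) :
    f =O[𝓝 0] fun x => ‖x‖ ^ 1 := by
  refine isBigO_pow_succ_of_fderiv (hf.eventually_analyticAt.mono fun _ hx => hx.differentiableAt)
    h0 ?_
  simp only [pow_zero]
  exact hf.fderiv.continuousAt.tendsto.isBigO_one ℝ

theorem isBigO_pow_two {f : E → F} (hf : AnalyticAt ℂ f 0) (h0 : f 0 = 0)
    (h1 : fderiv ℂ f 0 = 0) : f =O[𝓝 0] fun x => ‖x‖ ^ 2 :=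
  isBigO_pow_succ_of_fderiv (hf.eventually_analyticAt.mono fun _ hx => hx.differentiableAt)
    h0 (isBigO_pow_one hf.fderiv h1)

theorem isBigO_pow_four_of_fderiv {f : E → F} (hf : AnalyticAt ℂ f 0) (h0 : f 0 = 0)
    (h1 : fderiv ℂ f 0 = 0) (h2 : fderiv ℂ (fderiv ℂ f) 0 = 0)
    (h3 : fderiv ℂ (fderiv ℂ (fderiv ℂ f)) 0 = 0) : f =O[𝓝 0] fun x => ‖x‖ ^ 4 :=
  isBigO_pow_succ_of_fderiv (hf.eventually_analyticAt.mono fun _ hx => hx.differentiableAt) h0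
    (isBigO_pow_succ_of_fderiv
      (hf.fderiv.eventually_analyticAt.mono fun _ hx => hx.differentiableAt) h1
      (isBigO_pow_two hf.fderiv.fderiv h2 h3))

theorem hasFDerivAt_fderiv_apply {f : E → F} {x : E} (hf : AnalyticAt ℂ f x) (w : E) :
    HasFDerivAt (fun y => fderiv ℂ f y w) ((fderiv ℂ (fderiv ℂ f) x).flip w) x := by
  simpa using (hasFDerivAt_fderiv hf).clm_apply (hasFDerivAt_const w x)

theorem analyticAt_fderiv_apply {f : E → F} {x : E} (hf : AnalyticAt ℂ f x) (w : E) :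
    AnalyticAt ℂ (fun y => fderiv ℂ f y w) x :=
  ((hf.fderiv.contDiffAt (n := ⊤)).clm_apply contDiffAt_const).analyticAt

theorem fderiv_fderiv_fderiv_apply {f : E → F} {x : E} (hf : AnalyticAt ℂ f x) (u v w : E) :
    fderiv ℂ (fderiv ℂ fun y => fderiv ℂ f y w) x u v
      = fderiv ℂ (fderiv ℂ (fderiv ℂ f)) x u v w := by
  rw [← ContinuousLinearMap.flip_apply (fderiv ℂ (fderiv ℂ fun y => fderiv ℂ f y w) x),
    ← (hasFDerivAt_fderiv_apply (analyticAt_fderiv_apply hf w) v).fderiv]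
  have e : (fun y => fderiv ℂ (fun y => fderiv ℂ f y w) y v)
      =ᶠ[𝓝 x] fun y => fderiv ℂ (fderiv ℂ f) y v w := by
    filter_upwards [hf.eventually_analyticAt] with y hy
    rw [(hasFDerivAt_fderiv_apply hy w).fderiv]
    rfl
  rw [e.fderiv_eq]
  have d := (hasFDerivAt_fderiv_apply hf.fderiv v).clm_apply (hasFDerivAt_const w x)
  have d' : fderiv ℂ (fun y => fderiv ℂ (fderiv ℂ f) y v w) x = _ := d.fderiv
  rw [d']
  simp

theorem fderiv_fderiv_comp_clm {E' : Type*} [NormedAddCommGroup E'] [NormedSpace ℂ E']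
    {f : E → F} (i : E' →L[ℂ] E) {y : E'} (hf : AnalyticAt ℂ f (i y)) (v w : E') :
    fderiv ℂ (fderiv ℂ fun y => f (i y)) y v w = fderiv ℂ (fderiv ℂ f) (i y) (i v) (i w) := by
  have e : (fderiv ℂ fun y => f (i y)) =ᶠ[𝓝 y] fun y => (fderiv ℂ f (i y)).comp i := by
    filter_upwards [AnalyticAt.eventually_comp hf i.continuous.continuousAt] with t ht
    exact (ht.differentiableAt.hasFDerivAt.comp t i.hasFDerivAt).fderiv
  rw [e.fderiv_eq]
  have d := (((hasFDerivAt_fderiv hf).comp y i.hasFDerivAt).clm_comp (hasFDerivAt_const i y))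
  have d' : fderiv ℂ (fun y => (fderiv ℂ f (i y)).comp i) y = _ := d.fderiv
  rw [d']
  simp

theorem fderiv_fderiv_eq_star {f g : E → ℂ} {σ : E → E} {x : E}
    (hσ : ∀ x (t : ℂ) v, σ (x + t • v) = σ x + conj t • σ v) (hc : ContinuousAt σ x)
    (hf : AnalyticAt ℂ f x) (hg : AnalyticAt ℂ g (σ x))
    (h : ∀ᶠ y in 𝓝 x, f y = star (g (σ y))) (v w : E) :
    fderiv ℂ (fderiv ℂ f) x v w = star (fderiv ℂ (fderiv ℂ g) (σ x) (σ v) (σ w)) := by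
  have h1 : ∀ᶠ y in 𝓝 x, fderiv ℂ f y w = star (fderiv ℂ g (σ y) (σ w)) := by
    filter_upwards [h.eventually_nhds, hf.eventually_analyticAt, AnalyticAt.eventually_comp hg hc]
      with y e1 e2 e3
    exact fderiv_eq_star_fderiv hσ e2.differentiableAt e3.differentiableAt e1 w
  have := fderiv_eq_star_fderiv hσ (hasFDerivAt_fderiv_apply hf w).differentiableAt
    (hasFDerivAt_fderiv_apply hg (σ w)).differentiableAt h1 v
  rwa [(hasFDerivAt_fderiv_apply hf w).fderiv, (hasFDerivAt_fderiv_apply hg (σ w)).fderiv] at this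

end Taylor

section OrderFour

variable {V : Type*} [NormedAddCommGroup V] [NormedSpace ℂ V] [StarAddMonoid V]
  [NormedStarGroup V] [StarModule ℂ V] {R : V × V → ℂ}

/-- Split each argument of the first three derivatives at `0` into its `z` and `ζ` parts. Pure terms
vanish, terms with a single `ζ` vanish by hypothesis, and terms with a single `z` by conjugation. Up
to degree three there are no others; the first possible term has bidegree `(2, 2)`. -/
theorem isBigO_pow_four (hR : AnalyticAt ℂ R 0) (h1 : ∀ᶠ z in 𝓝 0, R (z, 0) = 0)
    (hs : ∀ᶠ x in 𝓝 0, R x = star (R (star x.2, star x.1)))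
    (hd1 : ∀ w, fderiv ℂ (fun z => fderiv ℂ R (z, 0) (0, w)) 0 = 0)
    (hd2 : ∀ w, fderiv ℂ (fderiv ℂ fun z => fderiv ℂ R (z, 0) (0, w)) 0 = 0) :
    R =O[𝓝 0] fun x => ‖x‖ ^ 4 := by
  let σ : V × V → V × V := fun x => (star x.2, star x.1)
  have hσ : ∀ x (t : ℂ) v, σ (x + t • v) = σ x + conj t • σ v := by
    intro x t v
    simp [σ]
  have hσc : Continuous σ := by fun_prop
  have hσ0 : σ 0 = 0 := by simp [σ, Prod.ext_iff]
  have hσt : Tendsto σ (𝓝 0) (𝓝 0) := tendsto_zero_of_continuousAt hσc.continuousAt hσ0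
  have ht2 : Tendsto (fun ζ : V => ((0 : V), ζ)) (𝓝 0) (𝓝 0) :=
    tendsto_zero_of_continuousAt (by fun_prop) rfl
  have hts : Tendsto (fun ζ : V => star ζ) (𝓝 0) (𝓝 0) :=
    tendsto_zero_of_continuousAt (by fun_prop) (star_zero _)
  have h2 : ∀ᶠ ζ in 𝓝 0, R (0, ζ) = 0 := by
    filter_upwards [ht2.eventually hs, hts.eventually h1] with ζ e1 e2
    rw [e1]
    simp [e2]
  have hsd : ∀ᶠ x in 𝓝 0, ∀ v, fderiv ℂ R x v = star (fderiv ℂ R (σ x) (σ v)) := by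
    filter_upwards [hs.eventually_nhds, hR.eventually_analyticAt,
      AnalyticAt.eventually_comp hR hσt] with x e1 e2 e3 v
    exact fderiv_eq_star_fderiv hσ e2.differentiableAt e3.differentiableAt e1 v
  let i : V →L[ℂ] V × V := ContinuousLinearMap.inl ℂ V V
  let i' : V →L[ℂ] V × V := ContinuousLinearMap.inr ℂ V V
  have hi0 : i 0 = 0 := map_zero i
  have hi0' : i' 0 = 0 := map_zero i'
  have hv1 := eventually_fderiv_eq_zero_of_comp hR i h1
  have hv2 := eventually_fderiv_eq_zero_of_comp hR i' h2
  have hRw : ∀ w, AnalyticAt ℂ (fun x => fderiv ℂ R x w) 0 := analyticAt_fderiv_apply hR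
  have hsplit : ∀ x : V × V, x = i x.1 + i' x.2 := fun x => by simp [i, i']
  have A1 : ∀ v, fderiv ℂ R 0 (i v) = 0 := fun v => by
    have := hv1.1.self_of_nhds v
    rwa [hi0] at this
  have A2 : ∀ w, fderiv ℂ R 0 (i' w) = 0 := fun v => by
    have := hv2.1.self_of_nhds v
    rwa [hi0'] at this
  have hsym : IsSymmSndFDerivAt ℂ R 0 := (hR.contDiffAt (n := ⊤)).isSymmSndFDerivAt (by simp)
  have hsym1 : IsSymmSndFDerivAt ℂ (fderiv ℂ R) 0 :=
    (hR.fderiv.contDiffAt (n := ⊤)).isSymmSndFDerivAt (by simp)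
  have B1 : ∀ v v', fderiv ℂ (fderiv ℂ R) 0 (i v) (i v') = 0 := fun v v' => by
    have := hv1.2.self_of_nhds v v'
    rwa [hi0] at this
  have B2 : ∀ v v', fderiv ℂ (fderiv ℂ R) 0 (i' v) (i' v') = 0 := fun v v' => by
    have := hv2.2.self_of_nhds v v'
    rwa [hi0'] at this
  have B3 : ∀ v w, fderiv ℂ (fderiv ℂ R) 0 (i v) (i' w) = 0 := fun v w => by
    have e : HasFDerivAt (fun x => fderiv ℂ R x (i' w)) ((fderiv ℂ (fderiv ℂ R) 0).flip (i' w))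
        (i 0) := by rw [hi0]; exact hasFDerivAt_fderiv_apply hR _
    have e1 : fderiv ℂ (fun z => fderiv ℂ R (z, 0) (0, w)) 0 = _ :=
      (e.comp (0 : V) i.hasFDerivAt).fderiv
    rw [hd1] at e1
    exact (DFunLike.congr_fun e1 v).symm
  set T := fderiv ℂ (fderiv ℂ (fderiv ℂ R)) 0 with hT
  have hT3 : ∀ (k : V →L[ℂ] V × V), (∀ᶠ y in 𝓝 0, ∀ v, fderiv ℂ R (k y) (k v) = 0) →
      ∀ u v w, T (k u) (k v) (k w) = 0 := fun k hk u v w => by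
    have := (eventually_fderiv_eq_zero_of_comp (hRw (k w)) k
      (hk.mono fun y hy => hy w)).2.self_of_nhds u v
    rwa [map_zero, fderiv_fderiv_fderiv_apply hR] at this
  have C1 := hT3 i hv1.1
  have C2 := hT3 i' hv2.1
  have C3 : ∀ u v w, T (i u) (i v) (i' w) = 0 := fun u v w => by
    have ha : AnalyticAt ℂ (fun x => fderiv ℂ R x (i' w)) (i 0) := by rw [hi0]; exact hRw _
    have := fderiv_fderiv_comp_clm i ha u v
    rw [hi0, fderiv_fderiv_fderiv_apply hR] at this
    rw [hT, ← this]
    have e : (fun y => fderiv ℂ R (i y) (i' w)) = fun z => fderiv ℂ R (z, 0) (0, w) := rfl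
    rw [e, hd2]
    rfl
  -- The conjugation exchanges the two blocks and carries this term to one with a single `ζ`
  -- argument.
  have C4 : ∀ u v w, T (i' u) (i' v) (i w) = 0 := fun u v w => by
    have ha : AnalyticAt ℂ (fun x => fderiv ℂ R x (i w)) (i' 0) := by rw [hi0']; exact hRw _
    have ha' : AnalyticAt ℂ (fun z => fderiv ℂ R (z, 0) (0, star w)) (star 0) := by
      have hb : AnalyticAt ℂ (fun x => fderiv ℂ R x (i' (star w))) (i (star 0)) := by
        rw [star_zero, hi0]; exact hRw _
      exact hb.fun_comp (i.analyticAt _)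
    have := fderiv_fderiv_comp_clm i' ha u v
    rw [hi0', fderiv_fderiv_fderiv_apply hR] at this
    rw [hT, ← this]
    have hst : ∀ (x : V) (t : ℂ) v, star (x + t • v) = star x + conj t • star v := by
      intro x t v
      simp
    have e := fderiv_fderiv_eq_star (σ := fun x : V => star x) hst
      (continuous_star.continuousAt (x := 0)) (ha.fun_comp (i'.analyticAt 0)) ha' (by
        filter_upwards [ht2.eventually hsd] with ζ hζ
        have := hζ (i w)
        simp only [σ, star_zero] at this
        refine this.trans ?_
        simp [i]) u v
    rw [e, star_zero, hd2]
    simp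
  have hT2 : ∀ u v w, T u v w = T v u w := fun u v w => by rw [hT, hsym1.eq u v]
  -- Differentiating the symmetry of the Hessian; with `hT2` this generates all permutations of the
  -- arguments.
  have hT23 : ∀ u v w, T u v w = T u w v := fun u v w => by
    have e : (fun x => fderiv ℂ (fderiv ℂ R) x v w) =ᶠ[𝓝 0]
        fun x => fderiv ℂ (fderiv ℂ R) x w v := by
      filter_upwards [hR.eventually_analyticAt] with x hx
      exact ((hx.contDiffAt (n := ⊤)).isSymmSndFDerivAt (by simp)).eq v w
    have hd : ∀ v w, fderiv ℂ (fun x => fderiv ℂ (fderiv ℂ R) x v w) 0 u = T u v w := fun v w => by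
      have d := (hasFDerivAt_fderiv_apply hR.fderiv v).clm_apply (hasFDerivAt_const w (0 : V × V))
      have d' : fderiv ℂ (fun y => fderiv ℂ (fderiv ℂ R) y v w) 0 = _ := d.fderiv
      rw [d']
      simp [hT]
    rw [← hd v w, e.fderiv_eq, hd w v]
  refine isBigO_pow_four_of_fderiv hR h1.self_of_nhds ?_ ?_ ?_
  · refine ContinuousLinearMap.ext fun x => ?_
    rw [hsplit x, map_add, A1, A2]
    simp
  · refine ContinuousLinearMap.ext fun x => ContinuousLinearMap.ext fun y => ?_
    rw [hsplit x, hsplit y]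
    simp only [map_add, add_apply, B1, B2, B3, hsym.eq (i' x.2) (i y.1)]
    simp
  · refine ContinuousLinearMap.ext fun x => ContinuousLinearMap.ext fun y =>
      ContinuousLinearMap.ext fun w => ?_
    have D1 : ∀ u v w, T (i u) (i' v) (i w) = 0 := fun u v w => by rw [hT23, C3]
    have D2 : ∀ u v w, T (i' u) (i v) (i w) = 0 := fun u v w => by rw [hT2, D1]
    have D3 : ∀ u v w, T (i' u) (i v) (i' w) = 0 := fun u v w => by rw [hT23, C4]
    have D4 : ∀ u v w, T (i u) (i' v) (i' w) = 0 := fun u v w => by rw [hT2, D3]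
    rw [← hT, hsplit x, hsplit y, hsplit w]
    simp only [map_add, add_apply, C1, C2, C3, C4, D1, D2, D3, D4]
    simp

end OrderFour

end CRGeometry

end

/-! ### The two remainders and the final coordinates. -/

noncomputable section

namespace CRGeometry

/-- The model `z₁ζ₁ + z₁²ζ₂/2 + z₂ζ₁²/2`. -/
def modelPoly (x : (Fin 2 → ℂ) × (Fin 2 → ℂ)) : ℂ :=
  x.1 0 * x.2 0 + 1 / 2 * x.1 0 ^ 2 * x.2 1 + 1 / 2 * x.1 1 * x.2 0 ^ 2

theorem contDiff_modelPoly : ContDiff ℂ ⊤ modelPoly := by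
  have hz : ∀ j, ContDiff ℂ ⊤ fun x : (Fin 2 → ℂ) × (Fin 2 → ℂ) => x.1 j := by fun_prop
  have hζ : ∀ j, ContDiff ℂ ⊤ fun x : (Fin 2 → ℂ) × (Fin 2 → ℂ) => x.2 j := by fun_prop
  exact (((hz 0).mul (hζ 0)).add ((contDiff_const.mul ((hz 0).pow 2)).mul (hζ 1))).add
    ((contDiff_const.mul (hz 1)).mul ((hζ 0).pow 2))

/-- The part of `F` independent of `u`, without its model part. -/
def remainder (F : (Fin 2 → ℂ) × (Fin 2 → ℂ) × ℂ → ℂ) (x : (Fin 2 → ℂ) × (Fin 2 → ℂ)) : ℂ :=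
  F (x.1, x.2, 0) - modelPoly x

section

variable {M : LocalHypersurface 3} {ψ : (Fin 2 → ℂ) × ℂ → (Fin 3 → ℂ)}
  {F : (Fin 2 → ℂ) × (Fin 2 → ℂ) × ℂ → ℂ}

theorem analyticAt_remainder (hF : AnalyticAt ℂ F 0) : AnalyticAt ℂ (remainder F) 0 :=
  (analyticAt_comp (f := fun x : (Fin 2 → ℂ) × (Fin 2 → ℂ) => (x.1, x.2, (0 : ℂ))) hF
    (by fun_prop) rfl).sub contDiff_modelPoly.contDiffAt.analyticAt

theorem IsNormalForm.remainder_right (h : IsNormalForm M ψ F) :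
    ∀ᶠ z in 𝓝 0, remainder F (z, 0) = 0 := by
  have h1 : Tendsto (fun z : Fin 2 → ℂ => (z, (0 : ℂ))) (𝓝 0) (𝓝 0) :=
    tendsto_zero_of_continuousAt (by fun_prop) rfl
  filter_upwards [h1.eventually h.graph_right] with z hz
  simp [remainder, modelPoly, hz]

theorem IsNormalForm.remainder_left (h : IsNormalForm M ψ F) :
    ∀ᶠ z in 𝓝 0, remainder F (0, z) = 0 := by
  have h1 : Tendsto (fun z : Fin 2 → ℂ => (z, (0 : ℂ))) (𝓝 0) (𝓝 0) :=
    tendsto_zero_of_continuousAt (by fun_prop) rfl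
  filter_upwards [h1.eventually h.graph_left] with z hz
  simp [remainder, modelPoly, hz]

theorem IsNormalForm.remainder_star (h : IsNormalForm M ψ F) :
    ∀ᶠ x in 𝓝 0, remainder F x = star (remainder F (star x.2, star x.1)) := by
  have h1 : Tendsto (fun x : (Fin 2 → ℂ) × (Fin 2 → ℂ) => (x.1, x.2, (0 : ℂ))) (𝓝 0) (𝓝 0) :=
    tendsto_zero_of_continuousAt (by fun_prop) rfl
  filter_upwards [h1.eventually h.graph_star] with x hx
  simp only [star_zero] at hx
  simp only [remainder, star_sub, hx, modelPoly]
  simp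
  ring

theorem fderiv_remainder (hF : AnalyticAt ℂ F 0) : ∀ᶠ z in 𝓝 0, ∀ w,
    fderiv ℂ (remainder F) (z, 0) (0, w)
      = w 0 * (gmap F z 0 - z 0) + w 1 * (gmap F z 1 - 1 / 2 * z 0 ^ 2) := by
  filter_upwards [AnalyticAt.eventually_comp hF tendsto_zSection,
    AnalyticAt.eventually_comp (analyticAt_remainder hF) (k := fun z : Fin 2 → ℂ =>
      (z, (0 : Fin 2 → ℂ))) (tendsto_zero_of_continuousAt (by fun_prop) rfl)] with z e1 e2 w
  have d1 := (hasDerivAt_smul_const_zero ((0, w) : (Fin 2 → ℂ) × (Fin 2 → ℂ))).const_add (z, 0)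
  refine fderiv_apply_eq_of_hasDerivAt_comp e2.differentiableAt d1 (by simp) ?_
  have d2 : HasFDerivAt F (fderiv ℂ F (z, 0, 0))
      ((z, (0 : Fin 2 → ℂ), (0 : ℂ)) + (0 : ℂ) • ((0, w, 0) : (Fin 2 → ℂ) × (Fin 2 → ℂ) × ℂ)) := by
    rw [zero_smul, add_zero]; exact e1.differentiableAt.hasFDerivAt
  have d3 := d2.comp_hasDerivAt (0 : ℂ) ((hasDerivAt_smul_const_zero
    ((0, w, 0) : (Fin 2 → ℂ) × (Fin 2 → ℂ) × ℂ)).const_add (z, (0 : Fin 2 → ℂ), (0 : ℂ)))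
  have di := hasDerivAt_id (0 : ℂ)
  have d4 := ((di.mul_const (w 0)).const_mul (z 0)).add
    ((di.mul_const (w 1)).const_mul (1 / 2 * z 0 ^ 2)) |>.add
    (((di.mul_const (w 0)).pow 2).const_mul (1 / 2 * z 1))
  have d5 := d3.sub d4
  convert! d5 using 1
  · ext t
    simp [remainder, modelPoly]
  · rw [fderiv_apply_mid]
    simp [Fin.sum_univ_two, gmap]
    ring

/-- The terms of the remainder linear in `ζ` have coefficients `g₁ - z₁ = 0` and `φ = g₂ - z₁²/2`,
and the derivatives of `φ` of orders one and two vanish at `0` by the normalization. -/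
theorem IsNormalForm.remainder_isBigO (h : IsNormalForm M ψ F) (hN : IsNormalized F) :
    remainder F =O[𝓝 0] fun x => ‖x‖ ^ 4 := by
  have hg := analyticAt_gmap h.analyticAt_graph
  let φ : (Fin 2 → ℂ) → ℂ := fun z => gmap F z 1 - 1 / 2 * z 0 ^ 2
  have hq : ∀ w, (fun z => fderiv ℂ (remainder F) (z, 0) (0, w)) =ᶠ[𝓝 0] fun z => w 1 • φ z := by
    intro w
    filter_upwards [fderiv_remainder h.analyticAt_graph, hN.gmap_zero] with z e1 e2
    rw [e1, e2]
    simp [φ]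
  have hφ : ∀ᶠ z in 𝓝 0, HasFDerivAt φ ((ContinuousLinearMap.proj 1).comp (fderiv ℂ (gmap F) z)
      - z 0 • ContinuousLinearMap.proj 0) z := by
    filter_upwards [hg.eventually_analyticAt] with z hz
    have d0 : HasFDerivAt (fun z : Fin 2 → ℂ => z 0)
      (ContinuousLinearMap.proj (R := ℂ) (φ := fun _ : Fin 2 => ℂ) 0) z :=
      (ContinuousLinearMap.proj (R := ℂ) (φ := fun _ : Fin 2 => ℂ) 0).hasFDerivAt
    have d1 := (hasFDerivAt_gmap_apply hz 1).sub ((d0.pow 2).const_mul (1 / 2 : ℂ))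
    convert! d1 using 1
    ext v
    simp
    ring
  have hφ1 : fderiv ℂ φ 0 = 0 := by
    rw [hφ.self_of_nhds.fderiv]
    refine ContinuousLinearMap.ext fun v => ?_
    simp [hN.gmap_one_fderiv]
  have hsym : IsSymmSndFDerivAt ℂ (gmap F) 0 :=
    (hg.contDiffAt (n := ⊤)).isSymmSndFDerivAt (by simp)
  have hD1 : ∀ v, fderiv ℂ (fderiv ℂ (gmap F)) 0 v (Pi.single 1 1) 1 = 0 := fun v => by
    have e := (hasFDerivAt_pi'.1 (hasFDerivAt_fderiv_apply hg (Pi.single 1 1)) 1).unique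
      ((hasFDerivAt_const (0 : ℂ) (0 : Fin 2 → ℂ)).congr_of_eventuallyEq hN.gmap_one)
    exact DFunLike.congr_fun e v
  have hD : ∀ v w, fderiv ℂ (fderiv ℂ (gmap F)) 0 v w 1 = v 0 * w 0 := fun v w => by
    have hv : ∀ v : Fin 2 → ℂ, v = v 0 • Pi.single 0 1 + v 1 • Pi.single 1 1 := by
      intro v
      ext j; fin_cases j <;> simp
    have e1 : fderiv ℂ (fderiv ℂ (gmap F)) 0 (Pi.single 1 1) w 1 = 0 := by
      rw [hsym.eq, hD1]
    conv_lhs => rw [hv v]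
    rw [map_add, map_smul, map_smul]
    simp only [add_apply, smul_apply, Pi.add_apply, Pi.smul_apply, e1]
    conv_lhs => rw [hv w]
    simp [hD1, hN.gmap_one_sndFDeriv]
  have hφa : AnalyticAt ℂ φ 0 :=
    (analyticAt_pi_iff.1 hg 1).sub (analyticAt_const.mul
      (((ContinuousLinearMap.proj (R := ℂ) (φ := fun _ : Fin 2 => ℂ) 0).analyticAt 0).pow 2))
  have hφ2 : fderiv ℂ (fderiv ℂ φ) 0 = 0 := by
    refine ContinuousLinearMap.ext fun v => ContinuousLinearMap.ext fun w => ?_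
    have e1 : (fun z => fderiv ℂ φ z w) =ᶠ[𝓝 0] fun z => fderiv ℂ (gmap F) z w 1 - z 0 * w 0 := by
      filter_upwards [hφ] with z hz
      rw [hz.fderiv]
      simp
    have d0 : HasFDerivAt (fun z : Fin 2 → ℂ => z 0)
      (ContinuousLinearMap.proj (R := ℂ) (φ := fun _ : Fin 2 => ℂ) 0) 0 :=
      (ContinuousLinearMap.proj (R := ℂ) (φ := fun _ : Fin 2 => ℂ) 0).hasFDerivAt
    have d1 := (hasFDerivAt_pi'.1 (hasFDerivAt_fderiv_apply hg w) 1).sub (d0.mul_const' (w 0))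
    have d2 := (hasFDerivAt_fderiv_apply hφa w).unique (d1.congr_of_eventuallyEq e1)
    have d3 := DFunLike.congr_fun d2 v
    simp only [ContinuousLinearMap.flip_apply] at d3
    rw [d3]
    simp [hD, mul_comm]
  have hd1 : ∀ w : Fin 2 → ℂ, fderiv ℂ (fun z => w 1 • φ z) =ᶠ[𝓝 0] fun z => w 1 • fderiv ℂ φ z := by
    intro w
    filter_upwards [hφ] with z hz
    exact (hz.differentiableAt.hasFDerivAt.const_smul (w 1)).fderiv
  refine isBigO_pow_four (analyticAt_remainder h.analyticAt_graph) h.remainder_right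
    h.remainder_star (fun w => ?_) fun w => ?_
  · rw [(hq w).fderiv_eq]
    have d := (hφa.differentiableAt.hasFDerivAt.const_smul (w 1)).fderiv
    rw [hφ1, smul_zero] at d
    exact d
  · rw [((hq w).fderiv).fderiv_eq, (hd1 w).fderiv_eq]
    have d := (hφa.fderiv.differentiableAt.hasFDerivAt.const_smul (w 1)).fderiv
    rw [hφ2, smul_zero] at d
    exact d

/-- `F(z, ζ, u) - F(z, ζ, 0)` vanishes on `u = 0`, so it is divisible by `u`. Reality and vanishing
for `z = 0` or `ζ = 0` hold for `uS`, hence for `S` where `u ≠ 0`, and then everywhere by density.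
-/
theorem IsNormalForm.exists_quotient (h : IsNormalForm M ψ F) :
    ∃ S : (Fin 2 → ℂ) × (Fin 2 → ℂ) × ℂ → ℂ, AnalyticAt ℂ S 0 ∧
      (∀ᶠ x in 𝓝 0, F x = F (x.1, x.2.1, 0) + x.2.2 * S x) ∧
      (∀ᶠ x : (Fin 2 → ℂ) × ℝ in 𝓝 0, (S (x.1, star x.1, (x.2 : ℂ))).im = 0) ∧
      S =O[𝓝 0] (fun x => ‖x‖ ^ 2) ∧
      (∀ᶠ x : (Fin 2 → ℂ) × ℂ in 𝓝 0, S (0, x.1, x.2) = 0) ∧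
      ∀ᶠ x : (Fin 2 → ℂ) × ℂ in 𝓝 0, S (x.1, 0, x.2) = 0 := by
  let ℓ : ((Fin 2 → ℂ) × (Fin 2 → ℂ) × ℂ) →L[ℂ] ℂ :=
    (ContinuousLinearMap.snd ℂ _ _).comp (ContinuousLinearMap.snd ℂ _ _)
  obtain ⟨S, hS, hdiv⟩ := exists_division h.analyticAt_graph ℓ (0, 0, 1)
  have hdiv' : ∀ᶠ x in 𝓝 0, F x = F (x.1, x.2.1, 0) + x.2.2 * S x := by
    filter_upwards [hdiv] with x hx
    have e : x - ℓ x • ((0, 0, 1) : (Fin 2 → ℂ) × (Fin 2 → ℂ) × ℂ) = (x.1, x.2.1, 0) := by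
      ext <;> simp [ℓ]
    rw [e, smul_eq_mul] at hx
    rw [← sub_eq_iff_eq_add']
    exact hx
  have hSa : ∀ {G : Type} [TopologicalSpace G] {k : G → (Fin 2 → ℂ) × (Fin 2 → ℂ) × ℂ} {y : G},
      Continuous k → k y = 0 → ∀ᶠ t in 𝓝 y, ContinuousAt (fun t => S (k t)) t := by
    intro G _ k y hk hky
    have ht : Tendsto k (𝓝 y) (𝓝 0) := hky ▸ hk.continuousAt.tendsto
    filter_upwards [AnalyticAt.eventually_comp hS ht] with t hta
    exact hta.continuousAt.comp hk.continuousAt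
  have t0 : Tendsto (fun x : (Fin 2 → ℂ) × ℂ => (x.1, (0 : ℂ))) (𝓝 0) (𝓝 0) :=
    tendsto_zero_of_continuousAt (by fun_prop) rfl
  have hleft : ∀ᶠ x : (Fin 2 → ℂ) × ℂ in 𝓝 0, S (0, x.1, x.2) = 0 := by
    have t1 : Tendsto (fun x : (Fin 2 → ℂ) × ℂ => ((0 : Fin 2 → ℂ), x.1, x.2)) (𝓝 0) (𝓝 0) :=
      tendsto_zero_of_continuousAt (by fun_prop) rfl
    refine eventually_eq_zero_of_dense (hSa (by fun_prop) rfl)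
      (ContinuousLinearMap.snd ℝ (Fin 2 → ℂ) ℂ)
      (fun hz => by simpa using DFunLike.congr_fun hz ((0, 1) : (Fin 2 → ℂ) × ℂ)) ?_
    filter_upwards [t1.eventually hdiv', h.graph_left, t0.eventually h.graph_left]
      with x e1 e2 e3 hx
    rw [e2, e3, zero_add] at e1
    exact (mul_eq_zero.1 e1.symm).resolve_left hx
  have hright : ∀ᶠ x : (Fin 2 → ℂ) × ℂ in 𝓝 0, S (x.1, 0, x.2) = 0 := by
    have t1 : Tendsto (fun x : (Fin 2 → ℂ) × ℂ => (x.1, (0 : Fin 2 → ℂ), x.2)) (𝓝 0) (𝓝 0) :=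
      tendsto_zero_of_continuousAt (by fun_prop) rfl
    refine eventually_eq_zero_of_dense (hSa (by fun_prop) rfl)
      (ContinuousLinearMap.snd ℝ (Fin 2 → ℂ) ℂ)
      (fun hz => by simpa using DFunLike.congr_fun hz ((0, 1) : (Fin 2 → ℂ) × ℂ)) ?_
    filter_upwards [t1.eventually hdiv', h.graph_right, t0.eventually h.graph_right]
      with x e1 e2 e3 hx
    rw [e2, e3, zero_add] at e1
    exact (mul_eq_zero.1 e1.symm).resolve_left hx
  refine ⟨S, hS, hdiv', ?_, ?_, hleft, hright⟩
  · have t1 : Tendsto (fun x : (Fin 2 → ℂ) × ℝ => (x.1, star x.1, (x.2 : ℂ))) (𝓝 0) (𝓝 0) :=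
      tendsto_zero_of_continuousAt (by fun_prop) (by simp [Prod.ext_iff])
    have t2 : Tendsto (fun x : (Fin 2 → ℂ) × ℝ => (x.1, star x.1, (0 : ℂ))) (𝓝 0) (𝓝 0) :=
      tendsto_zero_of_continuousAt (by fun_prop) (by simp [Prod.ext_iff])
    refine eventually_eq_zero_of_dense
      ((hSa (k := fun x : (Fin 2 → ℂ) × ℝ => (x.1, star x.1, (x.2 : ℂ))) (by fun_prop)
        (by simp [Prod.ext_iff])).mono
        fun x hx => Complex.continuous_im.continuousAt.comp hx)
      (ContinuousLinearMap.snd ℝ (Fin 2 → ℂ) ℝ)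
      (fun hz => by simpa using DFunLike.congr_fun hz ((0, 1) : (Fin 2 → ℂ) × ℝ)) ?_
    filter_upwards [t1.eventually hdiv', t1.eventually h.graph_real, t2.eventually h.graph_real]
      with x e1 e2 e3 hx
    have e4 := congrArg Complex.im e1
    rw [Complex.add_im, ← e2 ⟨rfl, by simp⟩, ← e3 ⟨rfl, by simp⟩] at e4
    simp only [Complex.ofReal_im, zero_add, Complex.im_ofReal_mul] at e4
    exact (mul_eq_zero.1 e4.symm).resolve_left hx
  -- `S` vanishes on two subspaces that span, so its value and its differential at `0` are zero.
  · let i : ((Fin 2 → ℂ) × ℂ) →L[ℂ] ((Fin 2 → ℂ) × (Fin 2 → ℂ) × ℂ) :=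
      (ContinuousLinearMap.fst ℂ (Fin 2 → ℂ) ℂ).prod
        ((0 : _ →L[ℂ] (Fin 2 → ℂ)).prod (ContinuousLinearMap.snd ℂ (Fin 2 → ℂ) ℂ))
    let i' : ((Fin 2 → ℂ) × ℂ) →L[ℂ] ((Fin 2 → ℂ) × (Fin 2 → ℂ) × ℂ) :=
      ContinuousLinearMap.inr ℂ (Fin 2 → ℂ) ((Fin 2 → ℂ) × ℂ)
    refine isBigO_pow_two hS hleft.self_of_nhds (ContinuousLinearMap.ext fun x => ?_)
    have e1 := (eventually_fderiv_eq_zero_of_comp hS i hright).1.self_of_nhds (x.1, x.2.2)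
    have e2 := (eventually_fderiv_eq_zero_of_comp hS i' hleft).1.self_of_nhds (x.2.1, 0)
    rw [map_zero] at e1 e2
    have e : x = i (x.1, x.2.2) + i' (x.2.1, 0) := by simp [i, i']
    rw [e, map_add, e1, e2]
    simp

/-- The isomorphism `((z₁, z₂), w) ↦ (z₁, z₂, w)`. -/
def coordEquiv : ((Fin 2 → ℂ) × ℂ) ≃L[ℂ] (Fin 3 → ℂ) :=
  LinearEquiv.toContinuousLinearEquiv
    { toFun := fun y => ![y.1 0, y.1 1, y.2]
      invFun := fun q => (![q 0, q 1], q 2)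
      map_add' := fun x y => by ext j; fin_cases j <;> simp
      map_smul' := fun c x => by ext j; fin_cases j <;> simp
      left_inv := fun y => by
        ext j
        · fin_cases j <;> simp
        · simp
      right_inv := fun q => by ext j; fin_cases j <;> simp }

/-- Restricting the source of the parametrization to an open set where `p` and the analyticity of
both maps hold turns statements near `0` into statements on the whole target. -/
theorem IsNormalForm.exists_coordinates (h : IsNormalForm M ψ F)
    {p : (Fin 2 → ℂ) × ℂ → Prop} (hp : ∀ᶠ y in 𝓝 0, p y) :
    ∃ Φ : OpenPartialHomeomorph (Fin 3 → ℂ) (Fin 3 → ℂ), (0 ∈ Φ.source ∧ Φ 0 = 0 ∧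
      AnalyticOnNhd ℂ Φ Φ.source ∧ AnalyticOnNhd ℂ Φ.symm Φ.target) ∧
      ∀ q ∈ Φ.target, Φ.symm q = ψ (![q 0, q 1], q 2) ∧ p (![q 0, q 1], q 2) := by
  obtain ⟨e, he, he0, hea⟩ := h.exists_openPartialHomeomorph
  have tψ : Tendsto ψ (𝓝 0) (𝓝 0) :=
    tendsto_zero_of_continuousAt h.analyticAt_param.continuousAt h.param_zero
  obtain ⟨s, hs, hso, hs0⟩ := eventually_nhds_iff.1 (hp.and
    (h.analyticAt_param.eventually_analyticAt.and (AnalyticAt.eventually_comp hea tψ)))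
  let e' := e.restrOpen s hso
  have he' : ∀ y, e' y = ψ y := he
  have hsrc : ∀ y ∈ e'.source, y ∈ s := fun y hy => by
    have : y ∈ e.source ∩ s := by simpa [e'] using hy
    exact this.2
  have h0src : (0 : (Fin 2 → ℂ) × ℂ) ∈ e'.source := by
    have : (0 : (Fin 2 → ℂ) × ℂ) ∈ e.source ∩ s := ⟨he0, hs0⟩
    simpa [e'] using this
  have h00 : e' 0 = 0 := by rw [he', h.param_zero]
  have hsymm : ∀ x, e'.symm x = e.symm x := fun x => rfl
  refine ⟨e'.symm.transHomeomorph coordEquiv.toHomeomorph, ⟨?_, ?_, ?_, ?_⟩, ?_⟩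
  · have := e'.map_source h0src
    rw [h00] at this
    exact this
  · have h1 : e'.symm 0 = 0 := by rw [← h00, e'.left_inv h0src]
    have : coordEquiv (e'.symm 0) = 0 := by rw [h1, map_zero]
    exact this
  · intro x hx
    have hx' : x ∈ e'.target := hx
    have h1 := (hs _ (hsrc _ (e'.map_target hx'))).2.2
    rw [← he', e'.right_inv hx'] at h1
    exact (coordEquiv.analyticAt _).comp h1
  · intro q hq
    have hq' : coordEquiv.symm q ∈ e'.source := hq
    have h1 := (hs _ (hsrc _ hq')).2.1
    have h2 : AnalyticAt ℂ (fun q => ψ (coordEquiv.symm q)) q :=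
      h1.fun_comp (coordEquiv.symm.analyticAt q)
    simp_rw [← he'] at h2
    exact h2
  · intro q hq
    have hq' : coordEquiv.symm q ∈ e'.source := hq
    exact ⟨he' _, (hs _ (hsrc _ hq')).1⟩

end

end CRGeometry

end

theorem mainTheorem8 (M : CRGeometry.LocalHypersurface 3)
    (h0 : (0 : Fin 3 → ℂ) ∈ M.carrier)
    (hLevi : ∀ p ∈ M.carrier, M.leviRank p = 1)
    (hFreeman : ∀ p ∈ M.carrier, M.FreemanNondegenerate p) :
    ∃ (Φ : OpenPartialHomeomorph (Fin 3 → ℂ) (Fin 3 → ℂ))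
      (R : (Fin 2 → ℂ) × (Fin 2 → ℂ) → ℂ)
      (S : (Fin 2 → ℂ) × (Fin 2 → ℂ) × ℂ → ℂ),
      -- local holomorphic coordinates `(z_1, z_2, w) = Φ` centred at the origin
      (0 ∈ Φ.source ∧ Φ 0 = 0 ∧
        AnalyticOnNhd ℂ Φ Φ.source ∧ AnalyticOnNhd ℂ Φ.symm Φ.target) ∧
      -- `R(z, z̄)` and `S(z, z̄, u)` are convergent power series, real for real `u`
      (AnalyticAt ℂ R 0 ∧ AnalyticAt ℂ S 0 ∧
        (∀ᶠ z : Fin 2 → ℂ in 𝓝 0, (R (z, star z)).im = 0) ∧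
        (∀ᶠ x : (Fin 2 → ℂ) × ℝ in 𝓝 0, (S (x.1, star x.1, (x.2 : ℂ))).im = 0)) ∧
      -- of orders at least 4 and 2
      (R =O[𝓝 0] (fun x => ‖x‖ ^ 4) ∧ S =O[𝓝 0] (fun x => ‖x‖ ^ 2)) ∧
      -- which vanish identically for `z = 0` and for `z̄ = 0`, as series in independent variables
      ((∀ᶠ z : Fin 2 → ℂ in 𝓝 0, R (0, z) = 0 ∧ R (z, 0) = 0) ∧
        (∀ᶠ x : (Fin 2 → ℂ) × ℂ in 𝓝 0, S (0, x.1, x.2) = 0 ∧ S (x.1, 0, x.2) = 0)) ∧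
      -- the equation of `M` in these coordinates
      ∀ q ∈ Φ.target, Φ.symm q ∈ M.carrier ↔
        ((q 2).im : ℂ) = q 0 * conj (q 0) + 1 / 2 * (q 0) ^ 2 * conj (q 1)
          + 1 / 2 * q 1 * (conj (q 0)) ^ 2
          + R (![q 0, q 1], star ![q 0, q 1])
          + ((q 2).re : ℂ) * S (![q 0, q 1], star ![q 0, q 1], ((q 2).re : ℂ)) := by
  obtain ⟨ψ, F, h, hN⟩ := CRGeometry.LocalHypersurface.exists_isNormalized h0 hLevi (hFreeman 0 h0)
  obtain ⟨S, hS, hdiv, hreal, hSO, hleft, hright⟩ := h.exists_quotient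
  have t1 : Tendsto (fun y : (Fin 2 → ℂ) × ℂ => (y.1, star y.1, (y.2.re : ℂ))) (𝓝 0) (𝓝 0) :=
    CRGeometry.tendsto_zero_of_continuousAt (by fun_prop) (by simp [Prod.ext_iff])
  obtain ⟨Φ, hΦ, hΦM⟩ := h.exists_coordinates (h.mem_iff.and (t1.eventually hdiv))
  have t2 : Tendsto (fun z : Fin 2 → ℂ => (z, star z)) (𝓝 0) (𝓝 0) :=
    CRGeometry.tendsto_zero_of_continuousAt (by fun_prop) (by simp [Prod.ext_iff])
  refine ⟨Φ, CRGeometry.remainder F, S, hΦ, ⟨CRGeometry.analyticAt_remainder h.analyticAt_graph, hS,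
    ?_, hreal⟩, ⟨h.remainder_isBigO hN, hSO⟩, ⟨h.remainder_left.and h.remainder_right,
    hleft.and hright⟩, fun q hq => ?_⟩
  · filter_upwards [t2.eventually h.remainder_star] with z hz
    simp only [star_star] at hz
    exact Complex.conj_eq_iff_im.1 hz.symm
  · obtain ⟨e1, e2, e3⟩ := hΦM q hq
    simp only at e2 e3
    rw [e1, e2, e3]
    simp only [CRGeometry.remainder, CRGeometry.modelPoly]
    simp
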